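/- Let $p$ be an odd prime, let $n\ge 1$, and let $H = E(x_1,\dots,x_n)\otimes P[y_1,\dots,y_n]$ be the tensor product of an exterior and a polynomial algebra over $\mathbb{Z}/p$, graded by $|x_i|=1$, $|y_i|=2$ (so $H\cong H^*(BV^n;\mathbb{Z}/p)$, where $V^n$ is an $n$-dimensional vector space over $\mathbb{Z}/p$). The mod-$p$ Steenrod algebra $\mathcal{A}$, generated by $\beta$ and the $P^k$, acts on $H$ by $\beta x_i=y_i$, $\beta y_i=0$, $P^0=\mathrm{id}$, $P^k x_i=0$ for $k>0$, $P^1y_i=y_i^p$, $P^ky_i=0$ for $k>1$, and the Cartan formulas. Put: * $d_{n,i}$ ($1\le i\le n$): the Dickson invariants, defined by $\prod_{v}(X-v)=X^{p^n}+\sum_{i=1}^n(-1)^i d_{n,i}X^{p^{n-i}}$, where $v$ runs through all $\mathbb{Z}/p$-linear combinations of $y_1,\dots,y_n$; * $L_n=\det\big(y_j^{p^{i}}\big)_{0\le i\le n-1,\ 1\le j\le n}$; * $M_{n;s_1,\dots,s_m}$ ($0\le s_1<\dots<s_m\le n-1$, $m\le 2$): $\frac1{m!}$ times the determinant (the factors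 of each product ordered by rows) whose first $m$ rows are $(x_1,\dots,x_n)$ and whose remaining rows are $(y_1^{p^t},\dots,y_n^{p^t})$, for $t\in\{0,\dots,n-1\}\setminus\{s_1,\dots,s_m\}$ in increasing order. Let $SD_n\subseteq H$ be the subalgebra generated by all $d_{n,s+1}$, $M_{n;s}L_n^{p-2}$ ($0\le s\le n-1$) and $M_{n;s_1,s_2}L_n^{p-2}$ ($0\le s_1<s_2\le n-1$); let $\overline{SD_n}$ be its part of positive degree; and let $I_n$ be the ideal of $SD_n$ generated by $d_{n,n}$, the $M_{n;i}L_n^{p-2}$ ($0\le i\le n-1$) and the $M_{n;0,i}L_n^{p-2}$ ($1\le i\le n-1$). A graded $\mathcal{A}$-module $N$ is called atomic if every degree preserving $\mathcal{A}$-linear map $f:N\to N$ that is an isomorphism in the lowest positive degree in which $N\neq0$ is an isomorphism. **Proposition.** $SD_n$, $\overline{SD_n}$ and $I_n$ are graded $\mathcal{A}$-submodules of $H$, and: (a) $\overline{SD_n}$ is atomic. Moreover, if a degree preserving $\mathcal{A}$-linear map $f:SD_n\to SD_n$ is an isomorphism in the lowest positive degree in which $SD_n\ne0$, then $f$ is an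 isomorphism in every positive degree, and $f$ is an isomorphism if and only if $f(1)\neq0$. (b) $I_n$ is atomic. -/

import Mathlib

open scoped TensorProduct

noncomputable section

namespace DicksonAtomic

/-- The ring `E(x_1, …, x_n) ⊗ P[y_1, …, y_n]` over `ℤ/p`, which for `p` odd is `H^*(BV^n; ℤ/p)`
(the `y_i` have even degree, so no sign enters the product of the tensor product). -/
abbrev Coh (p n : ℕ) : Type :=
  ExteriorAlgebra (ZMod p) (Fin n → ZMod p) ⊗[ZMod p] MvPolynomial (Fin n) (ZMod p)

variable (p n : ℕ)

/-- The exterior generator `x_i`. -/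
def x (i : Fin n) : Coh p n := ExteriorAlgebra.ι (ZMod p) (Pi.single i (1 : ZMod p)) ⊗ₜ 1

/-- The inclusion of the polynomial subalgebra `P[y_1, …, y_n]`. -/
def incl : MvPolynomial (Fin n) (ZMod p) →ₐ[ZMod p] Coh p n :=
  Algebra.TensorProduct.includeRight

/-- The polynomial generator `y_i`. -/
def y (i : Fin n) : Coh p n := incl p n (MvPolynomial.X i)

/-- The part of degree `d`, where `|x_i| = 1` and `|y_i| = 2`. -/
def degPart (d : ℕ) : Submodule (ZMod p) (Coh p n) :=
  Submodule.span (ZMod p) {z | ∃ (i j : ℕ) (a : ExteriorAlgebra (ZMod p) (Fin n → ZMod p))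
    (b : MvPolynomial (Fin n) (ZMod p)), i + 2 * j = d ∧ a ∈ ⋀[ZMod p]^i (Fin n → ZMod p) ∧
      b.IsHomogeneous j ∧ z = a ⊗ₜ b}

/-! ### The action of the Steenrod algebra -/

/-- The Bockstein `β`: the graded derivation with `β x_i = y_i` and `β y_i = 0`, that is
`∑ i, ∂/∂x_i ⊗ (y_i ·)`, where `∂/∂x_i` is the contraction with the `i`-th coordinate. -/
def bockstein : Coh p n →ₗ[ZMod p] Coh p n :=
  ∑ i : Fin n, TensorProduct.map
    (CliffordAlgebra.contractLeft (Q := (0 : QuadraticForm (ZMod p) (Fin n → ZMod p)))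
      (LinearMap.proj i))
    (LinearMap.mulLeft (ZMod p) (MvPolynomial.X i : MvPolynomial (Fin n) (ZMod p)))

/-- The total reduced power on polynomials: the ring homomorphism with `y_i ↦ y_i + y_i ^ p T`. -/
def totalPower : MvPolynomial (Fin n) (ZMod p) →ₐ[ZMod p]
    Polynomial (MvPolynomial (Fin n) (ZMod p)) :=
  MvPolynomial.aeval fun i =>
    Polynomial.C (MvPolynomial.X i) + Polynomial.C (MvPolynomial.X i ^ p) * Polynomial.X

/-- The reduced power `P^k` on polynomials: the coefficient of `T ^ k` in the total power. -/
def polyPower (k : ℕ) :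
    MvPolynomial (Fin n) (ZMod p) →ₗ[ZMod p] MvPolynomial (Fin n) (ZMod p) :=
  (Polynomial.lcoeff (MvPolynomial (Fin n) (ZMod p)) k).restrictScalars (ZMod p) ∘ₗ
    (totalPower p n).toLinearMap

/-- The reduced power `P^k`. By the Cartan formula and `P^k x_i = 0` for `k > 0`, it is linear over
the exterior algebra. -/
def power (k : ℕ) : Coh p n →ₗ[ZMod p] Coh p n :=
  LinearMap.lTensor (ExteriorAlgebra (ZMod p) (Fin n → ZMod p)) (polyPower p n k)

/-- A graded submodule over the Steenrod algebra `𝒜`, which is generated by `β` and the `P^k`. -/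
structure IsSteenrodSubmodule (N : Submodule (ZMod p) (Coh p n)) : Prop where
  graded : N = ⨆ d, N ⊓ degPart p n d
  bockstein_mem : ∀ z ∈ N, bockstein p n z ∈ N
  power_mem : ∀ k, ∀ z ∈ N, power p n k z ∈ N

variable {p n} in
/-- A degree preserving `𝒜`-linear endomorphism: it preserves the degree and commutes with `β` and
with all `P^k`. -/
structure IsSteenrodEnd {N : Submodule (ZMod p) (Coh p n)} (f : N →ₗ[ZMod p] N) : Prop where
  map_degree : ∀ (d : ℕ) (z : N), (z : Coh p n) ∈ degPart p n d → (f z : Coh p n) ∈ degPart p n d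
  map_bockstein : ∀ z w : N, (w : Coh p n) = bockstein p n z → (f w : Coh p n) = bockstein p n (f z)
  map_power : ∀ (k : ℕ) (z w : N),
    (w : Coh p n) = power p n k z → (f w : Coh p n) = power p n k (f z)

variable {p n} in
/-- `f` is an isomorphism in degree `d`. -/
def IsIsoInDegree {N : Submodule (ZMod p) (Coh p n)} (f : N →ₗ[ZMod p] N) (d : ℕ) : Prop :=
  Set.BijOn f {z | (z : Coh p n) ∈ degPart p n d} {z | (z : Coh p n) ∈ degPart p n d}

variable {p n} in
/-- `r` is the lowest positive degree in which `N` is nonzero. -/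
def IsLowestPositiveDegree (N : Submodule (ZMod p) (Coh p n)) (r : ℕ) : Prop :=
  IsLeast {d : ℕ | 0 < d ∧ N ⊓ degPart p n d ≠ ⊥} r

variable {p n} in
/-- Atomic: every degree preserving `𝒜`-linear endomorphism that is an isomorphism in the lowest
positive degree is an isomorphism. -/
def IsAtomicModule (N : Submodule (ZMod p) (Coh p n)) : Prop :=
  ∀ f : N →ₗ[ZMod p] N, IsSteenrodEnd f →
    ∀ r, IsLowestPositiveDegree N r → IsIsoInDegree f r → Function.Bijective f

/-! ### Invariants of Dickson and Mùi -/

/-- `∏ (X - v)` over all linear forms `v` in `y_1, …, y_n` with coefficients in `ℤ/p`. -/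
def dicksonPoly [NeZero p] : Polynomial (MvPolynomial (Fin n) (ZMod p)) :=
  ∏ v : Fin n → ZMod p, (Polynomial.X - Polynomial.C (∑ j, MvPolynomial.C (v j) * MvPolynomial.X j))

/-- The Dickson invariant `d_{n,i}` of degree `2(p^n - p^{n-i})`, for `1 ≤ i ≤ n`:
`∏ (X - v) = X^{p^n} + ∑_{i=1}^n (-1)^i d_{n,i} X^{p^{n-i}}`. -/
def dickson [NeZero p] (i : ℕ) : Coh p n :=
  incl p n ((-1) ^ i * (dicksonPoly p n).coeff (p ^ (n - i)))

/-- `L_n`, the determinant with rows `y_1^{p^i}, …, y_n^{p^i}` for `i = 0, …, n - 1`. -/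
def L : Coh p n :=
  incl p n (Matrix.det (Matrix.of fun i j : Fin n => MvPolynomial.X j ^ p ^ (i : ℕ)))

variable {p n} in
/-- The determinant of a matrix with entries in a noncommutative ring, the factors of each product
being ordered by rows. -/
def rowDet (A : Matrix (Fin n) (Fin n) (Coh p n)) : Coh p n :=
  ∑ σ : Equiv.Perm (Fin n), (Equiv.Perm.sign σ : ℤ) • (List.ofFn fun i => A i (σ i)).prod

/-- `M_{n;s_1,…,s_m}` for `S = {s_1, …, s_m} ⊆ {0, …, n - 1}` and `m < p`: `1 / m!` times the
determinant whose first `m` rows are `x_1, …, x_n` and whose other rows are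
`y_1^{p^t}, …, y_n^{p^t}`, where `t` runs in increasing order through the elements of
`{0, …, n - 1}` outside `S`. -/
def M (S : Finset ℕ) : Coh p n :=
  ((S.card.factorial : ZMod p))⁻¹ • rowDet (Matrix.of fun i j : Fin n =>
    if (i : ℕ) < S.card then x p n j
    else y p n j ^ p ^ (Nat.nth (fun t => t ∉ S) ((i : ℕ) - S.card)))

/-- `SD_n`, the subalgebra generated by `d_{n,s+1}`, `M_{n;s} L_n^{p-2}` and
`M_{n;s_1,s_2} L_n^{p-2}`. -/
def SD [NeZero p] : Subalgebra (ZMod p) (Coh p n) :=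
  Algebra.adjoin (ZMod p)
    ({z | ∃ s < n, z = dickson p n (s + 1)} ∪ {z | ∃ s < n, z = M p n {s} * L p n ^ (p - 2)} ∪
      {z | ∃ s₁ s₂, s₁ < s₂ ∧ s₂ < n ∧ z = M p n {s₁, s₂} * L p n ^ (p - 2)})

/-- The augmentation ideal of `SD_n`. -/
def augSD [NeZero p] : Submodule (ZMod p) (Coh p n) :=
  Subalgebra.toSubmodule (SD p n) ⊓ ⨆ d : ℕ, degPart p n (d + 1)

/-- `I_n`, the two-sided ideal `SD_n · G · SD_n` of `SD_n` generated by the set `G` of `d_{n,n}`, the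
`M_{n;i} L_n^{p-2}` and the `M_{n;0,i} L_n^{p-2}`. -/
def idealI [NeZero p] : Submodule (ZMod p) (Coh p n) :=
  Subalgebra.toSubmodule (SD p n) *
    Submodule.span (ZMod p)
      ({dickson p n n} ∪ {z | ∃ i < n, z = M p n {i} * L p n ^ (p - 2)} ∪
        {z | ∃ i, 0 < i ∧ i < n ∧ z = M p n {0, i} * L p n ^ (p - 2)}) *
    Subalgebra.toSubmodule (SD p n)

end DicksonAtomic

end

/-! The heart of the matter is that all nonzero Steenrod-closed subspaces of the augmentation ideal
of $SD_n$ meet: writing $D=d_{n,n}$ (up to sign `dicksonCoeff p n 0`), each of them contains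
$D^{p^j}$ for all large $j$ (`IsSteenrodClosed.exists_forall_dicksonCoeff_pow_mem`). Grant this and
let $f$ be bijective in the lowest positive degree $r$. Degrees are finite sets, so $f^m$ is the
identity in degree $r$ for some $m>0$, and $\ker(f^m-1)$ is nonzero in positive degree. If $\ker f$
were nonzero on the augmentation ideal, both kernels would contain a common $w=D^{p^j}\neq 0$, and
$w=f^m(w)=0$. So $f$ is injective there, hence bijective in each positive degree by finiteness
(`augKer_eq_bot`). In degree $0$ the algebra $SD_n$ is $\mathbb{Z}/p\cdot 1$, which gives the
criterion $f(1)\ne 0$.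

To find powers of $D$, the exterior part is removed by the Milnor operations $Q_i=\sum_j
y_j^{p^i}\,\partial/\partial x_j$ (`tau`), which are iterated commutators of $\beta$ and the
$P^{p^i}$. They anticommute and square to zero, so a nonzero element can be pushed to a nonzero one
killed by $Q_0,\dots,Q_{n-1}$. The Moore determinant $L_n$ is nonzero, so all $\partial/\partial
x_j$ kill it too and it is a polynomial $F(c_0,\dots,c_{n-1})$ in the Dickson invariants, $c_0=\pm
D$.

On such polynomials the derivations $y_j\mapsto y_j^{p^i}$ (`milnor`) act, up to sign, as
$X_0\,\partial/\partial X_i$ for $1\le i<n$ and as $X_0\sum_s X_s\,\partial/\partial X_s$ for $i=n$.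
With weight $1$ on $X_0$ and $2$ on the other variables, the former lower the weight; if they all
vanish, iterating $X_0^2\,\partial/\partial X_0$ leads to a $p$-th power, whose root has smaller
weight (`exists_dicksonCoeff_pow_mem`).

Closure under $\mathcal{A}$ is matrix algebra. The total reduced power multiplies the Moore matrix
on the left by a matrix over the Dickson algebra (`map_totalPower_moore`). Up to sign the generators
are $L_n^{p-1}$, $\xi_sL_n^{p-2}$ and $\xi_s\xi_tL_n^{p-3}$ together with the other Dickson
invariants, where $\xi_s$ is a combination of the $x_j$ by a column of the adjugate; so their
transformation laws are read off from determinant and adjugate. -/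

open scoped TensorProduct

noncomputable section

namespace DicksonAtomic

/-! ### The Moore determinant and the Dickson invariants as Cramer quotients -/

section Moore

variable (p n : ℕ)

/-- The Moore matrix with rows `y_1 ^ p ^ i, …, y_n ^ p ^ i`. -/
def moore : Matrix (Fin n) (Fin n) (MvPolynomial (Fin n) (ZMod p)) :=
  Matrix.of fun i j => MvPolynomial.X j ^ p ^ (i : ℕ)

/-- The linear form with coefficients `v`. -/
def linForm (v : Fin n → ZMod p) : MvPolynomial (Fin n) (ZMod p) :=
  ∑ j, MvPolynomial.C (v j) * MvPolynomial.X j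

variable {p n}

theorem moore_apply (i j : Fin n) : moore p n i j = MvPolynomial.X j ^ p ^ (i : ℕ) := rfl

theorem L_eq : L p n = incl p n (moore p n).det := rfl

variable [Fact p.Prime]

/-- Distinct permutations contribute distinct monomials, so the diagonal term $\prod_i y_i^{p^i}$
survives with coefficient $1$. -/
theorem det_moore_ne_zero : (moore p n).det ≠ 0 := by
  classical
  intro h
  have h1 : (moore p n).det = ∑ σ : Equiv.Perm (Fin n), MvPolynomial.monomial
      (Finsupp.equivFunOnFinite.symm fun i => p ^ (σ i : ℕ))
      (((Equiv.Perm.sign σ : ℤˣ) : ℤ) : ZMod p) := by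
    rw [Matrix.det_apply']
    refine Finset.sum_congr rfl fun σ _ => ?_
    simp only [moore_apply]
    rw [MvPolynomial.monomial_eq, Finsupp.prod_fintype _ _ (fun i => by simp)]
    simp
  have h2 := congrArg (MvPolynomial.coeff
    (Finsupp.equivFunOnFinite.symm fun i : Fin n => p ^ (i : ℕ))) (h1.symm.trans h)
  rw [MvPolynomial.coeff_sum, Finset.sum_eq_single 1] at h2
  · simp [MvPolynomial.coeff_monomial] at h2
  · intro σ _ hσ
    rw [MvPolynomial.coeff_monomial, if_neg]
    intro he
    apply hσ
    ext i
    have := DFunLike.congr_fun he i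
    simp only [Finsupp.equivFunOnFinite_symm_apply_apply] at this
    simpa using Nat.pow_right_injective (Fact.out : p.Prime).two_le this
  · simp

theorem linForm_pow (v : Fin n → ZMod p) (k : ℕ) :
    linForm p n v ^ p ^ k = ∑ j, MvPolynomial.C (v j) * MvPolynomial.X j ^ p ^ k := by
  rw [linForm, sum_pow_char_pow]
  refine Finset.sum_congr rfl fun j _ => ?_
  rw [mul_pow, ← map_pow, ZMod.pow_card_pow]

theorem linForm_injective : Function.Injective (linForm p n) := by
  intro v w h
  ext i
  have := congrArg (MvPolynomial.coeff (Finsupp.single i 1)) h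
  simpa [linForm, MvPolynomial.coeff_sum, MvPolynomial.coeff_C_mul, MvPolynomial.coeff_X,
    Finsupp.single_left_inj] using this

theorem dicksonPoly_monic : (dicksonPoly p n).Monic :=
  Polynomial.monic_prod_of_monic _ _ fun _ _ => Polynomial.monic_X_sub_C _

theorem dicksonPoly_natDegree : (dicksonPoly p n).natDegree = p ^ n := by
  rw [dicksonPoly, Polynomial.natDegree_prod_of_monic _ _ fun _ _ => Polynomial.monic_X_sub_C _]
  simp only [Polynomial.natDegree_X_sub_C]
  simp [ZMod.card]

variable (p n) in
/-- The row `(y_j ^ p ^ n)` times the adjugate of the Moore matrix. -/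
def dicksonNum : Fin n → MvPolynomial (Fin n) (ZMod p) :=
  Matrix.vecMul (fun j => MvPolynomial.X j ^ p ^ n) (moore p n).adjugate

theorem dicksonNum_relation (j : Fin n) :
    ∑ s, dicksonNum p n s * MvPolynomial.X j ^ p ^ (s : ℕ) =
      (moore p n).det * MvPolynomial.X j ^ p ^ n := by
  have h : Matrix.vecMul (dicksonNum p n) (moore p n) =
      (moore p n).det • fun j => MvPolynomial.X j ^ p ^ n := by
    rw [dicksonNum, Matrix.vecMul_vecMul, Matrix.adjugate_mul, Matrix.vecMul_smul,
      Matrix.vecMul_one]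
  exact congrFun h j

/-- The right side involves only exponents $p^s$, so it is additive in $X$; by Cramer's rule it
vanishes at each $y_j$, hence at all $p^n$ linear forms, just like the left side. The leading terms
agree, so the difference has degree below $p^n$ and too many roots. -/
theorem det_mul_dicksonPoly :
    Polynomial.C (moore p n).det * dicksonPoly p n =
      Polynomial.C (moore p n).det * Polynomial.X ^ p ^ n -
        ∑ s : Fin n, Polynomial.C (dicksonNum p n s) * Polynomial.X ^ p ^ (s : ℕ) := by
  classical
  have hcard : (Finset.univ.image (linForm p n)).card = p ^ n := by
    rw [Finset.card_image_of_injective _ linForm_injective]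
    simp [ZMod.card]
  refine Polynomial.eq_of_degree_sub_lt_of_eval_finset_eq (Finset.univ.image (linForm p n)) ?_ ?_
  · rw [hcard, sub_sub_eq_add_sub, add_sub_right_comm, ← mul_sub, ← Polynomial.mem_degreeLT]
    refine add_mem ?_ (sum_mem fun s _ => ?_)
    · rw [← Polynomial.smul_eq_C_mul]
      refine Submodule.smul_mem _ _ (Polynomial.mem_degreeLT.2 ?_)
      have hd : (dicksonPoly p n).degree = ((p ^ n : ℕ) : WithBot ℕ) := by
        rw [Polynomial.degree_eq_natDegree dicksonPoly_monic.ne_zero, dicksonPoly_natDegree]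
      rw [← hd]
      refine Polynomial.degree_sub_lt_left ?_ dicksonPoly_monic.ne_zero ?_
      · rw [hd, Polynomial.degree_X_pow]
      · rw [dicksonPoly_monic.leadingCoeff, Polynomial.leadingCoeff_X_pow]
    · refine Polynomial.mem_degreeLT.2 (lt_of_le_of_lt (Polynomial.degree_C_mul_X_pow_le _ _) ?_)
      exact_mod_cast Nat.pow_lt_pow_right (Fact.out : p.Prime).one_lt s.2
  · intro w hw
    obtain ⟨v, -, rfl⟩ := Finset.mem_image.1 hw
    have hz : (dicksonPoly p n).eval (linForm p n v) = 0 := by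
      rw [dicksonPoly, Polynomial.eval_prod]
      exact Finset.prod_eq_zero (Finset.mem_univ v) (by rw [← linForm]; simp only
        [Polynomial.eval_sub, Polynomial.eval_X,
          Polynomial.eval_C, sub_self])
    simp only [Polynomial.eval_mul, Polynomial.eval_C, hz, mul_zero, Polynomial.eval_sub,
      Polynomial.eval_pow, Polynomial.eval_X, Polynomial.eval_finsetSum, linForm_pow,
      Finset.mul_sum]
    rw [Finset.sum_comm, eq_comm, sub_eq_zero]
    refine Finset.sum_congr rfl fun j _ => ?_
    rw [mul_left_comm, ← dicksonNum_relation, Finset.mul_sum]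
    exact Finset.sum_congr rfl fun s _ => by ring

variable (p n) in
/-- The coefficients of the relation `y_j ^ p ^ n = ∑ s, c s * y_j ^ p ^ s`; up to sign, these
are the Dickson invariants. -/
def dicksonCoeff (s : Fin n) : MvPolynomial (Fin n) (ZMod p) :=
  -(dicksonPoly p n).coeff (p ^ (s : ℕ))

theorem det_mul_dicksonCoeff (s : Fin n) :
    (moore p n).det * dicksonCoeff p n s = dicksonNum p n s := by
  have h := congrArg (fun q => Polynomial.coeff q (p ^ (s : ℕ)))
    (det_mul_dicksonPoly (p := p) (n := n))
  have hlt := Nat.pow_lt_pow_right (Fact.out : p.Prime).one_lt s.2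
  have hinj : ∀ t : Fin n, (p ^ (s : ℕ) = p ^ (t : ℕ)) ↔ s = t := fun t =>
    ⟨fun h => Fin.ext (Nat.pow_right_injective (Fact.out : p.Prime).two_le h), fun h => h ▸ rfl⟩
  simp only [Polynomial.coeff_C_mul, Polynomial.coeff_sub, Polynomial.coeff_X_pow,
    Polynomial.finsetSum_coeff, hlt.ne, hinj] at h
  rw [dicksonCoeff, mul_neg, h]
  simp

theorem dicksonCoeff_relation (j : Fin n) :
    MvPolynomial.X j ^ p ^ n = ∑ s, dicksonCoeff p n s * MvPolynomial.X j ^ p ^ (s : ℕ) := by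
  refine mul_left_cancel₀ (det_moore_ne_zero (p := p) (n := n)) ?_
  rw [← dicksonNum_relation, Finset.mul_sum]
  exact Finset.sum_congr rfl fun s _ => by rw [← mul_assoc, det_mul_dicksonCoeff]

/-- Uniqueness of coordinates with respect to the rows of the Moore matrix. It turns identities
between the Dickson invariants into identities in a single $y_j$. -/
theorem eq_of_sum_mul_moore_eq {a b : Fin n → MvPolynomial (Fin n) (ZMod p)}
    (h : ∀ j, ∑ s, a s * MvPolynomial.X j ^ p ^ (s : ℕ) =
      ∑ s, b s * MvPolynomial.X j ^ p ^ (s : ℕ)) : a = b := by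
  rw [← sub_eq_zero]
  refine Matrix.eq_zero_of_vecMul_eq_zero (det_moore_ne_zero (p := p) (n := n)) ?_
  rw [Matrix.sub_vecMul, sub_eq_zero]
  exact funext h

end Moore

/-! ### The top Dickson invariant as a power of $L_n$ -/

section LowestCoefficient

variable {p n : ℕ} [Fact p.Prime] [NeZero n]

/-- The Cramer numerator for index $0$ has rows of exponents $p^n,p,\dots,p^{n-1}$. Up to a cyclic
rotation these are the rows of the entrywise $p$-th power of the Moore matrix, whose determinant is
$L_n^p$. -/
theorem exists_dicksonCoeff_zero_eq :
    ∃ ε : ℤˣ, dicksonCoeff p n 0 = ((ε : ℤ) : MvPolynomial (Fin n) (ZMod p)) *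
      (moore p n).det ^ (p - 1) := by
  obtain ⟨m, rfl⟩ : ∃ m, n = m + 1 := Nat.exists_eq_succ_of_ne_zero (NeZero.ne n)
  refine ⟨Equiv.Perm.sign (finRotate (m + 1)), mul_left_cancel₀ (det_moore_ne_zero (p := p)
    (n := m + 1)) ?_⟩
  rw [det_mul_dicksonCoeff, mul_left_comm, mul_pow_sub_one (Fact.out : p.Prime).ne_zero,
    dicksonNum, ← Matrix.mulVec_transpose, Matrix.adjugate_transpose,
    ← Matrix.cramer_eq_adjugate_mulVec, Matrix.cramer_transpose_apply]
  have h1 : (moore p (m + 1)).det ^ p = ((moore p (m + 1)).map (frobenius _ p)).det := by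
    have := RingHom.map_det (frobenius (MvPolynomial (Fin (m + 1)) (ZMod p)) p) (moore p (m + 1))
    rwa [frobenius_def] at this
  have h2 : (moore p (m + 1)).map (frobenius _ p) = ((moore p (m + 1)).updateRow 0
      fun j => MvPolynomial.X j ^ p ^ (m + 1)).submatrix (finRotate (m + 1)) id := by
    ext i j : 1
    simp only [Matrix.map_apply, moore_apply, frobenius_def, ← pow_mul, ← pow_succ,
      Matrix.submatrix_apply, id]
    rcases eq_or_ne i (Fin.last m) with rfl | hi
    · simp
    · have : finRotate (m + 1) i = i + 1 := by simp
      have h0 : i + 1 ≠ 0 := fun h => hi (by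
        have := Fin.lt_last_iff_ne_last.2 hi
        have h3 := congrArg Fin.val h
        rw [Fin.val_add_one_of_lt this] at h3
        simp at h3)
      rw [this, Matrix.updateRow_ne h0, moore_apply,
        Fin.val_add_one_of_lt (Fin.lt_last_iff_ne_last.2 hi)]
  rw [h1, h2, Matrix.det_permute, ← mul_assoc, ← Int.cast_mul, ← Units.val_mul,
    Int.units_mul_self]
  simp

theorem dicksonCoeff_zero_ne_zero : dicksonCoeff p n 0 ≠ 0 := by
  obtain ⟨ε, hε⟩ := exists_dicksonCoeff_zero_eq (p := p) (n := n)
  rw [hε]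
  refine mul_ne_zero ?_ (pow_ne_zero _ det_moore_ne_zero)
  rcases Int.units_eq_one_or ε with rfl | rfl <;> simp

end LowestCoefficient

/-! ### The total reduced power on the Moore matrix and on the Dickson algebra -/

section TotalPower

variable (p n : ℕ)

/-- The companion matrix with generic last row. -/
def companion : Matrix (Fin n) (Fin n) (MvPolynomial (Fin n) (ZMod p)) :=
  Matrix.of fun i j => if (i : ℕ) + 1 = n then MvPolynomial.X j
    else if (j : ℕ) = i + 1 then 1 else 0

/-- The generic matrix by which the total power acts on the Moore matrix. -/
def powerMatrix : Matrix (Fin n) (Fin n) (Polynomial (MvPolynomial (Fin n) (ZMod p))) :=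
  1 + Matrix.diagonal (fun i : Fin n => Polynomial.X ^ p ^ (i : ℕ)) *
    (companion p n).map Polynomial.C

variable [Fact p.Prime]

/-- The evaluation of a polynomial at the Dickson invariants. -/
def dicksonEval : MvPolynomial (Fin n) (ZMod p) →ₐ[ZMod p] MvPolynomial (Fin n) (ZMod p) :=
  MvPolynomial.aeval (dicksonCoeff p n)

/-- The evaluation of the coefficients at the Dickson invariants. -/
def dicksonEvalT : Polynomial (MvPolynomial (Fin n) (ZMod p)) →+*
    Polynomial (MvPolynomial (Fin n) (ZMod p)) :=
  Polynomial.mapRingHom (dicksonEval p n).toRingHom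

variable {p n}

@[simp] theorem dicksonEval_X (s : Fin n) :
    dicksonEval p n (MvPolynomial.X s) = dicksonCoeff p n s := by
  simp [dicksonEval]

@[simp] theorem dicksonEvalT_C (q : MvPolynomial (Fin n) (ZMod p)) :
    dicksonEvalT p n (Polynomial.C q) = Polynomial.C (dicksonEval p n q) := by
  simp [dicksonEvalT]

@[simp] theorem dicksonEvalT_X : dicksonEvalT p n Polynomial.X = Polynomial.X := by
  simp [dicksonEvalT]

@[simp] theorem coeff_dicksonEvalT (F : Polynomial (MvPolynomial (Fin n) (ZMod p))) (k : ℕ) :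
    (dicksonEvalT p n F).coeff k = dicksonEval p n (F.coeff k) := by
  simp [dicksonEvalT]

/-- The companion matrix raises the Frobenius exponent of every row by one. Only the last row leaves
the range $0,\dots,n-1$, and there the Dickson relation brings it back. -/
theorem sum_companion_mul (i j : Fin n) :
    ∑ s, dicksonEval p n (companion p n i s) * MvPolynomial.X j ^ p ^ (s : ℕ) =
      MvPolynomial.X j ^ p ^ ((i : ℕ) + 1) := by
  by_cases h : (i : ℕ) + 1 = n
  · simp only [companion, Matrix.of_apply, h, if_true, dicksonEval_X]
    exact (dicksonCoeff_relation j).symm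
  · have hi : (i : ℕ) + 1 < n := by omega
    rw [Finset.sum_eq_single ⟨i + 1, hi⟩]
    · simp [companion, h]
    · intro s _ hs
      have : (s : ℕ) ≠ i + 1 := fun e => hs (Fin.ext e)
      simp [companion, h, this]
    · simp

theorem totalPower_X_pow (j : Fin n) (k : ℕ) :
    totalPower p n (MvPolynomial.X j ^ p ^ k) = Polynomial.C (MvPolynomial.X j ^ p ^ k) +
      Polynomial.X ^ p ^ k * Polynomial.C (MvPolynomial.X j ^ p ^ (k + 1)) := by
  rw [map_pow, totalPower, MvPolynomial.aeval_X, add_pow_char_pow, mul_pow, ← Polynomial.C_pow,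
    ← Polynomial.C_pow, ← pow_mul, ← pow_succ', mul_comm (Polynomial.C _)]

theorem totalPower_moore (i j : Fin n) :
    totalPower p n (moore p n i j) =
      ∑ s, dicksonEvalT p n (powerMatrix p n i s) * Polynomial.C (moore p n s j) := by
  rw [moore_apply, totalPower_X_pow, ← sum_companion_mul]
  simp only [powerMatrix, Matrix.add_apply, Matrix.diagonal_mul, Matrix.map_apply, map_add,
    map_mul, map_pow, dicksonEvalT_X, dicksonEvalT_C, add_mul, Finset.sum_add_distrib, map_sum,
    Finset.mul_sum, mul_assoc, moore_apply]
  congr 1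
  simp [Matrix.one_apply, apply_ite]

/-- This carries all closure statements: determinant and adjugate of the Moore matrix, and with them
every generator, are transformed with coefficients in the Dickson algebra. -/
theorem map_totalPower_moore :
    (moore p n).map (totalPower p n) =
      (powerMatrix p n).map (dicksonEvalT p n) * (moore p n).map Polynomial.C := by
  ext i j : 1
  rw [Matrix.map_apply, totalPower_moore, Matrix.mul_apply]
  rfl

theorem totalPower_det_moore :
    totalPower p n (moore p n).det =
      dicksonEvalT p n (powerMatrix p n).det * Polynomial.C (moore p n).det := by
  have h := congrArg Matrix.det (map_totalPower_moore (p := p) (n := n))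
  rw [Matrix.det_mul] at h
  have h1 := RingHom.map_det (dicksonEvalT p n) (powerMatrix p n)
  have h2 := RingHom.map_det Polynomial.C (moore p n)
  rw [AlgHom.map_det, h1, h2]
  exact h

theorem totalPower_adjugate_moore (j s : Fin n) :
    totalPower p n ((moore p n).adjugate j s) =
      ∑ t, Polynomial.C ((moore p n).adjugate j t) *
        dicksonEvalT p n ((powerMatrix p n).adjugate t s) := by
  have h := congrArg Matrix.adjugate (map_totalPower_moore (p := p) (n := n))
  rw [Matrix.adjugate_mul_distrib] at h
  have h1 := RingHom.map_adjugate (totalPower p n).toRingHom (moore p n)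
  have h2 := RingHom.map_adjugate (dicksonEvalT p n) (powerMatrix p n)
  have h3 := RingHom.map_adjugate Polynomial.C (moore p n)
  have h4 := congrFun (congrFun (h1.trans (h.trans (congrArg₂ (· * ·) h3 h2).symm)) j) s
  rw [Matrix.mul_apply] at h4
  exact h4

theorem coeff_zero_det_powerMatrix : ((powerMatrix p n).det).coeff 0 = 1 := by
  have h := RingHom.map_det (Polynomial.constantCoeff (R := MvPolynomial (Fin n) (ZMod p)))
    (powerMatrix p n)
  rw [Polynomial.constantCoeff_apply] at h
  rw [h]
  suffices (Polynomial.constantCoeff (R := MvPolynomial (Fin n) (ZMod p))).mapMatrix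
      (powerMatrix p n) = 1 by rw [this, Matrix.det_one]
  ext i j : 1
  by_cases hij : i = j <;>
  simp [powerMatrix, Matrix.diagonal_mul, Matrix.one_apply, hij, Polynomial.mul_coeff_zero,
    Polynomial.coeff_X_pow, (pow_pos (Fact.out : p.Prime).pos _).ne]

/-- A polynomial in $T$ with constant term $1$ can be divided out recursively, coefficient by
coefficient, without leaving the Dickson algebra. -/
theorem coeff_mem_range_of_mul_eq {a : Polynomial (MvPolynomial (Fin n) (ZMod p))}
    {h g : Polynomial (MvPolynomial (Fin n) (ZMod p))} (h0 : h.coeff 0 = 1)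
    (e : a * dicksonEvalT p n h = dicksonEvalT p n g) (k : ℕ) :
    a.coeff k ∈ (dicksonEval p n).range := by
  induction k using Nat.strong_induction_on with
  | _ k ih =>
    have hk := congrArg (fun q => Polynomial.coeff q k) e
    simp only [Polynomial.coeff_mul, coeff_dicksonEvalT] at hk
    rw [← Finset.add_sum_erase _ _
      (show (k, 0) ∈ Finset.HasAntidiagonal.antidiagonal k by simp)] at hk
    simp only [h0, map_one, mul_one] at hk
    rw [← eq_sub_iff_add_eq] at hk
    rw [hk]
    refine sub_mem ⟨_, rfl⟩ (sum_mem fun x hx => mul_mem (ih _ ?_) ⟨_, rfl⟩)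
    simp only [Finset.mem_erase, Finset.HasAntidiagonal.mem_antidiagonal, ne_eq, Prod.ext_iff] at hx
    omega

/-- The total power of the Dickson relation is a linear system for the total powers of the $c_s$
with matrix `powerMatrix`. Multiplying by the adjugate leaves only its determinant to be divided
out, and that has constant term $1$. -/
theorem coeff_totalPower_dicksonCoeff_mem (s : Fin n) (k : ℕ) :
    (totalPower p n (dicksonCoeff p n s)).coeff k ∈ (dicksonEval p n).range := by
  have hdet : ((moore p n).map Polynomial.C).det ≠ 0 := by
    have h := RingHom.map_det (Polynomial.C (R := MvPolynomial (Fin n) (ZMod p))) (moore p n)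
    rw [RingHom.mapMatrix_apply] at h
    rw [← h]
    exact Polynomial.C_ne_zero.2 det_moore_ne_zero
  -- The coordinates of the total power of $y_j^{p^n}$ in the $y_j^{p^s}$. The term in $T^{p^n}$ is
  -- $y_j^{p^{n+1}}$, the $p$-th power of the Dickson relation, with each $y_j^{p^{t+1}}$ expanded
  -- by the companion matrix.
  let g : Fin n → Polynomial (MvPolynomial (Fin n) (ZMod p)) :=
    (fun t => Polynomial.C (MvPolynomial.X t)) +
      (Polynomial.X ^ p ^ n : Polynomial (MvPolynomial (Fin n) (ZMod p))) •
      Matrix.vecMul (fun t => Polynomial.C (MvPolynomial.X t ^ p))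
        ((companion p n).map Polynomial.C)
  have key : Matrix.vecMul (fun t => totalPower p n (dicksonCoeff p n t))
      ((powerMatrix p n).map (dicksonEvalT p n)) = fun t => dicksonEvalT p n (g t) := by
    rw [← sub_eq_zero]
    refine Matrix.eq_zero_of_vecMul_eq_zero hdet ?_
    rw [Matrix.sub_vecMul, Matrix.vecMul_vecMul, ← map_totalPower_moore, sub_eq_zero]
    ext1 j
    have h1 := congrArg (totalPower p n) (dicksonCoeff_relation (p := p) j)
    rw [totalPower_X_pow, map_sum] at h1
    have h2 : ∑ t, totalPower p n (dicksonCoeff p n t) * totalPower p n (moore p n t j) =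
        ∑ t, totalPower p n (dicksonCoeff p n t * MvPolynomial.X j ^ p ^ (t : ℕ)) :=
      Finset.sum_congr rfl fun t _ => (map_mul _ _ _).symm
    refine (h2.trans h1.symm).trans ?_
    have h3 : MvPolynomial.X j ^ p ^ (n + 1) = ∑ s, (∑ t, dicksonCoeff p n t ^ p *
        dicksonEval p n (companion p n t s)) * MvPolynomial.X j ^ p ^ (s : ℕ) := by
      rw [pow_succ, pow_mul, dicksonCoeff_relation, sum_pow_char]
      simp only [Finset.sum_mul]
      rw [Finset.sum_comm]
      refine Finset.sum_congr rfl fun t _ => ?_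
      rw [mul_pow, ← pow_mul, ← pow_succ, ← sum_companion_mul, Finset.mul_sum]
      exact Finset.sum_congr rfl fun s _ => by ring
    rw [h3, dicksonCoeff_relation]
    simp only [Matrix.vecMul, dotProduct, g, Pi.add_apply, Pi.smul_apply, smul_eq_mul, map_add,
      map_mul, map_pow, dicksonEvalT_X, dicksonEvalT_C, map_sum, Matrix.map_apply, moore_apply,
      dicksonEval_X, add_mul, Finset.sum_add_distrib, Finset.mul_sum]
    rw [add_right_inj]
    refine Finset.sum_congr rfl fun i _ => ?_
    rw [← Finset.mul_sum, mul_assoc]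
  have h5 := congrArg (fun v => Matrix.vecMul v
    ((powerMatrix p n).map (dicksonEvalT p n)).adjugate) key
  simp only [Matrix.vecMul_vecMul, Matrix.mul_adjugate, Matrix.vecMul_smul, Matrix.vecMul_one]
    at h5
  have h6 := RingHom.map_adjugate (dicksonEvalT p n) (powerMatrix p n)
  have h7 := RingHom.map_det (dicksonEvalT p n) (powerMatrix p n)
  rw [RingHom.mapMatrix_apply] at h6 h7
  have h8 := congrFun h5 s
  rw [← h7, ← RingHom.mapMatrix_apply, ← RingHom.map_adjugate] at h8
  refine coeff_mem_range_of_mul_eq (h := (powerMatrix p n).det)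
    (g := Matrix.vecMul g (powerMatrix p n).adjugate s) coeff_zero_det_powerMatrix ?_ k
  rw [mul_comm]
  refine h8.trans ?_
  simp [Matrix.vecMul, dotProduct]

theorem polyPower_mem_range (k : ℕ) {q : MvPolynomial (Fin n) (ZMod p)}
    (hq : q ∈ (dicksonEval p n).range) : polyPower p n k q ∈ (dicksonEval p n).range := by
  have hl : ∀ F : MvPolynomial (Fin n) (ZMod p), totalPower p n (dicksonEval p n F) ∈
      Polynomial.lifts (dicksonEval p n).toRingHom := by
    intro F
    induction F using MvPolynomial.induction_on with
    | C a =>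
      rw [← MvPolynomial.algebraMap_eq, AlgHom.commutes, AlgHom.commutes,
        Polynomial.algebraMap_apply, ← (dicksonEval p n).commutes]
      exact Polynomial.C_mem_lifts _ _
    | add F G hF hG => simpa using add_mem hF hG
    | mul_X F s hF =>
      rw [map_mul, map_mul, dicksonEval_X]
      exact mul_mem hF ((Polynomial.lifts_iff_coeff_lifts _).2
        (coeff_totalPower_dicksonCoeff_mem s))
  obtain ⟨F, rfl⟩ := hq
  exact (Polynomial.lifts_iff_coeff_lifts _).1 (hl F) k

/-- Modulo $X_0$ column $0$ of the companion matrix vanishes, so column $0$ of `powerMatrix` is a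
unit vector, and so is column $0$ of its adjugate up to the diagonal entry. This is what keeps the
reduced powers of $M_{n;0,i}L_n^{p-2}$ inside $I_n$. -/
theorem C_X_dvd_adjugate_powerMatrix [NeZero n] {a : Fin n} (ha : a ≠ 0) :
    Polynomial.C (MvPolynomial.X 0) ∣ (powerMatrix p n).adjugate a 0 := by
  have hcol : ∀ i, ∃ u, powerMatrix p n i 0 =
      (1 : Matrix (Fin n) (Fin n) (Polynomial (MvPolynomial (Fin n) (ZMod p)))) i 0 +
        Polynomial.C (MvPolynomial.X 0) * u := by
    intro i
    simp only [powerMatrix, Matrix.add_apply, Matrix.diagonal_mul, Matrix.map_apply, companion,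
      Matrix.of_apply]
    split_ifs with h1 h2
    · exact ⟨_, by rw [mul_comm]⟩
    · simp at h2
    · exact ⟨0, by simp⟩
  choose u hu using hcol
  have h := congrFun (congrFun (Matrix.adjugate_mul (powerMatrix p n)) a) 0
  rw [Matrix.mul_apply, Matrix.smul_apply, Matrix.one_apply_ne ha, smul_zero] at h
  simp only [hu, mul_add, Finset.sum_add_distrib, Matrix.one_apply, mul_ite, mul_one, mul_zero,
    Finset.sum_ite_eq', Finset.mem_univ, if_true] at h
  rw [eq_neg_of_add_eq_zero_left h]
  exact (dvd_neg).2 (Finset.dvd_sum fun i _ => (Dvd.intro _ rfl).mul_left _)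

end TotalPower

/-! ### Partial derivatives, $p$-th powers and weighted degree -/

section PartialDerivatives

variable {σ : Type*} {K : Type*}

theorem pderiv_pderiv_comm [CommRing K] (i j : σ) (F : MvPolynomial σ K) :
    MvPolynomial.pderiv i (MvPolynomial.pderiv j F) =
      MvPolynomial.pderiv j (MvPolynomial.pderiv i F) := by
  classical
  have h : ⁅MvPolynomial.pderiv (R := K) i, MvPolynomial.pderiv (R := K) j⁆ = 0 := by
    refine MvPolynomial.derivation_ext fun s => ?_
    rw [Derivation.commutator_apply, MvPolynomial.pderiv_X, MvPolynomial.pderiv_X]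
    by_cases hi : i = s <;> by_cases hj : j = s <;> simp [hi, hj]
  rw [← sub_eq_zero, ← Derivation.commutator_apply, h, Derivation.zero_apply]

/-- Vanishing of all derivatives forces every exponent to be divisible by $p$, and the coefficients
in $\mathbb{Z}/p$ are their own $p$-th powers. -/
theorem exists_pow_eq_of_pderiv_eq_zero {p : ℕ} [Fact p.Prime] {F : MvPolynomial σ (ZMod p)}
    (h : ∀ i, MvPolynomial.pderiv i F = 0) : ∃ G, F = G ^ p := by
  classical
  have hdvd : ∀ d ∈ F.support, ∀ i, p ∣ d i := by
    intro d hd i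
    by_contra hi
    have hpos : 1 ≤ d i := Nat.one_le_iff_ne_zero.2 fun h0 => hi (h0 ▸ dvd_zero p)
    have h1 := MvPolynomial.coeff_pderiv (i := i) F (d - Finsupp.single i 1)
    have h2 : d - Finsupp.single i 1 + Finsupp.single i 1 = d :=
      tsub_add_cancel_of_le (Finsupp.single_le_iff.2 hpos)
    rw [h i, MvPolynomial.coeff_zero, h2, eq_comm, mul_eq_zero] at h1
    rcases h1 with h1 | h1
    · exact (MvPolynomial.mem_support_iff.1 hd) h1
    · rw [Finsupp.tsub_apply, Finsupp.single_eq_same, ← Nat.cast_add_one,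
        Nat.sub_add_cancel hpos, ZMod.natCast_eq_zero_iff] at h1
      exact hi h1
  refine ⟨∑ d ∈ F.support, MvPolynomial.monomial (d.mapRange (· / p) (Nat.zero_div p))
    (F.coeff d), ?_⟩
  rw [← MvPolynomial.expand_zmod, map_sum]
  conv_lhs => rw [F.as_sum]
  refine Finset.sum_congr rfl fun d hd => ?_
  rw [MvPolynomial.expand_monomial]
  congr 2
  ext i
  simp [Nat.mul_div_cancel' (hdvd d hd i)]

theorem weightedTotalDegree_pderiv_add_le [CommSemiring K] (w : σ → ℕ) (i : σ)
    {F : MvPolynomial σ K} (h : MvPolynomial.pderiv i F ≠ 0) :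
    (MvPolynomial.pderiv i F).weightedTotalDegree w + w i ≤ F.weightedTotalDegree w := by
  classical
  obtain ⟨d, hd, hsup⟩ := Finset.exists_mem_eq_sup _ (MvPolynomial.support_nonempty.2 h)
    (fun s => Finsupp.weight w s)
  rw [MvPolynomial.weightedTotalDegree, hsup]
  have h1 : d + Finsupp.single i 1 ∈ F.support := by
    rw [MvPolynomial.mem_support_iff, MvPolynomial.coeff_pderiv] at hd
    exact MvPolynomial.mem_support_iff.2 (left_ne_zero_of_mul hd)
  simpa [Finsupp.weight_single] using MvPolynomial.le_weightedTotalDegree w h1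

theorem weightedTotalDegree_X_mul_le [CommSemiring K] (w : σ → ℕ) (i : σ)
    (F : MvPolynomial σ K) :
    (MvPolynomial.X i * F).weightedTotalDegree w ≤ F.weightedTotalDegree w + w i := by
  classical
  refine Finset.sup_le fun d hd => ?_
  rw [MvPolynomial.support_X_mul, Finset.mem_map] at hd
  obtain ⟨e, he, rfl⟩ := hd
  simpa [Finsupp.weight_single, add_comm] using MvPolynomial.le_weightedTotalDegree w he

theorem mul_weightedTotalDegree_le_pow {p : ℕ} [Fact p.Prime] (w : σ → ℕ)
    (F : MvPolynomial σ (ZMod p)) :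
    p * F.weightedTotalDegree w ≤ (F ^ p).weightedTotalDegree w := by
  classical
  rcases eq_or_ne F 0 with rfl | h
  · simp [MvPolynomial.weightedTotalDegree_zero]
  obtain ⟨d, hd, hsup⟩ := Finset.exists_mem_eq_sup _ (MvPolynomial.support_nonempty.2 h)
    (fun s => Finsupp.weight w s)
  rw [MvPolynomial.weightedTotalDegree, hsup, ← MvPolynomial.expand_zmod]
  have h1 : p • d ∈ (MvPolynomial.expand p F).support := by
    rw [MvPolynomial.mem_support_iff, MvPolynomial.coeff_expand_smul p
      (Fact.out : p.Prime).ne_zero]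
    exact MvPolynomial.mem_support_iff.1 hd
  simpa using MvPolynomial.le_weightedTotalDegree w h1

/-- The operator `X_i ^ 2 ∂/∂X_i`. -/
def sqEuler [CommSemiring K] (i : σ) : MvPolynomial σ K →ₗ[K] MvPolynomial σ K :=
  LinearMap.mulLeft K (MvPolynomial.X i ^ 2) ∘ₗ (MvPolynomial.pderiv i).toLinearMap

theorem sqEuler_apply [CommSemiring K] (i : σ) (F : MvPolynomial σ K) :
    sqEuler i F = MvPolynomial.X i ^ 2 * MvPolynomial.pderiv i F := rfl

theorem sqEuler_iterate_monomial [CommSemiring K] (i : σ) (d : σ →₀ ℕ) (a : K) (j : ℕ) :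
    (sqEuler i)^[j] (MvPolynomial.monomial d a) =
      MvPolynomial.monomial (d + Finsupp.single i j) (a * ∏ t ∈ Finset.range j, (d i + t : K)) := by
  induction j with
  | zero => simp
  | succ j ih =>
    rw [Function.iterate_succ_apply', ih, sqEuler_apply, MvPolynomial.pderiv_monomial,
      MvPolynomial.X_pow_eq_monomial, MvPolynomial.monomial_mul, one_mul, Finset.prod_range_succ]
    by_cases h0 : d i + j = 0
    · have h1 : (d i : K) + j = 0 := by exact_mod_cast congrArg (Nat.cast : ℕ → K) h0
      have h2 : (((d + Finsupp.single i j) i : ℕ) : K) = 0 := by simp [h1]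
      rw [h1, h2]
      simp
    · have h1 : Finsupp.single i 2 + (d + Finsupp.single i j - Finsupp.single i 1) =
          d + Finsupp.single i (j + 1) := by
        ext s
        rcases eq_or_ne i s with rfl | hs
        · simp only [Finsupp.add_apply, Finsupp.tsub_apply, Finsupp.single_eq_same]
          omega
        · simp [hs.symm]
      rw [h1]
      simp [mul_assoc]

/-- On a monomial of exponent $d$ in $X_i$, the $p$-th iterate has the factor $d(d+1)\cdots(d+p-1)$,
a product over all residues mod $p$. -/
theorem sqEuler_iterate_prime {p : ℕ} [Fact p.Prime] (i : σ) (F : MvPolynomial σ (ZMod p)) :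
    (sqEuler i)^[p] F = 0 := by
  have hp := (Fact.out : p.Prime).pos
  induction F using MvPolynomial.induction_on' with
  | monomial d a =>
    -- The index is the representative of $-d_i$ mod $p$; the outer remainder covers the case $p\mid
    -- d_i$.
    rw [sqEuler_iterate_monomial, Finset.prod_eq_zero (i := (p - d i % p) % p), mul_zero,
      MvPolynomial.monomial_zero]
    · exact Finset.mem_range.2 (Nat.mod_lt _ hp)
    · rw [← Nat.cast_add, ZMod.natCast_eq_zero_iff, Nat.dvd_iff_mod_eq_zero, Nat.add_mod,
        Nat.mod_mod, ← Nat.add_mod, ← Nat.mod_add_mod, Nat.add_sub_cancel' (Nat.mod_lt _ hp).le,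
        Nat.mod_self]
  | add F G hF hG => rw [iterate_map_add, hF, hG, add_zero]

end PartialDerivatives

/-! ### Milnor derivations on the polynomial algebra -/

section Milnor

variable (p n : ℕ)

/-- The derivation `y_j ↦ y_j ^ p ^ i`, a Milnor primitive for `i ≥ 1`. -/
def milnor (i : ℕ) : Derivation (ZMod p) (MvPolynomial (Fin n) (ZMod p))
    (MvPolynomial (Fin n) (ZMod p)) :=
  MvPolynomial.mkDerivation _ fun j => MvPolynomial.X j ^ p ^ i

variable {p n}

/-- Closed under all reduced powers. -/
def IsPowerClosed (N : Submodule (ZMod p) (MvPolynomial (Fin n) (ZMod p))) : Prop :=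
  ∀ k, ∀ q ∈ N, polyPower p n k q ∈ N

theorem polyPower_apply (k : ℕ) (q : MvPolynomial (Fin n) (ZMod p)) :
    polyPower p n k q = (totalPower p n q).coeff k := rfl

@[simp] theorem milnor_X (i : ℕ) (j : Fin n) :
    milnor p n i (MvPolynomial.X j) = MvPolynomial.X j ^ p ^ i := by
  simp [milnor]

theorem milnor_C (i : ℕ) (a : ZMod p) : milnor p n i (MvPolynomial.C a) = 0 :=
  MvPolynomial.derivation_C _ _

theorem totalPower_X (j : Fin n) : totalPower p n (MvPolynomial.X j) =
    Polynomial.C (MvPolynomial.X j) + Polynomial.C (MvPolynomial.X j ^ p) * Polynomial.X := by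
  rw [totalPower, MvPolynomial.aeval_X]

theorem totalPower_C (a : ZMod p) : totalPower p n (MvPolynomial.C a) =
    Polynomial.C (MvPolynomial.C a) := by
  rw [← MvPolynomial.algebraMap_eq, AlgHom.commutes, Polynomial.algebraMap_apply]

theorem polyPower_zero (q : MvPolynomial (Fin n) (ZMod p)) : polyPower p n 0 q = q := by
  rw [polyPower_apply]
  induction q using MvPolynomial.induction_on with
  | C a => simp
  | add q r hq hr => simp [hq, hr]
  | mul_X q j hq => simp [totalPower_X, Polynomial.mul_coeff_zero, hq]

variable [Fact p.Prime]

theorem milnor_pow_char (i : ℕ) (q : MvPolynomial (Fin n) (ZMod p)) :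
    milnor p n i (q ^ p) = 0 := by
  rw [Derivation.leibniz_pow, ← Nat.cast_smul_eq_nsmul (ZMod p)]
  simp

theorem polyPower_one (q : MvPolynomial (Fin n) (ZMod p)) :
    polyPower p n 1 q = milnor p n 1 q := by
  have h0 : ∀ r : MvPolynomial (Fin n) (ZMod p), (totalPower p n r).coeff 0 = r := polyPower_zero
  rw [polyPower_apply]
  induction q using MvPolynomial.induction_on with
  | C a => rw [totalPower_C, milnor_C, Polynomial.coeff_C]; simp
  | add q r hq hr => simp [hq, hr]
  | mul_X q j hq =>
    rw [map_mul, totalPower_X, mul_add, ← mul_assoc, Polynomial.coeff_add, Polynomial.coeff_mul_C,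
      hq, Polynomial.coeff_mul_X, Polynomial.coeff_mul_C, h0, Derivation.leibniz, milnor_X]
    simp only [smul_eq_mul, pow_one]
    ring

/-- For $k=p^i$ the last term is `milnor p n (i + 1) q`, so this contains the commutator formula for
$P^{p^i}$ and `milnor p n i`. On a variable, the shift by $T^{p^i}$ records the second term of the
total power of $y_j^{p^i}$; the products go through because the derivations kill $y_j^p$. -/
theorem coeff_totalPower_milnor (i : ℕ) (q : MvPolynomial (Fin n) (ZMod p)) (k : ℕ) :
    (totalPower p n (milnor p n i q)).coeff k = milnor p n i ((totalPower p n q).coeff k) +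
      milnor p n (i + 1) ((totalPower p n q * Polynomial.X ^ p ^ i).coeff k) := by
  induction q using MvPolynomial.induction_on generalizing k with
  | C a =>
    rw [milnor_C, map_zero, totalPower_C]
    simp only [Polynomial.coeff_C_mul_X_pow, Polynomial.coeff_C, Polynomial.coeff_zero]
    split_ifs <;> simp
  | add q r hq hr =>
    simp only [map_add, Polynomial.coeff_add, add_mul, hq, hr]
    ring
  | mul_X q j hq =>
    have hshift : (totalPower p n (milnor p n i q) * Polynomial.X).coeff k =
        milnor p n i ((totalPower p n q * Polynomial.X).coeff k) +
          milnor p n (i + 1) ((totalPower p n q * Polynomial.X ^ p ^ i * Polynomial.X).coeff k) := by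
      cases k with
      | zero => simp
      | succ k => simp only [Polynomial.coeff_mul_X, hq]
    have e1 : totalPower p n (milnor p n i (q * MvPolynomial.X j)) =
        totalPower p n q * Polynomial.C (MvPolynomial.X j ^ p ^ i) +
        totalPower p n q * Polynomial.X ^ p ^ i * Polynomial.C (MvPolynomial.X j ^ p ^ (i + 1)) +
        totalPower p n (milnor p n i q) * Polynomial.C (MvPolynomial.X j) +
        totalPower p n (milnor p n i q) * Polynomial.X * Polynomial.C (MvPolynomial.X j ^ p) := by
      rw [Derivation.leibniz, milnor_X, smul_eq_mul, smul_eq_mul, map_add, map_mul, map_mul,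
        totalPower_X_pow, totalPower_X]
      ring
    have e2 : totalPower p n (q * MvPolynomial.X j) =
        totalPower p n q * Polynomial.C (MvPolynomial.X j) +
        totalPower p n q * Polynomial.X * Polynomial.C (MvPolynomial.X j ^ p) := by
      rw [map_mul, totalPower_X]
      ring
    have e3 : totalPower p n (q * MvPolynomial.X j) * Polynomial.X ^ p ^ i =
        totalPower p n q * Polynomial.X ^ p ^ i * Polynomial.C (MvPolynomial.X j) +
        totalPower p n q * Polynomial.X ^ p ^ i * Polynomial.X *
          Polynomial.C (MvPolynomial.X j ^ p) := by
      rw [e2]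
      ring
    rw [e1, e3, e2]
    simp only [Polynomial.coeff_add, Polynomial.coeff_mul_C, map_add, Derivation.leibniz,
      milnor_pow_char, milnor_X, smul_eq_mul, hshift, hq, mul_zero, zero_add]
    ring

/-- The recursion by commutators with $P^{p^i}$ starts from $P^1$, which is the derivation of index
$1$; hence the bound on $i$. -/
theorem IsPowerClosed.milnor_mem {N : Submodule (ZMod p) (MvPolynomial (Fin n) (ZMod p))}
    (hN : IsPowerClosed N) {i : ℕ} (hi : 1 ≤ i) : ∀ q ∈ N, milnor p n i q ∈ N := by
  induction i, hi using Nat.le_induction with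
  | base => exact fun q hq => polyPower_one q ▸ hN 1 q hq
  | succ i hi ih =>
    intro q hq
    have h := coeff_totalPower_milnor i q (p ^ i)
    rw [← polyPower_apply, ← polyPower_apply, Polynomial.coeff_mul_X_pow', if_pos le_rfl,
      Nat.sub_self, ← polyPower_apply, polyPower_zero] at h
    rw [← sub_eq_iff_eq_add'.2 h]
    exact sub_mem (hN _ _ (ih q hq)) (ih _ (hN _ _ hq))

end Milnor

/-! ### Descent in the Dickson algebra to powers of the top invariant -/

section DicksonAlgebra

variable {p n : ℕ} [Fact p.Prime]

theorem derivation_dicksonEval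
    (d : Derivation (ZMod p) (MvPolynomial (Fin n) (ZMod p)) (MvPolynomial (Fin n) (ZMod p)))
    (F : MvPolynomial (Fin n) (ZMod p)) :
    d (dicksonEval p n F) =
      ∑ s, dicksonEval p n (MvPolynomial.pderiv s F) * d (dicksonCoeff p n s) := by
  induction F using MvPolynomial.induction_on with
  | C a =>
    rw [← MvPolynomial.algebraMap_eq, AlgHom.commutes, Derivation.map_algebraMap]
    simp
  | add F G hF hG => simp [hF, hG, add_mul, Finset.sum_add_distrib]
  | mul_X F j hF =>
    simp only [map_mul, Derivation.leibniz, smul_eq_mul, hF, MvPolynomial.pderiv_X, map_add,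
      add_mul, Finset.sum_add_distrib, Finset.mul_sum, dicksonEval_X, mul_assoc]
    congr 1
    rw [Finset.sum_eq_single j]
    · simp
    · intro s _ hs
      simp [hs.symm]
    · simp

/-- The elements whose `p`-th power lies in `N`. -/
def rootSubmodule (N : Submodule (ZMod p) (MvPolynomial (Fin n) (ZMod p))) :
    Submodule (ZMod p) (MvPolynomial (Fin n) (ZMod p)) where
  carrier := {u | u ^ p ∈ N}
  zero_mem' := by simp [(Fact.out : p.Prime).ne_zero]
  add_mem' {a b} ha hb := by
    rw [Set.mem_ofPred_eq, add_pow_char]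
    exact add_mem ha hb
  smul_mem' c a ha := by
    rw [Set.mem_ofPred_eq, smul_pow]
    exact N.smul_mem _ ha

/-- The total power is multiplicative, so $P^{pk}(u^p)=(P^ku)^p$. This permits taking $p$-th roots
during the descent. -/
theorem IsPowerClosed.root {N : Submodule (ZMod p) (MvPolynomial (Fin n) (ZMod p))}
    (hN : IsPowerClosed N) : IsPowerClosed (rootSubmodule N) := by
  intro k u hu
  have h : polyPower p n (p * k) (u ^ p) = polyPower p n k u ^ p := by
    rw [polyPower_apply, map_pow, ← Polynomial.map_frobenius_expand, Polynomial.coeff_map,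
      Polynomial.coeff_expand_mul' (Fact.out : p.Prime).pos, frobenius_def, polyPower_apply]
  change polyPower p n k u ^ p ∈ N
  exact h ▸ hN _ _ hu

variable [NeZero n]

/-- The derivation kills $p$-th powers. So in the Dickson relation only the coefficients $c_s$ and
the factor $y_j$ of the term $s=0$ are differentiated. -/
theorem milnor_relation (i : ℕ) (j : Fin n) :
    ∑ s, milnor p n i (dicksonCoeff p n s) * MvPolynomial.X j ^ p ^ (s : ℕ) =
      -(dicksonCoeff p n 0 * MvPolynomial.X j ^ p ^ i) := by
  have hpow : ∀ k : ℕ, k ≠ 0 → milnor p n i (MvPolynomial.X j ^ p ^ k) = 0 := by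
    intro k hk
    obtain ⟨k, rfl⟩ := Nat.exists_eq_succ_of_ne_zero hk
    rw [pow_succ, pow_mul, milnor_pow_char]
  have h := congrArg (milnor p n i) (dicksonCoeff_relation (p := p) j)
  rw [hpow n (NeZero.ne n), map_sum] at h
  simp only [Derivation.leibniz, smul_eq_mul, Finset.sum_add_distrib] at h
  rw [Finset.sum_eq_single 0] at h
  · rw [eq_neg_iff_add_eq_zero, add_comm, h]
    simp [mul_comm]
  · intro s _ hs
    rw [hpow _ (fun h0 => hs (Fin.ext (by simpa using h0))), mul_zero]
  · simp

/-- The right side of the differentiated relation is $-c_0$ times row $i$ of the Moore matrix, so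
the coordinates can be read off. At index $n$ that row is no longer in the matrix and is expanded by
the Dickson relation instead. -/
theorem milnor_dicksonCoeff_of_lt (i s : Fin n) :
    milnor p n i (dicksonCoeff p n s) = if s = i then -dicksonCoeff p n 0 else 0 := by
  refine congrFun (eq_of_sum_mul_moore_eq
    (a := fun s => milnor p n i (dicksonCoeff p n s))
    (b := fun s => if s = i then -dicksonCoeff p n 0 else 0)
    fun j => ?_) s
  rw [milnor_relation]
  simp

theorem milnor_dicksonCoeff_self (s : Fin n) :
    milnor p n n (dicksonCoeff p n s) = -(dicksonCoeff p n 0 * dicksonCoeff p n s) := by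
  refine congrFun (eq_of_sum_mul_moore_eq
    (a := fun s => milnor p n n (dicksonCoeff p n s)) (b := fun s => -(dicksonCoeff p n 0 *
    dicksonCoeff p n s)) fun j => ?_) s
  rw [milnor_relation, dicksonCoeff_relation]
  simp [Finset.mul_sum, mul_assoc]

theorem milnor_dicksonEval_of_lt (i : Fin n) (F : MvPolynomial (Fin n) (ZMod p)) :
    milnor p n i (dicksonEval p n F) =
      -dicksonEval p n (MvPolynomial.X 0 * MvPolynomial.pderiv i F) := by
  simp [derivation_dicksonEval, milnor_dicksonCoeff_of_lt, mul_comm]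

theorem milnor_dicksonEval_self (F : MvPolynomial (Fin n) (ZMod p)) :
    milnor p n n (dicksonEval p n F) = -dicksonEval p n
      (MvPolynomial.X 0 * ∑ s, MvPolynomial.X s * MvPolynomial.pderiv s F) := by
  simp only [derivation_dicksonEval, milnor_dicksonCoeff_self, map_mul, map_sum, dicksonEval_X,
    Finset.mul_sum, mul_neg, Finset.sum_neg_distrib]
  rw [neg_inj]
  exact Finset.sum_congr rfl fun s _ => by ring

variable (n) in
/-- The weight `1` on the first variable and `2` on the others. -/
def dicksonWeight (s : Fin n) : ℕ := if s = 0 then 1 else 2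

theorem eq_C_mul_X_of_weightedTotalDegree_le_one {F : MvPolynomial (Fin n) (ZMod p)}
    (h : F.weightedTotalDegree (dicksonWeight n) ≤ 1) (h0 : F.coeff 0 = 0) :
    ∃ a, F = MvPolynomial.C a * MvPolynomial.X 0 := by
  refine ⟨F.coeff (Finsupp.single 0 1), ?_⟩
  ext d
  rw [MvPolynomial.coeff_C_mul, MvPolynomial.coeff_X]
  split_ifs with hd
  · rw [← hd, mul_one]
  · rw [mul_zero]
    by_contra hF
    have h1 := (MvPolynomial.le_weightedTotalDegree (dicksonWeight n)
      (MvPolynomial.mem_support_iff.2 hF)).trans h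
    rw [Finsupp.weight_apply, Finsupp.sum_fintype _ _ (by simp)] at h1
    have h2 : ∀ s, d s * dicksonWeight n s ≤ 1 := fun s =>
      (Finset.single_le_sum (f := fun s => d s * dicksonWeight n s) (fun _ _ => Nat.zero_le _)
        (Finset.mem_univ s)).trans h1
    have h3 : ∀ s, s ≠ 0 → d s = 0 := fun s hs => by
      have := h2 s
      rw [dicksonWeight, if_neg hs] at this
      omega
    have h4 : d 0 ≤ 1 := by simpa [dicksonWeight] using h2 0
    have h5 : d = Finsupp.single 0 (d 0) := by
      ext s
      rcases eq_or_ne s 0 with rfl | hs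
      · simp
      · simp [h3 s hs, hs]
    rcases Nat.le_one_iff_eq_zero_or_eq_one.1 h4 with h6 | h6
    · rw [h5, h6, Finsupp.single_zero] at hF
      exact hF h0
    · exact hd (by rw [h5, h6])

/-- Once the derivatives in the other variables vanish, the Euler sum in the action of `milnor p n
n` reduces to $X_0\,\partial/\partial X_0$. -/
theorem IsPowerClosed.sqEuler_mem {N : Submodule (ZMod p) (MvPolynomial (Fin n) (ZMod p))}
    (hN : IsPowerClosed N) {F : MvPolynomial (Fin n) (ZMod p)}
    (hF : ∀ i ≠ 0, MvPolynomial.pderiv i F = 0) (h : dicksonEval p n F ∈ N) :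
    dicksonEval p n (sqEuler 0 F) ∈ N := by
  have h1 := hN.milnor_mem (Nat.one_le_iff_ne_zero.2 (NeZero.ne n)) _ h
  rw [milnor_dicksonEval_self, Finset.sum_eq_single 0 (fun s _ hs => by rw [hF s hs, mul_zero])
    (by simp), neg_mem_iff, ← mul_assoc, ← pow_two] at h1
  exact h1

theorem pderiv_sqEuler_zero {F : MvPolynomial (Fin n) (ZMod p)}
    (hF : ∀ i ≠ 0, MvPolynomial.pderiv i F = 0) (i : Fin n) (hi : i ≠ 0) :
    MvPolynomial.pderiv i (sqEuler 0 F) = 0 := by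
  rw [sqEuler_apply, MvPolynomial.pderiv_mul, MvPolynomial.pderiv_pow, pderiv_pderiv_comm,
    hF i hi, MvPolynomial.pderiv_X_of_ne hi.symm]
  simp

/-- Every nonzero polynomial without constant term in the Dickson invariants generates a power of
the top Dickson invariant. -/
theorem exists_dicksonCoeff_pow_mem {F : MvPolynomial (Fin n) (ZMod p)} (hF : F ≠ 0)
    (h0 : F.coeff 0 = 0) {N : Submodule (ZMod p) (MvPolynomial (Fin n) (ZMod p))}
    (hN : IsPowerClosed N) (hFN : dicksonEval p n F ∈ N) :
    ∃ k, dicksonCoeff p n 0 ^ p ^ k ∈ N := by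
  induction hm : F.weightedTotalDegree (dicksonWeight n) using Nat.strong_induction_on
    generalizing F N with
  | _ m ih =>
  subst hm
  by_cases hi : ∀ i ≠ 0, MvPolynomial.pderiv i F = 0
  -- No derivative in the variables other than $X_0$ is left. In weight at most $1$ the polynomial
  -- is a multiple of $X_0$, which ends the descent.
  · rcases le_or_gt (F.weightedTotalDegree (dicksonWeight n)) 1 with hle | hgt
    · obtain ⟨a, rfl⟩ := eq_C_mul_X_of_weightedTotalDegree_le_one hle h0
      have ha : a ≠ 0 := by
        rintro rfl
        simp at hF
      refine ⟨0, ?_⟩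
      rw [← MvPolynomial.smul_eq_C_mul, map_smul, dicksonEval_X, N.smul_mem_iff ha] at hFN
      simpa using hFN
    -- Stop $X_0^2\,\partial/\partial X_0$ at its last nonzero iterate: there the derivative in
    -- $X_0$ vanishes as well, so this iterate is a $p$-th power $G^p$.
    · have hex : ∃ j, (sqEuler 0)^[j] F = 0 := ⟨p, sqEuler_iterate_prime 0 F⟩
      obtain ⟨j, hj⟩ : ∃ j, Nat.find hex = j + 1 := Nat.exists_eq_succ_of_ne_zero (by
        intro h
        exact hF (by simpa [h] using Nat.find_spec hex))
      have hjp : j + 1 ≤ p := hj ▸ Nat.find_le (sqEuler_iterate_prime 0 F)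
      have hne : (sqEuler 0)^[j] F ≠ 0 := Nat.find_min hex (by omega)
      have hz : sqEuler 0 ((sqEuler 0)^[j] F) = 0 := by
        rw [← Function.iterate_succ_apply' (sqEuler 0), ← Nat.succ_eq_add_one] at *
        exact hj ▸ Nat.find_spec hex
      have hinv : ∀ t : ℕ, (∀ i ≠ 0, MvPolynomial.pderiv i ((sqEuler 0)^[t] F) = 0) ∧
          dicksonEval p n ((sqEuler 0)^[t] F) ∈ N ∧ ((sqEuler 0)^[t] F).coeff 0 = 0 ∧
          ((sqEuler 0)^[t] F).weightedTotalDegree (dicksonWeight n) ≤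
            F.weightedTotalDegree (dicksonWeight n) + t := by
        intro t
        induction t with
        | zero => exact ⟨hi, hFN, h0, le_rfl⟩
        | succ t iht =>
          rw [Function.iterate_succ_apply']
          refine ⟨pderiv_sqEuler_zero iht.1, hN.sqEuler_mem iht.1 iht.2.1, ?_, ?_⟩
          · rw [sqEuler_apply, ← MvPolynomial.constantCoeff_eq]
            simp
          · rw [sqEuler_apply, pow_two, mul_assoc]
            by_cases hp0 : MvPolynomial.pderiv 0 ((sqEuler 0)^[t] F) = 0
            · rw [hp0]
              simp [MvPolynomial.weightedTotalDegree_zero]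
            have e1 := weightedTotalDegree_X_mul_le (dicksonWeight n) 0
              (MvPolynomial.X 0 * MvPolynomial.pderiv 0 ((sqEuler 0)^[t] F))
            have e2 := weightedTotalDegree_X_mul_le (dicksonWeight n) 0
              (MvPolynomial.pderiv 0 ((sqEuler 0)^[t] F))
            have e3 := weightedTotalDegree_pderiv_add_le (dicksonWeight n) 0 hp0
            have e4 : dicksonWeight n 0 = 1 := by simp [dicksonWeight]
            have e5 := iht.2.2.2
            omega
      obtain ⟨hd, hmem, hc, hw⟩ := hinv j
      have hd0 : MvPolynomial.pderiv 0 ((sqEuler 0)^[j] F) = 0 := by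
        rw [sqEuler_apply, mul_eq_zero] at hz
        exact hz.resolve_left (pow_ne_zero _ (MvPolynomial.X_ne_zero _))
      obtain ⟨G, hG⟩ := exists_pow_eq_of_pderiv_eq_zero (F := (sqEuler 0)^[j] F) fun i =>
        (eq_or_ne i 0).elim (fun h => h ▸ hd0) (hd i)
      rw [hG] at hne hmem hc hw
      have hp := (Fact.out : p.Prime)
      have hle := (mul_weightedTotalDegree_le_pow (dicksonWeight n) G).trans hw
      -- At most $p-1$ iterations were made, each raising the weight by at most $1$. So
      -- $p\,\mathrm{wt}(G)\le \mathrm{wt}(F)+p-1$, which is less than $p\,\mathrm{wt}(F)$ because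
      -- $\mathrm{wt}(F)\ge 2$.
      have hlt : G.weightedTotalDegree (dicksonWeight n) <
          F.weightedTotalDegree (dicksonWeight n) := by
        have := hp.two_le
        by_contra hcon
        nlinarith
      rw [map_pow] at hmem
      obtain ⟨k, hk⟩ := ih _ hlt (F := G) (fun h => hne (by rw [h, zero_pow hp.ne_zero]))
        (by
          rw [← MvPolynomial.constantCoeff_eq, map_pow] at hc
          exact eq_zero_of_pow_eq_zero hc) hN.root hmem rfl
      refine ⟨k + 1, ?_⟩
      rw [pow_succ, pow_mul]
      exact hk
  · push Not at hi
    obtain ⟨i, hi0, hne⟩ := hi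
    -- The factor $X_0$ costs weight $1$ and the derivative in $X_i$ gains $2$: the weights are
    -- chosen so that this operator lowers the weight.
    have e1 := weightedTotalDegree_X_mul_le (dicksonWeight n) 0 (MvPolynomial.pderiv i F)
    have e2 := weightedTotalDegree_pderiv_add_le (dicksonWeight n) i hne
    have e3 : dicksonWeight n 0 = 1 := by simp [dicksonWeight]
    have e4 : dicksonWeight n i = 2 := by simp [dicksonWeight, hi0]
    refine ih _ (by omega) (F := MvPolynomial.X 0 * MvPolynomial.pderiv i F)
      (mul_ne_zero (MvPolynomial.X_ne_zero _) hne) (by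
        rw [← MvPolynomial.constantCoeff_eq]
        simp) hN ?_ rfl
    have h1 := hN.milnor_mem (i := i) (Nat.one_le_iff_ne_zero.2 fun h => hi0 (Fin.ext (by
      simpa using h))) _ hFN
    rwa [milnor_dicksonEval_of_lt, neg_mem_iff] at h1

/-- The derivation `milnor p n n` sends $D^m$ to $-mD^{m+1}$ up to the sign of $D$, so $D$ leads to
$D^p$ through exponents invertible mod $p$; roots reduce the step from $p^j$ to $p^{j+1}$ to this
one. This is needed to find one power of $D$ common to two subspaces. -/
theorem IsPowerClosed.dicksonCoeff_pow_mem
    {N : Submodule (ZMod p) (MvPolynomial (Fin n) (ZMod p))} (hN : IsPowerClosed N) {j k : ℕ}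
    (hjk : j ≤ k) (h : dicksonCoeff p n 0 ^ p ^ j ∈ N) : dicksonCoeff p n 0 ^ p ^ k ∈ N := by
  have hp := (Fact.out : p.Prime)
  have hbase : ∀ N' : Submodule (ZMod p) (MvPolynomial (Fin n) (ZMod p)), IsPowerClosed N' →
      dicksonCoeff p n 0 ∈ N' → dicksonCoeff p n 0 ^ p ∈ N' := by
    intro N' hN' h'
    have hm : ∀ m : ℕ, m < p → dicksonCoeff p n 0 ^ (m + 1) ∈ N' := by
      intro m
      induction m with
      | zero => intro _; simpa using h'
      | succ m ihm =>
        intro hlt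
        have h1 := hN'.milnor_mem (Nat.one_le_iff_ne_zero.2 (NeZero.ne n)) _ (ihm (by omega))
        rw [Derivation.leibniz_pow, milnor_dicksonCoeff_self, ← Nat.cast_smul_eq_nsmul (ZMod p),
          N'.smul_mem_iff, smul_neg, neg_mem_iff] at h1
        · convert h1 using 1
          simp only [Nat.add_sub_cancel, smul_eq_mul]
          ring
        · rw [Ne, ZMod.natCast_eq_zero_iff]
          exact Nat.not_dvd_of_pos_of_lt (Nat.succ_pos m) hlt
    have := hm (p - 1) (by have := hp.pos; omega)
    rwa [Nat.sub_add_cancel hp.one_le] at this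
  have hroot : ∀ (j : ℕ) (N' : Submodule (ZMod p) (MvPolynomial (Fin n) (ZMod p))),
      IsPowerClosed N' → dicksonCoeff p n 0 ^ p ^ j ∈ N' →
        dicksonCoeff p n 0 ^ p ^ (j + 1) ∈ N' := by
    intro j
    induction j with
    | zero => intro N' hN' h'; simpa using hbase N' hN' (by simpa using h')
    | succ j ihj =>
      intro N' hN' h'
      rw [pow_succ, pow_mul] at h' ⊢
      exact ihj (rootSubmodule N') hN'.root h'
  induction k, hjk using Nat.le_induction with
  | base => exact h
  | succ k _ ihk => exact hroot k N hN ihk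

end DicksonAlgebra

/-! ### Bockstein, Milnor operations and total power on $H$ -/

section Basic

variable (p n : ℕ)

/-- The projection which kills the exterior generators. -/
def exteriorAug : Coh p n →ₐ[ZMod p] MvPolynomial (Fin n) (ZMod p) :=
  Algebra.TensorProduct.lift
    ((Algebra.ofId (ZMod p) _).comp ExteriorAlgebra.algebraMapInv) (AlgHom.id _ _)
    fun _ _ => Commute.all _ _

/-- The grade involution with respect to the exterior degree. -/
def gradeInvol : Coh p n →ₐ[ZMod p] Coh p n :=
  Algebra.TensorProduct.map
    (CliffordAlgebra.involute (Q := (0 : QuadraticForm (ZMod p) (Fin n → ZMod p))))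
    (AlgHom.id _ _)

/-- The contraction `∂/∂x_j`. -/
def contr (j : Fin n) : Coh p n →ₗ[ZMod p] Coh p n :=
  LinearMap.rTensor _ (CliffordAlgebra.contractLeft
    (Q := (0 : QuadraticForm (ZMod p) (Fin n → ZMod p))) (LinearMap.proj j))

/-- The derivation `x_j ↦ y_j ^ p ^ i`. -/
def tau (i : ℕ) : Coh p n →ₗ[ZMod p] Coh p n :=
  ∑ j : Fin n, LinearMap.mulLeft (ZMod p) (incl p n (MvPolynomial.X j ^ p ^ i)) ∘ₗ contr p n j

theorem commute_map_incl (a : ExteriorAlgebra (ZMod p) (Fin n → ZMod p))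
    (b : MvPolynomial (Fin n) (ZMod p)) :
    Commute ((Polynomial.CAlgHom (R := ZMod p)).comp
        (Algebra.TensorProduct.includeLeft : _ →ₐ[ZMod p] Coh p n) a)
      ((Polynomial.mapAlgHom (incl p n)).comp (totalPower p n) b) := by
  ext k
  simp [incl, Polynomial.coeff_C_mul, Polynomial.coeff_mul_C]

/-- The total reduced power on `E(x_1, …, x_n) ⊗ P[y_1, …, y_n]`. -/
def cohPower : Coh p n →ₐ[ZMod p] Polynomial (Coh p n) :=
  Algebra.TensorProduct.lift
    (Polynomial.CAlgHom.comp Algebra.TensorProduct.includeLeft)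
    ((Polynomial.mapAlgHom (incl p n)).comp (totalPower p n))
    (commute_map_incl p n)

variable {p n}

theorem incl_mul_tmul (q b : MvPolynomial (Fin n) (ZMod p))
    (a : ExteriorAlgebra (ZMod p) (Fin n → ZMod p)) :
    incl p n q * (a ⊗ₜ b) = a ⊗ₜ (q * b) := by
  simp [incl]

theorem tmul_eq (a : ExteriorAlgebra (ZMod p) (Fin n → ZMod p))
    (b : MvPolynomial (Fin n) (ZMod p)) : (a ⊗ₜ b : Coh p n) = (a ⊗ₜ 1) * incl p n b := by
  simp [incl]

theorem incl_commute (q : MvPolynomial (Fin n) (ZMod p)) (z : Coh p n) :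
    Commute (incl p n q) z := by
  induction z using TensorProduct.induction_on with
  | zero => exact Commute.zero_right _
  | tmul a b => simp [Commute, SemiconjBy, incl, mul_comm]
  | add z w hz hw => exact hz.add_right hw

theorem incl_mul_eq_lTensor (q : MvPolynomial (Fin n) (ZMod p)) (z : Coh p n) :
    incl p n q * z = LinearMap.lTensor _ (LinearMap.mulLeft (ZMod p) q) z := by
  induction z using TensorProduct.induction_on with
  | zero => simp
  | tmul a b => rw [incl_mul_tmul]; rfl
  | add z w hz hw => rw [mul_add, hz, hw, map_add]

@[simp] theorem exteriorAug_incl (q : MvPolynomial (Fin n) (ZMod p)) :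
    exteriorAug p n (incl p n q) = q := by
  simp [exteriorAug, incl]

@[simp] theorem exteriorAug_tmul (a : ExteriorAlgebra (ZMod p) (Fin n → ZMod p))
    (b : MvPolynomial (Fin n) (ZMod p)) :
    exteriorAug p n (a ⊗ₜ b) = MvPolynomial.C (ExteriorAlgebra.algebraMapInv a) * b := by
  simp [exteriorAug, Algebra.ofId_apply, MvPolynomial.algebraMap_eq]

theorem incl_injective : Function.Injective (incl p n) :=
  Function.LeftInverse.injective exteriorAug_incl

@[simp] theorem exteriorAug_x (j : Fin n) : exteriorAug p n (x p n j) = 0 := by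
  simp [x, ExteriorAlgebra.algebraMapInv]

@[simp] theorem gradeInvol_incl (q : MvPolynomial (Fin n) (ZMod p)) :
    gradeInvol p n (incl p n q) = incl p n q := by
  simp [gradeInvol, incl]

@[simp] theorem gradeInvol_x (j : Fin n) : gradeInvol p n (x p n j) = -x p n j := by
  rw [x, gradeInvol, Algebra.TensorProduct.map_tmul, ← TensorProduct.neg_tmul]
  congr 1
  exact CliffordAlgebra.involute_ι _

theorem contr_tmul (j : Fin n) (a : ExteriorAlgebra (ZMod p) (Fin n → ZMod p))
    (b : MvPolynomial (Fin n) (ZMod p)) :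
    contr p n j (a ⊗ₜ b) = CliffordAlgebra.contractLeft
      (Q := (0 : QuadraticForm (ZMod p) (Fin n → ZMod p))) (LinearMap.proj j) a ⊗ₜ b := rfl

theorem contractLeft_mul (d : Module.Dual (ZMod p) (Fin n → ZMod p))
    (a b : CliffordAlgebra (0 : QuadraticForm (ZMod p) (Fin n → ZMod p))) :
    CliffordAlgebra.contractLeft d (a * b) = CliffordAlgebra.contractLeft d a * b +
      CliffordAlgebra.involute a * CliffordAlgebra.contractLeft d b := by
  induction a using CliffordAlgebra.left_induction with
  | algebraMap r =>
    rw [CliffordAlgebra.contractLeft_algebraMap_mul, CliffordAlgebra.contractLeft_algebraMap,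
      AlgHom.commutes, zero_mul, zero_add]
  | add a a' h h' =>
    rw [add_mul, map_add, h, h', map_add, map_add, add_mul, add_mul]
    abel
  | ι_mul a m h =>
    rw [mul_assoc, CliffordAlgebra.contractLeft_ι_mul, h, CliffordAlgebra.contractLeft_ι_mul,
      map_mul, CliffordAlgebra.involute_ι]
    simp only [smul_mul_assoc, sub_mul, mul_add, neg_mul, mul_assoc]
    abel

theorem contr_mul (j : Fin n) (u v : Coh p n) :
    contr p n j (u * v) = contr p n j u * v + gradeInvol p n u * contr p n j v := by
  induction u using TensorProduct.induction_on with
  | zero => simp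
  | add u u' h h' => rw [add_mul, map_add, h, h', map_add, map_add, add_mul, add_mul]; abel
  | tmul a b =>
    induction v using TensorProduct.induction_on with
    | zero => simp
    | add v v' h h' => rw [mul_add, map_add, h, h', map_add, mul_add, mul_add]; abel
    | tmul c d =>
      rw [Algebra.TensorProduct.tmul_mul_tmul, contr_tmul, contr_tmul, contr_tmul, gradeInvol,
        Algebra.TensorProduct.map_tmul, Algebra.TensorProduct.tmul_mul_tmul,
        Algebra.TensorProduct.tmul_mul_tmul, AlgHom.id_apply, ← TensorProduct.add_tmul]
      exact congrArg (· ⊗ₜ (b * d)) (contractLeft_mul _ a c)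

theorem contr_incl (j : Fin n) (q : MvPolynomial (Fin n) (ZMod p)) :
    contr p n j (incl p n q) = 0 := by
  rw [incl, Algebra.TensorProduct.includeRight_apply, contr_tmul]
  erw [CliffordAlgebra.contractLeft_one]
  rw [TensorProduct.zero_tmul]

theorem contr_incl_mul (j : Fin n) (q : MvPolynomial (Fin n) (ZMod p)) (z : Coh p n) :
    contr p n j (incl p n q * z) = incl p n q * contr p n j z := by
  rw [contr_mul, contr_incl, gradeInvol_incl, zero_mul, zero_add]

theorem contr_x (j k : Fin n) : contr p n j (x p n k) = if k = j then 1 else 0 := by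
  rw [x, contr_tmul]
  erw [CliffordAlgebra.contractLeft_ι]
  split_ifs with h
  · subst h
    simp [Algebra.TensorProduct.one_def]
  · simp [Ne.symm h]

theorem contr_add_contr (j k : Fin n) (z : Coh p n) :
    contr p n j (contr p n k z) + contr p n k (contr p n j z) = 0 := by
  induction z using TensorProduct.induction_on with
  | zero => simp
  | tmul a b =>
    simp only [contr_tmul]
    rw [CliffordAlgebra.contractLeft_comm, ← TensorProduct.add_tmul, neg_add_cancel,
      TensorProduct.zero_tmul]
  | add z w hz hw =>
    simp only [map_add]
    rw [add_add_add_comm, hz, hw, add_zero]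

theorem tau_apply (i : ℕ) (z : Coh p n) :
    tau p n i z = ∑ j, incl p n (MvPolynomial.X j ^ p ^ i) * contr p n j z := by
  simp [tau]

theorem tau_zero (z : Coh p n) : tau p n 0 z = bockstein p n z := by
  rw [tau_apply, bockstein, LinearMap.sum_apply]
  refine Finset.sum_congr rfl fun j _ => ?_
  rw [pow_zero, pow_one]
  induction z using TensorProduct.induction_on with
  | zero => simp
  | tmul a b => rw [contr_tmul, incl_mul_tmul]; rfl
  | add z w hz hw => rw [map_add, mul_add, hz, hw, map_add]

theorem tau_add_tau (i k : ℕ) (z : Coh p n) :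
    tau p n i (tau p n k z) + tau p n k (tau p n i z) = 0 := by
  simp only [tau_apply, map_sum, contr_incl_mul]
  rw [Finset.sum_comm, ← Finset.sum_add_distrib]
  refine Finset.sum_eq_zero fun a _ => ?_
  rw [← Finset.sum_add_distrib]
  refine Finset.sum_eq_zero fun b _ => ?_
  rw [← mul_assoc, ← mul_assoc, ← map_mul, ← map_mul, mul_comm (MvPolynomial.X a ^ _),
    ← mul_add, contr_add_contr, mul_zero]

theorem bockstein_mul (u v : Coh p n) :
    bockstein p n (u * v) = bockstein p n u * v + gradeInvol p n u * bockstein p n v := by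
  simp only [← tau_zero, tau_apply, contr_mul, mul_add, Finset.sum_add_distrib, Finset.sum_mul,
    Finset.mul_sum, mul_assoc]
  congr 1
  refine Finset.sum_congr rfl fun j _ => ?_
  rw [← mul_assoc, (incl_commute _ _).eq, mul_assoc]

theorem bockstein_incl (q : MvPolynomial (Fin n) (ZMod p)) : bockstein p n (incl p n q) = 0 := by
  simp [← tau_zero, tau_apply, contr_incl]

theorem bockstein_incl_mul (q : MvPolynomial (Fin n) (ZMod p)) (z : Coh p n) :
    bockstein p n (incl p n q * z) = incl p n q * bockstein p n z := by
  rw [bockstein_mul, bockstein_incl, gradeInvol_incl, zero_mul, zero_add]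

theorem bockstein_x (j : Fin n) : bockstein p n (x p n j) = incl p n (MvPolynomial.X j) := by
  simp [← tau_zero, tau_apply, contr_x]

theorem power_tmul (k : ℕ) (a : ExteriorAlgebra (ZMod p) (Fin n → ZMod p))
    (b : MvPolynomial (Fin n) (ZMod p)) : power p n k (a ⊗ₜ b) = a ⊗ₜ polyPower p n k b := rfl

theorem power_incl (k : ℕ) (q : MvPolynomial (Fin n) (ZMod p)) :
    power p n k (incl p n q) = incl p n (polyPower p n k q) := rfl

theorem power_contr (k : ℕ) (j : Fin n) (z : Coh p n) :
    power p n k (contr p n j z) = contr p n j (power p n k z) := by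
  induction z using TensorProduct.induction_on with
  | zero => simp
  | tmul a b => rfl
  | add z w hz hw => simp only [map_add, hz, hw]

theorem cohPower_tmul (a : ExteriorAlgebra (ZMod p) (Fin n → ZMod p))
    (b : MvPolynomial (Fin n) (ZMod p)) : cohPower p n (a ⊗ₜ b) =
      Polynomial.C (a ⊗ₜ 1) * (totalPower p n b).map (incl p n).toRingHom := by
  rw [cohPower, Algebra.TensorProduct.lift_tmul]
  rfl

theorem coeff_cohPower (k : ℕ) (z : Coh p n) : (cohPower p n z).coeff k = power p n k z := by
  induction z using TensorProduct.induction_on with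
  | zero => simp
  | tmul a b =>
    rw [cohPower_tmul, Polynomial.coeff_C_mul, Polynomial.coeff_map, power_tmul,
      tmul_eq a (polyPower p n k b)]
    rfl
  | add z w hz hw => simp only [map_add, Polynomial.coeff_add, hz, hw]

theorem cohPower_incl (q : MvPolynomial (Fin n) (ZMod p)) :
    cohPower p n (incl p n q) = (totalPower p n q).map (incl p n).toRingHom := by
  rw [incl, Algebra.TensorProduct.includeRight_apply, cohPower_tmul, ← Algebra.TensorProduct.one_def,
    Polynomial.C_1, one_mul]
  rfl

theorem cohPower_x (j : Fin n) : cohPower p n (x p n j) = Polynomial.C (x p n j) := by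
  rw [x, cohPower_tmul, map_one, Polynomial.map_one, mul_one]

theorem x_mul_x (i j : Fin n) : x p n i * x p n j = -(x p n j * x p n i) := by
  rw [eq_neg_iff_add_eq_zero]
  simp only [x, Algebra.TensorProduct.tmul_mul_tmul, ← TensorProduct.add_tmul, mul_one,
    ExteriorAlgebra.ι_add_mul_swap, TensorProduct.zero_tmul]

variable [Fact p.Prime]

theorem eq_zero_of_incl_mul_eq_zero {q : MvPolynomial (Fin n) (ZMod p)} (hq : q ≠ 0)
    {z : Coh p n} (h : incl p n q * z = 0) : z = 0 := by
  rw [incl_mul_eq_lTensor] at h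
  refine (injective_iff_map_eq_zero _).1 (Module.Flat.lTensor_preserves_injective_linearMap
    (M := ExteriorAlgebra (ZMod p) (Fin n → ZMod p)) (LinearMap.mulLeft (ZMod p) q) ?_) z h
  exact mul_right_injective₀ hq

theorem power_incl_X_pow_mul (i : ℕ) (j : Fin n) (z : Coh p n) :
    power p n (p ^ i) (incl p n (MvPolynomial.X j ^ p ^ i) * z) =
      incl p n (MvPolynomial.X j ^ p ^ i) * power p n (p ^ i) z +
        incl p n (MvPolynomial.X j ^ p ^ (i + 1)) * z := by
  induction z using TensorProduct.induction_on with
  | zero => simp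
  | tmul a b =>
    have h : polyPower p n (p ^ i) (MvPolynomial.X j ^ p ^ i * b) =
        MvPolynomial.X j ^ p ^ i * polyPower p n (p ^ i) b +
          MvPolynomial.X j ^ p ^ (i + 1) * b := by
      rw [polyPower_apply, map_mul, totalPower_X_pow, add_mul, mul_assoc, Polynomial.coeff_add,
        Polynomial.coeff_C_mul, Polynomial.coeff_X_pow_mul', if_pos le_rfl, Nat.sub_self,
        Polynomial.coeff_C_mul, ← polyPower_apply, ← polyPower_apply, polyPower_zero]
    rw [incl_mul_tmul, power_tmul, h, TensorProduct.tmul_add, power_tmul, incl_mul_tmul,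
      incl_mul_tmul]
  | add z w hz hw => simp only [mul_add, map_add, hz, hw]; abel

/-- Milnor's recursion, starting from $\beta$. A reduced power commutes with $\partial/\partial
x_j$, so the commutator only sees its action on the coefficient $y_j^{p^i}$, whose highest power is
$y_j^{p^{i+1}}$. -/
theorem tau_succ (i : ℕ) (z : Coh p n) :
    tau p n (i + 1) z = power p n (p ^ i) (tau p n i z) - tau p n i (power p n (p ^ i) z) := by
  simp only [tau_apply, map_sum, power_incl_X_pow_mul, power_contr, Finset.sum_add_distrib]
  abel

end Basic

/-! ### Elimination of the exterior generators -/

section Exterior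

variable (p n : ℕ)

/-- The operator `a ↦ a - e_j ∧ ∂a/∂e_j` on the exterior algebra. -/
def killGen (j : Fin n) : ExteriorAlgebra (ZMod p) (Fin n → ZMod p) →ₗ[ZMod p]
    ExteriorAlgebra (ZMod p) (Fin n → ZMod p) :=
  LinearMap.id - LinearMap.mulLeft (ZMod p)
    (ExteriorAlgebra.ι (ZMod p) (Pi.single j (1 : ZMod p))) ∘ₗ CliffordAlgebra.contractLeft
      (Q := (0 : QuadraticForm (ZMod p) (Fin n → ZMod p))) (LinearMap.proj j)

/-- The composite of the operators `killGen` over a list. -/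
def killGens (l : List (Fin n)) : ExteriorAlgebra (ZMod p) (Fin n → ZMod p) →ₗ[ZMod p]
    ExteriorAlgebra (ZMod p) (Fin n → ZMod p) :=
  l.foldr (fun j f => killGen p n j ∘ₗ f) LinearMap.id

variable {p n}

theorem killGen_apply (j : Fin n) (a : ExteriorAlgebra (ZMod p) (Fin n → ZMod p)) :
    killGen p n j a = a - ExteriorAlgebra.ι (ZMod p) (Pi.single j (1 : ZMod p)) *
      CliffordAlgebra.contractLeft
        (Q := (0 : QuadraticForm (ZMod p) (Fin n → ZMod p))) (LinearMap.proj j) a := rfl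

theorem killGens_cons (j : Fin n) (l : List (Fin n))
    (a : ExteriorAlgebra (ZMod p) (Fin n → ZMod p)) :
    killGens p n (j :: l) a = killGen p n j (killGens p n l a) := rfl

theorem killGen_ι_mul (j k : Fin n) (a : ExteriorAlgebra (ZMod p) (Fin n → ZMod p)) :
    killGen p n j (ExteriorAlgebra.ι (ZMod p) (Pi.single k (1 : ZMod p)) * a) =
      if j = k then 0 else
        ExteriorAlgebra.ι (ZMod p) (Pi.single k (1 : ZMod p)) * killGen p n j a := by
  have hc : CliffordAlgebra.contractLeft
      (Q := (0 : QuadraticForm (ZMod p) (Fin n → ZMod p))) (LinearMap.proj j)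
      (ExteriorAlgebra.ι (ZMod p) (Pi.single k (1 : ZMod p)) * a) =
      (Pi.single k (1 : ZMod p) : Fin n → ZMod p) j • a -
        ExteriorAlgebra.ι (ZMod p) (Pi.single k (1 : ZMod p)) * CliffordAlgebra.contractLeft
          (Q := (0 : QuadraticForm (ZMod p) (Fin n → ZMod p))) (LinearMap.proj j) a :=
    CliffordAlgebra.contractLeft_ι_mul _ _ _
  rw [killGen_apply, hc, killGen_apply]
  split_ifs with h
  · subst h
    rw [Pi.single_eq_same, one_smul, mul_sub, ← mul_assoc, ExteriorAlgebra.ι_sq_zero, zero_mul,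
      sub_zero, sub_self]
  · have hs := eq_neg_of_add_eq_zero_left (ExteriorAlgebra.ι_add_mul_swap (R := ZMod p)
      (Pi.single j (1 : ZMod p) : Fin n → ZMod p) (Pi.single k (1 : ZMod p)))
    rw [Pi.single_eq_of_ne h, zero_smul, zero_sub, mul_sub, ← mul_assoc, mul_neg, ← mul_assoc, hs,
      neg_mul, neg_neg]

theorem killGens_ι_mul (l : List (Fin n)) (k : Fin n)
    (a : ExteriorAlgebra (ZMod p) (Fin n → ZMod p)) :
    killGens p n l (ExteriorAlgebra.ι (ZMod p) (Pi.single k (1 : ZMod p)) * a) =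
      if k ∈ l then 0 else
        ExteriorAlgebra.ι (ZMod p) (Pi.single k (1 : ZMod p)) * killGens p n l a := by
  induction l with
  | nil => rfl
  | cons j l ih =>
    rw [killGens_cons, ih]
    by_cases hk : k ∈ l
    · simp [hk]
    · rw [if_neg hk, killGen_ι_mul]
      by_cases hj : j = k
      · simp [hj]
      · simp [hj, hk, Ne.symm hj, killGens_cons]

theorem killGens_algebraMap (l : List (Fin n)) (r : ZMod p) :
    killGens p n l (algebraMap _ _ r) = algebraMap _ _ r := by
  induction l with
  | nil => rfl
  | cons j l ih =>
    rw [killGens_cons, ih, killGen_apply]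
    erw [CliffordAlgebra.contractLeft_algebraMap]
    rw [mul_zero, sub_zero]

/-- Each factor kills the monomials containing its generator, so all of them together leave the
constant term. -/
theorem killGens_finRange (a : ExteriorAlgebra (ZMod p) (Fin n → ZMod p)) :
    killGens p n (List.finRange n) a =
      algebraMap _ _ (ExteriorAlgebra.algebraMapInv a) := by
  induction a using CliffordAlgebra.left_induction with
  | algebraMap r =>
    exact (killGens_algebraMap _ r).trans
      (congrArg _ (ExteriorAlgebra.algebraMap_leftInverse (Fin n → ZMod p) r).symm)
  | add a b ha hb => rw [map_add, ha, hb, map_add, map_add]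
  | ι_mul a m h =>
    change killGens p n (List.finRange n) (ExteriorAlgebra.ι (ZMod p) m * a) =
      algebraMap _ _ (ExteriorAlgebra.algebraMapInv (ExteriorAlgebra.ι (ZMod p) m * a))
    have hm : m = ∑ k, m k • (Pi.single k (1 : ZMod p) : Fin n → ZMod p) := by
      ext i
      simp [Finset.sum_apply, Pi.single_apply]
    have h0 : ExteriorAlgebra.algebraMapInv (ExteriorAlgebra.ι (ZMod p) m) = 0 := by
      simp [ExteriorAlgebra.algebraMapInv]
    rw [map_mul ExteriorAlgebra.algebraMapInv, h0, zero_mul, map_zero, hm, map_sum,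
      Finset.sum_mul, map_sum]
    refine Finset.sum_eq_zero fun k _ => ?_
    rw [map_smul, smul_mul_assoc, map_smul, killGens_ι_mul, if_pos (List.mem_finRange k),
      smul_zero]

/-- An element with vanishing contractions is fixed by every operator $1-e_j\wedge\partial_j$, hence
by their composite, which is the projection to exterior degree $0$. -/
theorem eq_incl_of_contr_eq_zero {z : Coh p n} (h : ∀ j, contr p n j z = 0) :
    z = incl p n (exteriorAug p n z) := by
  have h1 : ∀ l, LinearMap.rTensor _ (killGens p n l) z = z := by
    intro l
    induction l with
    | nil => exact LinearMap.rTensor_id_apply _ _ _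
    | cons j l ih =>
      have e : killGens p n (j :: l) = killGen p n j ∘ₗ killGens p n l := rfl
      rw [e, LinearMap.rTensor_comp_apply, ih, killGen, LinearMap.rTensor_sub,
        LinearMap.rTensor_comp, LinearMap.rTensor_id]
      have h2 := h j
      rw [contr] at h2
      rw [LinearMap.sub_apply, LinearMap.comp_apply, h2, map_zero, sub_zero, LinearMap.id_apply]
  have h2 : ∀ w : Coh p n, LinearMap.rTensor _ (killGens p n (List.finRange n)) w =
      incl p n (exteriorAug p n w) := by
    intro w
    induction w using TensorProduct.induction_on with
    | zero => simp
    | tmul a b =>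
      rw [LinearMap.rTensor_tmul, killGens_finRange, exteriorAug_tmul, incl,
        Algebra.TensorProduct.includeRight_apply, Algebra.algebraMap_eq_smul_one,
        TensorProduct.smul_tmul, MvPolynomial.smul_eq_C_mul]
    | add z w hz hw => simp only [map_add, hz, hw]
  rw [← h2, h1]

/-- Closed under the Bockstein and all reduced powers. -/
structure IsSteenrodClosed (K : Submodule (ZMod p) (Coh p n)) : Prop where
  bockstein_mem : ∀ z ∈ K, bockstein p n z ∈ K
  power_mem : ∀ k, ∀ z ∈ K, power p n k z ∈ K

variable [Fact p.Prime]

theorem IsSteenrodClosed.tau_mem {K : Submodule (ZMod p) (Coh p n)} (hK : IsSteenrodClosed K)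
    (i : ℕ) : ∀ z ∈ K, tau p n i z ∈ K := by
  induction i with
  | zero => exact fun z hz => tau_zero z ▸ hK.bockstein_mem z hz
  | succ i ih =>
    intro z hz
    rw [tau_succ]
    exact sub_mem (hK.power_mem _ _ (ih z hz)) (ih _ (hK.power_mem _ _ hz))

/-- The operations `tau p n i`, $i<n$, are the Moore matrix applied to the contractions. The
adjugate recovers each contraction up to the factor $L_n$, which is not a zero divisor on $H$. -/
theorem contr_eq_zero_of_tau_eq_zero {z : Coh p n} (h : ∀ i < n, tau p n i z = 0) (k : Fin n) :
    contr p n k z = 0 := by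
  refine eq_zero_of_incl_mul_eq_zero (det_moore_ne_zero (p := p) (n := n)) ?_
  have h1 : ∑ i : Fin n, incl p n ((moore p n).adjugate k i) * tau p n i z = 0 :=
    Finset.sum_eq_zero fun i _ => by rw [h i i.2, mul_zero]
  simp only [tau_apply, Finset.mul_sum, ← mul_assoc, ← map_mul] at h1
  rw [Finset.sum_comm] at h1
  simp only [← Finset.sum_mul, ← map_sum] at h1
  have h2 : ∀ j, ∑ i : Fin n, (moore p n).adjugate k i * MvPolynomial.X j ^ p ^ (i : ℕ) =
      if k = j then (moore p n).det else 0 := by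
    intro j
    have := congrFun (congrFun (Matrix.adjugate_mul (moore p n)) k) j
    rw [Matrix.mul_apply] at this
    simpa [moore_apply, Matrix.one_apply] using this
  simp only [h2, apply_ite (incl p n), map_zero, ite_mul, zero_mul, Finset.sum_ite_eq,
    Finset.mem_univ, if_true] at h1
  exact h1

theorem tau_tau_self (hp : p ≠ 2) (i : ℕ) (z : Coh p n) : tau p n i (tau p n i z) = 0 := by
  have h := tau_add_tau i i z
  rw [← two_smul (ZMod p), smul_eq_zero] at h
  refine h.resolve_left fun h2 => hp ?_
  have h3 : ((2 : ℕ) : ZMod p) = 0 := by exact_mod_cast h2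
  rw [ZMod.natCast_eq_zero_iff] at h3
  exact (Nat.prime_dvd_prime_iff_eq Fact.out Nat.prime_two).1 h3

/-- Apply the Milnor operations of index $0,\dots,n-1$ one after another, skipping those that give
zero. Anticommutativity preserves the vanishing already reached, and the square of an operation is
zero because $p$ is odd. -/
theorem IsSteenrodClosed.exists_incl_mem (hp : p ≠ 2) {K : Submodule (ZMod p) (Coh p n)}
    (hK : IsSteenrodClosed K) {z : Coh p n} (hz : z ∈ K) (hz0 : z ≠ 0) :
    ∃ q, q ≠ 0 ∧ incl p n q ∈ K := by
  have h : ∀ m : ℕ, ∃ w ∈ K, w ≠ 0 ∧ ∀ i < m, tau p n i w = 0 := by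
    intro m
    induction m with
    | zero => exact ⟨z, hz, hz0, by simp⟩
    | succ m ih =>
      obtain ⟨w, hw, hw0, hwi⟩ := ih
      by_cases hm : tau p n m w = 0
      · exact ⟨w, hw, hw0, fun i hi => (Nat.lt_succ_iff_lt_or_eq.1 hi).elim (hwi i)
          fun h => h ▸ hm⟩
      · refine ⟨tau p n m w, hK.tau_mem m w hw, hm, fun i hi => ?_⟩
        rcases Nat.lt_succ_iff_lt_or_eq.1 hi with h | rfl
        · have := tau_add_tau i m w
          rwa [hwi i h, map_zero, add_zero] at this
        · exact tau_tau_self hp i w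
  obtain ⟨w, hw, hw0, hwi⟩ := h n
  have hq := eq_incl_of_contr_eq_zero (contr_eq_zero_of_tau_eq_zero hwi)
  refine ⟨exteriorAug p n w, fun h0 => hw0 ?_, hq ▸ hw⟩
  rw [hq, h0, map_zero]

variable [NeZero n]

/-- Every nonzero element without constant term generates a power of the top Dickson
invariant. -/
theorem IsSteenrodClosed.exists_forall_dicksonCoeff_pow_mem (hp : p ≠ 2)
    {K : Submodule (ZMod p) (Coh p n)} (hK : IsSteenrodClosed K)
    (hD : ∀ z ∈ K, exteriorAug p n z ∈ (dicksonEval p n).range)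
    (hc : ∀ z ∈ K, MvPolynomial.constantCoeff (exteriorAug p n z) = 0) (h0 : K ≠ ⊥)
    (hcc : ∀ s, MvPolynomial.constantCoeff (dicksonCoeff p n s) = 0) :
    ∃ k, ∀ j ≥ k, incl p n (dicksonCoeff p n 0 ^ p ^ j) ∈ K := by
  obtain ⟨z, hz, hz0⟩ := Submodule.exists_mem_ne_zero_of_ne_bot h0
  obtain ⟨q, hq0, hq⟩ := hK.exists_incl_mem hp hz hz0
  obtain ⟨F, rfl⟩ : q ∈ (dicksonEval p n).range := by simpa using hD _ hq
  have hN : IsPowerClosed (K.comap (incl p n).toLinearMap) := fun k q hq => by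
    have := hK.power_mem k _ (Submodule.mem_comap.1 hq)
    rwa [AlgHom.toLinearMap_apply, power_incl] at this
  -- The Dickson invariants have no constant term, so evaluating at them preserves constant terms.
  have hF : F.coeff 0 = 0 := by
    have h1 : (MvPolynomial.constantCoeff (R := ZMod p)).comp (dicksonEval p n).toRingHom =
        MvPolynomial.constantCoeff := by
      refine MvPolynomial.ringHom_ext (fun r => ?_) fun s => ?_
      · simp [dicksonEval]
      · simpa using hcc s
    have h2 := hc _ hq
    rw [exteriorAug_incl] at h2
    rw [← MvPolynomial.constantCoeff_eq, ← h1]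
    exact h2
  obtain ⟨k, hk⟩ := exists_dicksonCoeff_pow_mem (F := F) (fun h => hq0 (by rw [h]; exact map_zero _))
    hF hN hq
  exact ⟨k, fun j hj => hN.dicksonCoeff_pow_mem hj hk⟩

end Exterior

/-! ### Mùi's determinants in terms of the forms $\xi_s$ -/

section Mui

variable (p n : ℕ)

/-- `∑ j, adj(A)_{j s} x_j` for the Moore matrix `A`; up to sign, this is `M_{n;s}`. -/
def xi (s : Fin n) : Coh p n := ∑ j, incl p n ((moore p n).adjugate j s) * x p n j

variable {p n}

/-- Inverts the definition of the $\xi_a$: after multiplication by $L_n$, a row of $x$'s in a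
determinant becomes a combination of Moore rows. -/
theorem incl_det_mul_x (j : Fin n) :
    incl p n (moore p n).det * x p n j = ∑ a, incl p n (moore p n a j) * xi p n a := by
  have h : ∀ k, ∑ a, moore p n a j * (moore p n).adjugate k a =
      if k = j then (moore p n).det else 0 := by
    intro k
    have := congrFun (congrFun (Matrix.adjugate_mul (moore p n)) k) j
    rw [Matrix.mul_apply] at this
    simpa [Matrix.one_apply, mul_comm] using this
  simp only [xi, Finset.mul_sum, ← mul_assoc, ← map_mul]
  rw [Finset.sum_comm]
  simp only [← Finset.sum_mul, ← map_sum, h, apply_ite (incl p n), map_zero, ite_mul, zero_mul,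
    Finset.sum_ite_eq', Finset.mem_univ, if_true]

theorem incl_mul_mul_incl_mul (q r : MvPolynomial (Fin n) (ZMod p)) (z w : Coh p n) :
    incl p n q * z * (incl p n r * w) = incl p n (q * r) * (z * w) := by
  rw [mul_assoc, ← mul_assoc z, ← (incl_commute r z).eq, mul_assoc, ← mul_assoc, ← map_mul]

theorem incl_mul_mul_incl_mul_mul (q r : MvPolynomial (Fin n) (ZMod p)) (a b w : Coh p n) :
    incl p n q * a * (incl p n r * b * w) = a * b * (incl p n q * (incl p n r * w)) := by
  rw [mul_assoc (incl p n r), incl_mul_mul_incl_mul, (incl_commute _ _).eq,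
    ← mul_assoc (incl p n q), ← map_mul, (incl_commute _ w).eq]
  simp only [mul_assoc]

theorem xi_mul_xi_add (s t : Fin n) : xi p n s * xi p n t + xi p n t * xi p n s = 0 := by
  simp only [xi, Finset.sum_mul, Finset.mul_sum, incl_mul_mul_incl_mul]
  rw [Finset.sum_comm, ← Finset.sum_add_distrib]
  refine Finset.sum_eq_zero fun i _ => ?_
  rw [← Finset.sum_add_distrib]
  refine Finset.sum_eq_zero fun j _ => ?_
  rw [mul_comm (Matrix.adjugate _ _ _), ← mul_add, x_mul_x, neg_add_cancel, mul_zero]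

/-- The rows of powers in $M_{n;S}$ are indexed by the complement of $S$ in increasing order;
counting shows that the enumeration by `Nat.nth` stays below $n$. -/
theorem exists_gap {S : Finset ℕ} {k : ℕ} (hS : ∀ s ∈ S, s < n) (hk : k + S.card = n) :
    ∃ g : Fin k → Fin n, Function.Injective g ∧ ∀ i, ((g i : ℕ) ∉ S ∧
      (g i : ℕ) = Nat.nth (fun t => t ∉ S) i) := by
  have hinf : (Set.ofPred fun t : ℕ => t ∉ S).Infinite := S.finite_toSet.infinite_compl
  have hcount : Nat.count (fun t => t ∉ S) n = k := by
    rw [Nat.count_eq_card_filter_range, Finset.filter_notMem_eq_sdiff,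
      Finset.card_sdiff_of_subset fun s hs => Finset.mem_range.2 (hS s hs), Finset.card_range]
    omega
  refine ⟨fun i => ⟨Nat.nth (fun t => t ∉ S) i, Nat.nth_lt_of_lt_count (hcount.symm ▸ i.2)⟩,
    fun i j h => Fin.ext ((Nat.nth_strictMono hinf).injective (Fin.mk.inj_iff.1 h)), fun i =>
    ⟨Nat.nth_mem_of_infinite hinf i, rfl⟩⟩

theorem det_submatrix_moore_of_not_injective {e : Fin n → Fin n} (he : ¬ Function.Injective e) :
    ((moore p n).submatrix e id).det = 0 := by
  simp only [Function.Injective, not_forall] at he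
  obtain ⟨a, b, hab, hne⟩ := he
  exact Matrix.det_zero_of_row_eq hne (by ext j; simp [hab])

theorem exists_det_submatrix_moore {e : Fin n → Fin n} (he : Function.Injective e) :
    ∃ ε : ℤˣ, ((moore p n).submatrix e id).det = (ε : ℤ) • (moore p n).det :=
  ⟨_, (Matrix.det_permute (Equiv.ofBijective e (Finite.injective_iff_bijective.1 he))
    (moore p n)).trans (zsmul_eq_mul _ _).symm⟩

theorem det_submatrix_moore (e : Fin n → Fin n) :
    ((moore p n).submatrix e id).det =
      ∑ σ : Equiv.Perm (Fin n), (Equiv.Perm.sign σ : ℤ) • ∏ i, moore p n (e i) (σ i) := by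
  rw [← Matrix.det_transpose, Matrix.det_apply']
  exact Finset.sum_congr rfl fun σ _ => by simp

theorem prod_ofFn_incl {k : ℕ} (f : Fin k → MvPolynomial (Fin n) (ZMod p)) :
    (List.ofFn fun i => incl p n (f i)).prod = incl p n (∏ i, f i) := by
  rw [← List.prod_ofFn, map_list_prod, List.map_ofFn]
  rfl

theorem exists_cons_eq_of_notMem_range {k : ℕ} {s a : Fin (k + 1)} {g : Fin k → Fin (k + 1)}
    (he : Function.Injective (Fin.cons s g : Fin (k + 1) → Fin (k + 1)))
    (ha : a ≠ s) : a ∈ Set.range g := by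
  obtain ⟨i, rfl⟩ := (Finite.injective_iff_surjective.1 he) a
  induction i using Fin.cases with
  | zero => simp at ha
  | succ i => exact ⟨i, by simp⟩

variable [Fact p.Prime]

theorem incl_mul_left_cancel {q : MvPolynomial (Fin n) (ZMod p)} (hq : q ≠ 0) {z w : Coh p n}
    (h : incl p n q * z = incl p n q * w) : z = w := by
  rw [← sub_eq_zero] at h ⊢
  rw [← mul_sub] at h
  exact eq_zero_of_incl_mul_eq_zero hq h

theorem two_ne_zero_of_ne_two (hp : p ≠ 2) : (2 : ZMod p) ≠ 0 := by
  intro h2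
  have h3 : ((2 : ℕ) : ZMod p) = 0 := by exact_mod_cast h2
  rw [ZMod.natCast_eq_zero_iff] at h3
  exact hp ((Nat.prime_dvd_prime_iff_eq Fact.out Nat.prime_two).1 h3)

theorem mul_zsmul_add_mul_neg_zsmul {A : Type*} [Ring A] {z z' : A} (h : z + z' = 0) (e : ℤ)
    (d : A) : z * e • d + z' * (-e) • d = e • (z * d) + e • (z * d) := by
  rw [eq_neg_of_add_eq_zero_right h, neg_smul, neg_mul_neg, mul_smul_comm]

theorem incl_mul_incl_mul (q : MvPolynomial (Fin n) (ZMod p)) (a b w : Coh p n) :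
    incl p n q * (incl p n q * (a * (b * w))) = incl p n q * a * (incl p n q * b * w) := by
  rw [mul_assoc (incl p n q) b w, incl_mul_mul_incl_mul, map_mul, mul_assoc]

theorem xi_mul_self (hp : p ≠ 2) (s : Fin n) : xi p n s * xi p n s = 0 :=
  (smul_eq_zero.1 ((two_smul (ZMod p) _).trans (xi_mul_xi_add s s))).resolve_left
    (two_ne_zero_of_ne_two hp)

/-- After replacing the row of $x$'s by $\sum_a\xi_a\cdot(\text{Moore row }a)$, every determinant
with $a\ne s$ has a repeated row, and the one with $a=s$ is $\pm L_n$. -/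
theorem exists_M_singleton_eq (s : Fin n) :
    ∃ ε : ℤˣ, M p n {(s : ℕ)} = (ε : ℤ) • xi p n s := by
  obtain ⟨k, rfl⟩ : ∃ k, n = k + 1 := Nat.exists_eq_succ_of_ne_zero (by
    rintro rfl
    exact s.elim0)
  obtain ⟨g, hg, hgS⟩ := exists_gap (n := k + 1) (S := {(s : ℕ)}) (k := k)
    (by simp [s.is_le]) (by simp)
  have he : Function.Injective (Fin.cons s g : Fin (k + 1) → Fin (k + 1)) := by
    refine Fin.cons_injective_iff.2 ⟨?_, hg⟩
    rintro ⟨i, rfl⟩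
    simpa using (hgS i).1
  obtain ⟨ε, hε⟩ := exists_det_submatrix_moore (p := p) he
  refine ⟨ε, ?_⟩
  have hM : M p (k + 1) {(s : ℕ)} = ∑ σ : Equiv.Perm (Fin (k + 1)),
      (Equiv.Perm.sign σ : ℤ) • (x p (k + 1) (σ 0) *
        incl p (k + 1) (∏ i, moore p (k + 1) (g i) (σ i.succ))) := by
    rw [M, rowDet]
    simp only [Finset.card_singleton, Nat.factorial_one, Nat.cast_one, inv_one, one_smul]
    refine Finset.sum_congr rfl fun σ _ => ?_
    rw [List.ofFn_succ, List.prod_cons, ← prod_ofFn_incl]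
    simp [moore_apply, y, (hgS _).2]
  have key : incl p (k + 1) (moore p (k + 1)).det * M p (k + 1) {(s : ℕ)} =
      incl p (k + 1) (moore p (k + 1)).det * ((ε : ℤ) • xi p (k + 1) s) := by
    have h1 : incl p (k + 1) (moore p (k + 1)).det * M p (k + 1) {(s : ℕ)} =
        ∑ a, xi p (k + 1) a * incl p (k + 1) ((moore p (k + 1)).submatrix
          (Fin.cons a g : Fin (k + 1) → Fin (k + 1)) id).det := by
      simp only [det_submatrix_moore, Fin.prod_univ_succ, Fin.cons_zero, Fin.cons_succ, map_sum,
        map_zsmul, map_mul, Finset.mul_sum]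
      rw [hM, Finset.mul_sum, Finset.sum_comm]
      refine Finset.sum_congr rfl fun σ _ => ?_
      rw [mul_smul_comm, ← mul_assoc, incl_det_mul_x, Finset.sum_mul, Finset.smul_sum]
      refine Finset.sum_congr rfl fun a _ => ?_
      rw [mul_smul_comm, (incl_commute _ _).eq, mul_assoc]
    rw [h1, Finset.sum_eq_single s]
    · rw [hε, map_zsmul, mul_smul_comm, mul_smul_comm, (incl_commute _ _).eq]
    · intro a _ ha
      rw [det_submatrix_moore_of_not_injective, map_zero, mul_zero]
      exact fun h => (Fin.cons_injective_iff.1 h).1 (exists_cons_eq_of_notMem_range he ha)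
    · simp
  exact incl_mul_left_cancel det_moore_ne_zero key

theorem exists_incl_det_mul_M_pair_eq (hp : p ≠ 2) {s t : Fin n} (hst : s ≠ t) :
    ∃ ε : ℤˣ, incl p n (moore p n).det * M p n {(s : ℕ), (t : ℕ)} =
      (ε : ℤ) • (xi p n s * xi p n t) := by
  obtain ⟨k, rfl⟩ : ∃ k, n = k + 2 := by
    refine ⟨n - 2, ?_⟩
    have h1 := s.2
    have h2 := t.2
    have h3 : (s : ℕ) ≠ t := fun h => hst (Fin.ext h)
    omega
  have hcard : ({(s : ℕ), (t : ℕ)} : Finset ℕ).card = 2 :=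
    Finset.card_pair fun h => hst (Fin.ext h)
  obtain ⟨g, hg, hgS⟩ := exists_gap (n := k + 2) (S := {(s : ℕ), (t : ℕ)}) (k := k)
    (by simp) (by rw [hcard])
  have hcons : ∀ a b : Fin (k + 2), Function.Injective
      (Fin.cons a (Fin.cons b g : Fin (k + 1) → Fin (k + 2)) : Fin (k + 2) → Fin (k + 2)) ↔
        a ≠ b ∧ a ∉ Set.range g ∧ b ∉ Set.range g := by
    intro a b
    rw [Fin.cons_injective_iff, Fin.cons_injective_iff, Fin.range_cons, Set.mem_insert_iff, not_or]
    tauto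
  have hs : s ∉ Set.range g := by
    rintro ⟨i, rfl⟩
    simpa using (hgS i).1
  have ht : t ∉ Set.range g := by
    rintro ⟨i, rfl⟩
    simpa using (hgS i).1
  have he := (hcons s t).2 ⟨hst, hs, ht⟩
  have hmem : ∀ a, a ≠ s → a ≠ t → a ∈ Set.range g := by
    intro a has hat
    obtain ⟨i, hi⟩ := exists_cons_eq_of_notMem_range he has
    induction i using Fin.cases with
    | zero => exact absurd hi.symm hat
    | succ i => exact ⟨i, hi⟩
  obtain ⟨ε, hε⟩ := exists_det_submatrix_moore (p := p) he
  -- Exchanging the two leading rows changes the sign. As $\xi_s$ and $\xi_t$ anticommute, the terms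
  -- $(s,t)$ and $(t,s)$ agree, and the resulting factor $2$ cancels $1/2!$.
  have hε' : ((moore p (k + 2)).submatrix
      (Fin.cons t (Fin.cons s g : Fin (k + 1) → Fin (k + 2)) : Fin (k + 2) → Fin (k + 2)) id).det =
        -((ε : ℤ) • (moore p (k + 2)).det) := by
    have h := Matrix.det_permute (Equiv.swap 0 1) ((moore p (k + 2)).submatrix
      (Fin.cons s (Fin.cons t g : Fin (k + 1) → Fin (k + 2)) : Fin (k + 2) → Fin (k + 2)) id)
    rw [hε, Equiv.Perm.sign_swap (by simp), Matrix.submatrix_submatrix] at h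
    have h2 : (Fin.cons s (Fin.cons t g : Fin (k + 1) → Fin (k + 2)) : Fin (k + 2) → Fin (k + 2)) ∘
        Equiv.swap 0 1 =
        (Fin.cons t (Fin.cons s g : Fin (k + 1) → Fin (k + 2)) : Fin (k + 2) → Fin (k + 2)) := by
      funext i
      induction i using Fin.cases with
      | zero => rw [Function.comp_apply, Equiv.swap_apply_left]; rfl
      | succ i =>
        induction i using Fin.cases with
        | zero =>
          rw [Function.comp_apply, show (Fin.succ 0 : Fin (k + 2)) = 1 from rfl,
            Equiv.swap_apply_right]
          rfl
        | succ i =>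
          have hne : i.succ.succ ≠ (1 : Fin (k + 2)) := fun h =>
            Fin.succ_ne_zero i (Fin.succ_injective _ h)
          rw [Function.comp_apply, Equiv.swap_apply_of_ne_of_ne (Fin.succ_ne_zero _) hne]
          rfl
    rw [h2] at h
    simpa using h
  refine ⟨ε, ?_⟩
  have h2 : (2 : ZMod p) ≠ 0 := two_ne_zero_of_ne_two hp
  have hM : (2 : ZMod p) • M p (k + 2) {(s : ℕ), (t : ℕ)} = ∑ σ : Equiv.Perm (Fin (k + 2)),
      (Equiv.Perm.sign σ : ℤ) • (x p (k + 2) (σ 0) * (x p (k + 2) (σ 1) *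
        incl p (k + 2) (∏ i, moore p (k + 2) (g i) (σ i.succ.succ)))) := by
    rw [M, rowDet, hcard, Nat.factorial_two, Nat.cast_two, smul_smul, mul_inv_cancel₀ h2, one_smul]
    refine Finset.sum_congr rfl fun σ _ => ?_
    rw [List.ofFn_succ, List.prod_cons, List.ofFn_succ, List.prod_cons, ← prod_ofFn_incl]
    simp [moore_apply, y, (hgS _).2]
  set D := incl p (k + 2) (moore p (k + 2)).det with hD
  -- One factor $L_n$ is spent on each of the two rows of $x$'s; the surviving determinant gives one
  -- back, so a single factor remains after cancellation.
  have key : D * (D * ((2 : ZMod p) • M p (k + 2) {(s : ℕ), (t : ℕ)})) =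
      D * ((2 : ZMod p) • ((ε : ℤ) • (xi p (k + 2) s * xi p (k + 2) t))) := by
    have h1 : D * (D * ((2 : ZMod p) • M p (k + 2) {(s : ℕ), (t : ℕ)})) =
        ∑ a, ∑ b, xi p (k + 2) a * xi p (k + 2) b * incl p (k + 2) ((moore p (k + 2)).submatrix
          (Fin.cons a (Fin.cons b g : Fin (k + 1) → Fin (k + 2)) :
            Fin (k + 2) → Fin (k + 2)) id).det := by
      simp only [det_submatrix_moore, Fin.prod_univ_succ (n := k + 1), Fin.prod_univ_succ (n := k),
        Fin.cons_zero, Fin.cons_succ, map_sum, map_zsmul, map_mul, Finset.mul_sum]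
      rw [hM, Finset.mul_sum, Finset.mul_sum]
      have hσ : ∀ σ : Equiv.Perm (Fin (k + 2)),
          D * (D * ((Equiv.Perm.sign σ : ℤ) • (x p (k + 2) (σ 0) * (x p (k + 2) (σ 1) *
            incl p (k + 2) (∏ i, moore p (k + 2) (g i) (σ i.succ.succ)))))) =
          ∑ a, ∑ b, xi p (k + 2) a * xi p (k + 2) b * ((Equiv.Perm.sign σ : ℤ) •
            (incl p (k + 2) (moore p (k + 2) a (σ 0)) * (incl p (k + 2) (moore p (k + 2) b
              (σ (Fin.succ 0))) * incl p (k + 2) (∏ i, moore p (k + 2) (g i) (σ i.succ.succ))))) := by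
        intro σ
        rw [mul_smul_comm, mul_smul_comm, incl_mul_incl_mul, incl_det_mul_x, incl_det_mul_x,
          Finset.sum_mul, Finset.sum_mul, Finset.smul_sum]
        refine Finset.sum_congr rfl fun a _ => ?_
        rw [Finset.mul_sum, Finset.smul_sum]
        refine Finset.sum_congr rfl fun b _ => ?_
        rw [mul_smul_comm]
        congr 1
        exact incl_mul_mul_incl_mul_mul _ _ _ _ _
      rw [Finset.sum_congr rfl fun σ _ => hσ σ, Finset.sum_comm]
      refine Finset.sum_congr rfl fun a _ => ?_
      rw [Finset.sum_comm]
    have hz : ∀ a b, (a ≠ s ∨ b ≠ t) → (a ≠ t ∨ b ≠ s) → ((moore p (k + 2)).submatrix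
          (Fin.cons a (Fin.cons b g : Fin (k + 1) → Fin (k + 2)) :
            Fin (k + 2) → Fin (k + 2)) id).det = 0 := by
      intro a b h1 h2
      refine det_submatrix_moore_of_not_injective fun h => ?_
      obtain ⟨hab, ha, hb⟩ := (hcons a b).1 h
      rcases eq_or_ne a s with rfl | has
      · exact hb (hmem b hab.symm (h1.resolve_left (not_not_intro rfl)))
      rcases eq_or_ne a t with rfl | hat
      · exact hb (hmem b (h2.resolve_left (not_not_intro rfl)) hab.symm)
      exact ha (hmem a has hat)
    rw [h1, ← Finset.sum_product', Finset.sum_eq_add (s, t) (t, s)]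
    · simp only [hε, hε']
      rw [← neg_smul, map_zsmul, map_zsmul]
      refine (mul_zsmul_add_mul_neg_zsmul (A := Coh p (k + 2)) (xi_mul_xi_add s t) _ _).trans ?_
      rw [two_smul, mul_add, mul_smul_comm, (incl_commute _ _).eq]
    · intro h
      exact hst (Prod.ext_iff.1 h).1
    · rintro ⟨a, b⟩ _ ⟨h1, h2⟩
      simp only [ne_eq, Prod.mk.injEq, not_and_or] at h1 h2
      rw [hz a b h1 h2, map_zero, mul_zero]
    · simp
    · simp
  have key2 := incl_mul_left_cancel det_moore_ne_zero key
  rw [mul_smul_comm] at key2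
  exact smul_right_injective _ h2 key2

end Mui

/-! ### Generators of $SD_n$ and $I_n$ up to sign -/

section Generators

variable (p n : ℕ)

/-- Up to sign, the generator `M_{n;s} L_n^{p-2}`. -/
def gen₁ (s : Fin n) : Coh p n := xi p n s * incl p n ((moore p n).det ^ (p - 2))

/-- Up to sign, the generator `M_{n;s,t} L_n^{p-2}`. -/
def gen₂ (s t : Fin n) : Coh p n := xi p n s * xi p n t * incl p n ((moore p n).det ^ (p - 3))

variable {p n} in
theorem gen₂_add_gen₂ (s t : Fin n) : gen₂ p n s t + gen₂ p n t s = 0 := by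
  rw [gen₂, gen₂, ← add_mul, xi_mul_xi_add, zero_mul]

variable {p n} in
theorem neg_mul_coh (z w : Coh p n) : -z * w = -(z * w) := neg_mul z w

variable {p n} in
theorem mul_neg_coh (z w : Coh p n) : z * -w = -(z * w) := mul_neg z w

variable [Fact p.Prime]

/-- The span of the generators of the ideal `I_n`. -/
def idealGens : Submodule (ZMod p) (Coh p n) :=
  Submodule.span (ZMod p)
    ({dickson p n n} ∪ {z | ∃ i < n, z = M p n {i} * L p n ^ (p - 2)} ∪
      {z | ∃ i, 0 < i ∧ i < n ∧ z = M p n {0, i} * L p n ^ (p - 2)})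

variable {p n}

theorem idealI_eq : idealI p n =
    Subalgebra.toSubmodule (SD p n) * idealGens p n * Subalgebra.toSubmodule (SD p n) := rfl

theorem zsmul_units_mem_iff {N : Submodule (ZMod p) (Coh p n)} (ε : ℤˣ) {z : Coh p n} :
    (ε : ℤ) • z ∈ N ↔ z ∈ N := by
  rcases Int.units_eq_one_or ε with rfl | rfl <;> simp

theorem exists_dickson_eq (s : Fin n) {i : ℕ} (hi : i + s = n) :
    ∃ ε : ℤˣ, dickson p n i = (ε : ℤ) • incl p n (dicksonCoeff p n s) := by
  refine ⟨(-1) ^ (i + 1), ?_⟩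
  rw [← map_zsmul, dickson, dicksonCoeff, show n - i = s by omega, zsmul_eq_mul]
  congr 1
  push_cast
  ring

theorem exists_M_singleton_mul_eq (s : Fin n) :
    ∃ ε : ℤˣ, M p n {(s : ℕ)} * L p n ^ (p - 2) = (ε : ℤ) • gen₁ p n s := by
  obtain ⟨ε, hε⟩ := exists_M_singleton_eq (p := p) s
  exact ⟨ε, by rw [hε, L_eq, ← map_pow, smul_mul_assoc, gen₁]⟩

/-- Since $p\ge 3$, one factor of $L_n^{p-2}$ can be split off to turn $M_{n;s,t}$ into
$\pm\xi_s\xi_t$. -/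
theorem exists_M_pair_mul_eq (hp : p ≠ 2) {s t : Fin n} (hst : s ≠ t) :
    ∃ ε : ℤˣ, M p n {(s : ℕ), (t : ℕ)} * L p n ^ (p - 2) = (ε : ℤ) • gen₂ p n s t := by
  obtain ⟨ε, hε⟩ := exists_incl_det_mul_M_pair_eq hp hst
  have h2 := (Fact.out : p.Prime).two_le
  refine ⟨ε, ?_⟩
  rw [show p - 2 = (p - 3) + 1 by omega, pow_succ', ← mul_assoc, L_eq, ← (incl_commute _ _).eq, hε,
    ← map_pow, smul_mul_assoc, gen₂]

theorem gen₂_self (hp : p ≠ 2) (s : Fin n) : gen₂ p n s s = 0 := by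
  rw [gen₂, xi_mul_self hp, zero_mul]

theorem gen₂_mem_symm {N : Submodule (ZMod p) (Coh p n)} {s t : Fin n} (h : gen₂ p n s t ∈ N) :
    gen₂ p n t s ∈ N := by
  rw [eq_neg_of_add_eq_zero_right (gen₂_add_gen₂ s t)]
  exact N.neg_mem h

theorem incl_dicksonCoeff_mem (s : Fin n) : incl p n (dicksonCoeff p n s) ∈ SD p n := by
  obtain ⟨ε, hε⟩ := exists_dickson_eq (p := p) (n := n) s (i := n - 1 - s + 1) (by omega)
  refine (zsmul_units_mem_iff (N := Subalgebra.toSubmodule (SD p n)) ε).1 ?_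
  rw [← hε]
  exact Algebra.subset_adjoin (Or.inl (Or.inl ⟨n - 1 - s, by omega, rfl⟩))

theorem gen₁_mem (s : Fin n) : gen₁ p n s ∈ SD p n := by
  obtain ⟨ε, hε⟩ := exists_M_singleton_mul_eq (p := p) (n := n) s
  refine (zsmul_units_mem_iff (N := Subalgebra.toSubmodule (SD p n)) ε).1 ?_
  rw [← hε]
  exact Algebra.subset_adjoin (Or.inl (Or.inr ⟨s, s.2, rfl⟩))

theorem gen₂_mem (hp : p ≠ 2) (s t : Fin n) : gen₂ p n s t ∈ SD p n := by
  have h : ∀ s t : Fin n, s < t → gen₂ p n s t ∈ SD p n := by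
    intro s t hst
    obtain ⟨ε, hε⟩ := exists_M_pair_mul_eq hp hst.ne
    refine (zsmul_units_mem_iff (N := Subalgebra.toSubmodule (SD p n)) ε).1 ?_
    rw [← hε]
    exact Algebra.subset_adjoin (Or.inr ⟨s, t, hst, t.2, rfl⟩)
  rcases lt_trichotomy s t with hst | rfl | hst
  · exact h s t hst
  · rw [gen₂_self hp]
    exact zero_mem _
  · exact gen₂_mem_symm (N := Subalgebra.toSubmodule (SD p n)) (h t s hst)

/-- Signs do not affect generation, so this serves as the induction principle for $SD_n$ on the
normalised generators. -/
theorem SD_le (hp : p ≠ 2) {S : Subalgebra (ZMod p) (Coh p n)}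
    (h0 : ∀ s, incl p n (dicksonCoeff p n s) ∈ S) (h1 : ∀ s, gen₁ p n s ∈ S)
    (h2 : ∀ s t, gen₂ p n s t ∈ S) : SD p n ≤ S := by
  refine Algebra.adjoin_le ?_
  rintro z ((⟨s, hs, rfl⟩ | ⟨s, hs, rfl⟩) | ⟨s, t, hst, ht, rfl⟩)
  · obtain ⟨ε, hε⟩ := exists_dickson_eq (p := p) (n := n) ⟨n - 1 - s, by omega⟩ (i := s + 1)
      (by simp only; omega)
    rw [hε]
    exact zsmul_mem (h0 _) _
  · obtain ⟨ε, hε⟩ := exists_M_singleton_mul_eq (p := p) (n := n) ⟨s, hs⟩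
    exact (congrArg (· ∈ S) hε).mpr (zsmul_mem (h1 _) _)
  · obtain ⟨ε, hε⟩ := exists_M_pair_mul_eq hp (s := ⟨s, hst.trans ht⟩) (t := ⟨t, ht⟩)
      (fun h => hst.ne (Fin.mk.inj_iff.1 h))
    exact (congrArg (· ∈ S) hε).mpr (zsmul_mem (h2 _ _) _)

theorem incl_dicksonEval_mem (F : MvPolynomial (Fin n) (ZMod p)) :
    incl p n (dicksonEval p n F) ∈ SD p n := by
  induction F using MvPolynomial.induction_on with
  | C a =>
    rw [← MvPolynomial.algebraMap_eq, AlgHom.commutes, AlgHom.commutes]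
    exact Subalgebra.algebraMap_mem _ _
  | add F G hF hG =>
    rw [map_add, map_add]
    exact add_mem hF hG
  | mul_X F s hF =>
    rw [map_mul, map_mul, dicksonEval_X]
    exact mul_mem hF (incl_dicksonCoeff_mem s)

theorem exteriorAug_mem_range (hp : p ≠ 2) {z : Coh p n} (hz : z ∈ SD p n) :
    exteriorAug p n z ∈ (dicksonEval p n).range := by
  have hxi : ∀ s, exteriorAug p n (xi p n s) = 0 := fun s => by simp [xi]
  refine SD_le hp (S := (dicksonEval p n).range.comap (exteriorAug p n)) (fun s => ?_)
    (fun s => ?_) (fun s t => ?_) hz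
  · exact ⟨MvPolynomial.X s, by simp⟩
  · rw [Subalgebra.mem_comap, gen₁, map_mul, hxi, zero_mul]
    exact zero_mem _
  · rw [Subalgebra.mem_comap, gen₂, map_mul, map_mul, hxi, zero_mul, zero_mul]
    exact zero_mem _

theorem gradeInvol_xi (s : Fin n) : gradeInvol p n (xi p n s) = -xi p n s := by
  simp only [xi, map_sum, map_mul, gradeInvol_incl, gradeInvol_x, mul_neg_coh]
  exact Finset.sum_neg_distrib _

theorem gradeInvol_gen₁ (s : Fin n) : gradeInvol p n (gen₁ p n s) = -gen₁ p n s := by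
  rw [gen₁, map_mul, gradeInvol_xi, gradeInvol_incl, neg_mul_coh]

theorem gradeInvol_gen₂ (s t : Fin n) : gradeInvol p n (gen₂ p n s t) = gen₂ p n s t := by
  rw [gen₂, map_mul, map_mul, gradeInvol_xi, gradeInvol_xi, gradeInvol_incl, neg_mul_coh, mul_neg_coh,
    neg_neg]

theorem gradeInvol_mem (hp : p ≠ 2) {z : Coh p n} (hz : z ∈ SD p n) :
    gradeInvol p n z ∈ SD p n := by
  refine SD_le hp (S := (SD p n).comap (gradeInvol p n)) (fun s => ?_)
    (fun s => ?_) (fun s t => ?_) hz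
  · rw [Subalgebra.mem_comap, gradeInvol_incl]
    exact incl_dicksonCoeff_mem s
  · rw [Subalgebra.mem_comap, gradeInvol_gen₁]
    exact neg_mem (gen₁_mem s)
  · rw [Subalgebra.mem_comap, gradeInvol_gen₂]
    exact gen₂_mem hp s t

variable [NeZero n]

/-- The Bockstein turns $x_j$ into $y_j$, so the result is row $0$ of the Moore matrix times a
column of its adjugate. -/
theorem bockstein_xi (s : Fin n) :
    bockstein p n (xi p n s) = if s = 0 then incl p n (moore p n).det else 0 := by
  have h := congrFun (congrFun (Matrix.mul_adjugate (moore p n)) 0) s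
  rw [Matrix.mul_apply, Matrix.smul_apply, Matrix.one_apply] at h
  simp only [xi, map_sum, bockstein_incl_mul, bockstein_x, ← map_mul]
  rw [← map_sum]
  have e : ∑ j, (moore p n).adjugate j s * MvPolynomial.X j =
      ∑ j, moore p n 0 j * (moore p n).adjugate j s :=
    Finset.sum_congr rfl fun j _ => by simp [moore_apply, mul_comm]
  rw [e, h]
  simp [apply_ite (incl p n), eq_comm]

theorem exists_incl_dicksonCoeff_zero_eq :
    ∃ ε : ℤˣ, incl p n ((moore p n).det ^ (p - 1)) =
      (ε : ℤ) • incl p n (dicksonCoeff p n 0) := by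
  obtain ⟨ε, hε⟩ := exists_dicksonCoeff_zero_eq (p := p) (n := n)
  refine ⟨ε, ?_⟩
  rw [hε, ← zsmul_eq_mul, map_zsmul, smul_smul, ← Units.val_mul, Int.units_mul_self]
  simp

theorem bockstein_gen₁ (s : Fin n) : bockstein p n (gen₁ p n s) =
    if s = 0 then incl p n ((moore p n).det ^ (p - 1)) else 0 := by
  have hp := (Fact.out : p.Prime).two_le
  rw [gen₁, bockstein_mul, bockstein_incl, bockstein_xi]
  split_ifs
  · rw [mul_zero, add_zero, ← map_mul, ← pow_succ', show p - 2 + 1 = p - 1 by omega]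
  · rw [mul_zero, add_zero, zero_mul]

theorem bockstein_gen₂ (hp : p ≠ 2) (s t : Fin n) : bockstein p n (gen₂ p n s t) =
    (if s = 0 then gen₁ p n t else 0) - if t = 0 then gen₁ p n s else 0 := by
  have h2 := (Fact.out : p.Prime).two_le
  have h3 : ∀ r, xi p n r * incl p n ((moore p n).det) * incl p n ((moore p n).det ^ (p - 3)) =
      gen₁ p n r := fun r => by
    rw [mul_assoc, ← map_mul, ← pow_succ', show p - 3 + 1 = p - 2 by omega, gen₁]
  rw [gen₂, bockstein_mul, bockstein_mul, bockstein_incl, bockstein_xi, bockstein_xi,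
    gradeInvol_xi, mul_zero, add_zero, add_mul, sub_eq_add_neg]
  congr 1
  · split_ifs
    · rw [(incl_commute _ _).eq, h3]
    · rw [zero_mul, zero_mul]
  · split_ifs
    · rw [neg_mul_coh, neg_mul_coh, h3]
    · rw [mul_zero, zero_mul, neg_zero]

theorem incl_dicksonCoeff_zero_mem_idealGens :
    incl p n (dicksonCoeff p n 0) ∈ idealGens p n := by
  obtain ⟨ε, hε⟩ := exists_dickson_eq (p := p) (n := n) 0 (i := n) (by simp)
  rw [← zsmul_units_mem_iff ε, ← hε]
  exact Submodule.subset_span (Or.inl (Or.inl rfl))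

omit [NeZero n] in
theorem gen₁_mem_idealGens (s : Fin n) : gen₁ p n s ∈ idealGens p n := by
  obtain ⟨ε, hε⟩ := exists_M_singleton_mul_eq (p := p) (n := n) s
  rw [← zsmul_units_mem_iff ε, ← hε]
  exact Submodule.subset_span (Or.inl (Or.inr ⟨s, s.2, rfl⟩))

theorem gen₂_mem_idealGens (hp : p ≠ 2) (t : Fin n) : gen₂ p n 0 t ∈ idealGens p n := by
  rcases eq_or_ne 0 t with rfl | ht
  · rw [gen₂_self hp]
    exact zero_mem _
  · obtain ⟨ε, hε⟩ := exists_M_pair_mul_eq hp ht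
    rw [← zsmul_units_mem_iff ε, ← hε]
    exact Submodule.subset_span (Or.inr ⟨t, Nat.pos_of_ne_zero fun h => ht (Fin.ext (by simp [h])),
      t.2, by simp⟩)

theorem idealGens_le (hp : p ≠ 2) {N : Submodule (ZMod p) (Coh p n)}
    (h0 : incl p n (dicksonCoeff p n 0) ∈ N) (h1 : ∀ s, gen₁ p n s ∈ N)
    (h2 : ∀ t, gen₂ p n 0 t ∈ N) : idealGens p n ≤ N := by
  refine Submodule.span_le.2 ?_
  rintro z ((rfl | ⟨s, hs, rfl⟩) | ⟨t, ht0, ht, rfl⟩)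
  · obtain ⟨ε, hε⟩ := exists_dickson_eq (p := p) (n := n) 0 (i := n) (by simp)
    rw [hε]
    exact zsmul_mem h0 _
  · obtain ⟨ε, hε⟩ := exists_M_singleton_mul_eq (p := p) (n := n) ⟨s, hs⟩
    exact (congrArg (· ∈ N) hε).mpr (zsmul_mem (h1 _) _)
  · obtain ⟨ε, hε⟩ := exists_M_pair_mul_eq hp (s := (0 : Fin n)) (t := ⟨t, ht⟩)
      (fun h => ht0.ne (by simpa using congrArg Fin.val h))
    refine (congrArg (· ∈ N) ?_).mp (zsmul_mem (h2 ⟨t, ht⟩) ε)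
    rw [← hε]
    simp

theorem idealGens_le_SD (hp : p ≠ 2) : idealGens p n ≤ Subalgebra.toSubmodule (SD p n) :=
  idealGens_le hp (incl_dicksonCoeff_mem 0) gen₁_mem fun t => gen₂_mem hp 0 t

end Generators

/-! ### Closure of $SD_n$ and $I_n$ under the Steenrod operations -/

section Closure

variable (p n : ℕ)

/-- The inclusion of the polynomial subalgebra on the coefficients of polynomials. -/
def inclT : Polynomial (MvPolynomial (Fin n) (ZMod p)) →+* Polynomial (Coh p n) :=
  Polynomial.mapRingHom (incl p n).toRingHom

variable {p n}

theorem inclT_C (q : MvPolynomial (Fin n) (ZMod p)) :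
    inclT p n (Polynomial.C q) = Polynomial.C (incl p n q) := by
  simp [inclT]

theorem coeff_inclT (F : Polynomial (MvPolynomial (Fin n) (ZMod p))) (k : ℕ) :
    (inclT p n F).coeff k = incl p n (F.coeff k) := by
  simp [inclT]

theorem inclT_commute (F : Polynomial (MvPolynomial (Fin n) (ZMod p))) (z : Coh p n) :
    Commute (inclT p n F) (Polynomial.C z) := by
  ext k
  rw [Polynomial.coeff_mul_C, Polynomial.coeff_C_mul, coeff_inclT, (incl_commute _ _).eq]

theorem cohPower_incl_eq (q : MvPolynomial (Fin n) (ZMod p)) :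
    cohPower p n (incl p n q) = inclT p n (totalPower p n q) := cohPower_incl q

theorem coeff_mul_mem_mul {N N' : Submodule (ZMod p) (Coh p n)} {F G : Polynomial (Coh p n)}
    (hF : ∀ k, F.coeff k ∈ N) (hG : ∀ k, G.coeff k ∈ N') (k : ℕ) :
    (F * G).coeff k ∈ N * N' := by
  rw [Polynomial.coeff_mul]
  exact sum_mem fun _ _ => Submodule.mul_mem_mul (hF _) (hG _)

/-- The Cartan formula is the multiplicativity of `cohPower`, and $SGS$ absorbs $S$ on both sides,
so it suffices to control the powers on $G$. -/
theorem sandwich_power_mem {S : Subalgebra (ZMod p) (Coh p n)} {G : Submodule (ZMod p) (Coh p n)}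
    (hS : ∀ z ∈ S, ∀ k, power p n k z ∈ S)
    (hG : ∀ z ∈ G, ∀ k, power p n k z ∈
      Subalgebra.toSubmodule S * G * Subalgebra.toSubmodule S) (k : ℕ) :
    ∀ z ∈ Subalgebra.toSubmodule S * G * Subalgebra.toSubmodule S,
      power p n k z ∈ Subalgebra.toSubmodule S * G * Subalgebra.toSubmodule S := by
  set J := Subalgebra.toSubmodule S * G * Subalgebra.toSubmodule S with hJ
  have hSJ : Subalgebra.toSubmodule S * J = J := by
    rw [hJ, ← mul_assoc, ← mul_assoc, S.isIdempotentElem_toSubmodule.eq]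
  have hJS : J * Subalgebra.toSubmodule S = J := by
    rw [hJ, mul_assoc, S.isIdempotentElem_toSubmodule.eq]
  have hSc : ∀ z ∈ S, ∀ k, (cohPower p n z).coeff k ∈ Subalgebra.toSubmodule S := fun z hz k =>
    (coeff_cohPower k z).symm ▸ hS z hz k
  have h1 : Subalgebra.toSubmodule S * G ≤ ⨅ k, J.comap (power p n k) := by
    refine Submodule.mul_le.2 fun u hu g hg => (Submodule.mem_iInf _).2 fun k => ?_
    rw [Submodule.mem_comap, ← coeff_cohPower, map_mul, ← hSJ]
    exact coeff_mul_mem_mul (hSc u hu) (fun k => (coeff_cohPower k g).symm ▸ hG g hg k) k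
  have h2 : J ≤ ⨅ k, J.comap (power p n k) := by
    refine Submodule.mul_le.2 fun m hm v hv => (Submodule.mem_iInf _).2 fun k => ?_
    rw [Submodule.mem_comap, ← coeff_cohPower, map_mul, ← hJS]
    refine coeff_mul_mem_mul (fun k => ?_) (hSc v hv) k
    rw [coeff_cohPower]
    exact (Submodule.mem_iInf _).1 (h1 hm) k
  exact fun z hz => (Submodule.mem_iInf _).1 (h2 hz) k

/-- The Bockstein is a derivation only up to the grade involution, so stability of $S$ and $G$ under
that involution enters. -/
theorem sandwich_bockstein_mem {S : Subalgebra (ZMod p) (Coh p n)}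
    {G : Submodule (ZMod p) (Coh p n)} (hS : ∀ z ∈ S, bockstein p n z ∈ S)
    (hSi : ∀ z ∈ S, gradeInvol p n z ∈ S) (hGi : ∀ z ∈ G, gradeInvol p n z ∈ G)
    (hG : ∀ z ∈ G, bockstein p n z ∈ Subalgebra.toSubmodule S * G * Subalgebra.toSubmodule S) :
    ∀ z ∈ Subalgebra.toSubmodule S * G * Subalgebra.toSubmodule S,
      bockstein p n z ∈ Subalgebra.toSubmodule S * G * Subalgebra.toSubmodule S := by
  set J := Subalgebra.toSubmodule S * G * Subalgebra.toSubmodule S with hJ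
  have hSJ : Subalgebra.toSubmodule S * J = J := by
    rw [hJ, ← mul_assoc, ← mul_assoc, S.isIdempotentElem_toSubmodule.eq]
  have hJS : J * Subalgebra.toSubmodule S = J := by
    rw [hJ, mul_assoc, S.isIdempotentElem_toSubmodule.eq]
  have hle : Subalgebra.toSubmodule S * G ≤ J := fun z hz => by
    simpa using Submodule.mul_mem_mul hz (N := Subalgebra.toSubmodule S) S.one_mem
  have h1 : Subalgebra.toSubmodule S * G ≤ J.comap (bockstein p n) := by
    refine Submodule.mul_le.2 fun u hu g hg => ?_
    rw [Submodule.mem_comap, bockstein_mul]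
    refine add_mem (hle (Submodule.mul_mem_mul (hS u hu) hg)) ?_
    rw [← hSJ]
    exact Submodule.mul_mem_mul (hSi u hu) (hG g hg)
  have h2 : Subalgebra.toSubmodule S * G ≤
      (Subalgebra.toSubmodule S * G).comap (gradeInvol p n).toLinearMap := by
    refine Submodule.mul_le.2 fun u hu g hg => ?_
    rw [Submodule.mem_comap, AlgHom.toLinearMap_apply, map_mul]
    exact Submodule.mul_mem_mul (hSi u hu) (hGi g hg)
  have h3 : J ≤ J.comap (bockstein p n) := by
    refine Submodule.mul_le.2 fun m hm v hv => ?_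
    rw [Submodule.mem_comap, bockstein_mul]
    refine add_mem ?_ (Submodule.mul_mem_mul (h2 hm) (hS v hv))
    rw [← hJS]
    exact Submodule.mul_mem_mul (h1 hm) hv
  exact fun z hz => h3 hz

/-- The polynomials all of whose coefficients lie in `S`. -/
def coeffSubalgebra (S : Subalgebra (ZMod p) (Coh p n)) :
    Subalgebra (ZMod p) (Polynomial (Coh p n)) where
  carrier := {F | ∀ k, F.coeff k ∈ S}
  mul_mem' hF hG k := by
    rw [Polynomial.coeff_mul]
    exact sum_mem fun _ _ => mul_mem (hF _) (hG _)
  add_mem' hF hG k := by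
    rw [Polynomial.coeff_add]
    exact add_mem (hF k) (hG k)
  algebraMap_mem' r k := by
    rw [Polynomial.algebraMap_apply, Polynomial.coeff_C]
    split_ifs
    · exact Subalgebra.algebraMap_mem _ _
    · exact zero_mem _

variable [Fact p.Prime]

theorem cohPower_xi (s : Fin n) : cohPower p n (xi p n s) =
    ∑ t, inclT p n (dicksonEvalT p n ((powerMatrix p n).adjugate t s)) *
      Polynomial.C (xi p n t) := by
  simp only [xi, map_sum, map_mul, cohPower_incl_eq, cohPower_x, totalPower_adjugate_moore,
    inclT_C, Finset.mul_sum, Finset.sum_mul]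
  rw [Finset.sum_comm]
  refine Finset.sum_congr rfl fun t _ => Finset.sum_congr rfl fun j _ => ?_
  rw [← (inclT_commute _ _).eq, mul_assoc]

theorem cohPower_det_pow (m : ℕ) : cohPower p n (incl p n ((moore p n).det ^ m)) =
    inclT p n (dicksonEvalT p n ((powerMatrix p n).det ^ m)) *
      Polynomial.C (incl p n ((moore p n).det ^ m)) := by
  rw [cohPower_incl_eq, map_pow, totalPower_det_moore, mul_pow, map_mul, ← map_pow, ← map_pow,
    inclT_C]

/-- The $\xi_s$ transform by the adjugate of `powerMatrix` and $L_n$ by its determinant; the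
coefficients commute with everything in $H$. -/
theorem cohPower_gen₁ (s : Fin n) : cohPower p n (gen₁ p n s) =
    ∑ t, inclT p n (dicksonEvalT p n ((powerMatrix p n).adjugate t s *
      (powerMatrix p n).det ^ (p - 2))) * Polynomial.C (gen₁ p n t) := by
  rw [gen₁, map_mul, cohPower_xi, cohPower_det_pow, Finset.sum_mul]
  refine Finset.sum_congr rfl fun t _ => ?_
  rw [gen₁, map_mul, map_mul, map_mul, mul_assoc, mul_assoc,
    ← mul_assoc (Polynomial.C _), ← (inclT_commute _ _).eq, mul_assoc]

theorem cohPower_gen₂ (s t : Fin n) : cohPower p n (gen₂ p n s t) =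
    ∑ a, ∑ b, inclT p n (dicksonEvalT p n ((powerMatrix p n).adjugate a s *
      ((powerMatrix p n).adjugate b t * (powerMatrix p n).det ^ (p - 3)))) *
        Polynomial.C (gen₂ p n a b) := by
  rw [gen₂, map_mul, map_mul, cohPower_xi, cohPower_xi, cohPower_det_pow, mul_assoc,
    Finset.sum_mul]
  refine Finset.sum_congr rfl fun a _ => ?_
  rw [Finset.sum_mul, Finset.mul_sum]
  refine Finset.sum_congr rfl fun b _ => ?_
  simp only [gen₂, map_mul, mul_assoc]
  congr 1
  rw [← mul_assoc, ← (inclT_commute _ _).eq, mul_assoc]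
  congr 1
  rw [← mul_assoc (Polynomial.C _) (inclT p n _), ← (inclT_commute _ _).eq, mul_assoc,
    ← mul_assoc (Polynomial.C _) (inclT p n _), ← (inclT_commute _ _).eq, mul_assoc]

theorem coeff_inclT_mul_C (G : Polynomial (MvPolynomial (Fin n) (ZMod p))) (z : Coh p n) (k : ℕ) :
    (inclT p n (dicksonEvalT p n G) * Polynomial.C z).coeff k =
      incl p n (dicksonEval p n (G.coeff k)) * z := by
  rw [Polynomial.coeff_mul_C, coeff_inclT, coeff_dicksonEvalT]

theorem coeff_cohPower_gen₁_mem {N : Submodule (ZMod p) (Coh p n)}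
    (hN : ∀ F t, incl p n (dicksonEval p n F) * gen₁ p n t ∈ N) (s : Fin n) (k : ℕ) :
    power p n k (gen₁ p n s) ∈ N := by
  rw [← coeff_cohPower, cohPower_gen₁, Polynomial.finsetSum_coeff]
  exact sum_mem fun t _ => by
    rw [coeff_inclT_mul_C]
    exact hN _ t

theorem power_SD_mem (hp : p ≠ 2) {z : Coh p n} (hz : z ∈ SD p n) (k : ℕ) :
    power p n k z ∈ SD p n := by
  rw [← coeff_cohPower]
  refine SD_le hp (S := (coeffSubalgebra (SD p n)).comap (cohPower p n)) (fun s k => ?_)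
    (fun s k => ?_) (fun s t k => ?_) hz k
  · change (cohPower p n _).coeff k ∈ _
    rw [coeff_cohPower, power_incl]
    obtain ⟨F, hF⟩ := polyPower_mem_range k (q := dicksonCoeff p n s) ⟨MvPolynomial.X s, by simp⟩
    rw [← hF]
    exact incl_dicksonEval_mem F
  · change (cohPower p n _).coeff k ∈ _
    rw [coeff_cohPower]
    exact coeff_cohPower_gen₁_mem (N := Subalgebra.toSubmodule (SD p n))
      (fun F t => (SD p n).mul_mem (incl_dicksonEval_mem F) (gen₁_mem t)) s k
  · change (cohPower p n _).coeff k ∈ _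
    rw [cohPower_gen₂]
    simp only [Polynomial.finsetSum_coeff, coeff_inclT_mul_C]
    exact sum_mem fun a _ => sum_mem fun b _ => mul_mem (incl_dicksonEval_mem _) (gen₂_mem hp a b)

variable [NeZero n]

theorem bockstein_gen₂_mem {N : Submodule (ZMod p) (Coh p n)} (hp : p ≠ 2)
    (hN : ∀ s, gen₁ p n s ∈ N) (s t : Fin n) : bockstein p n (gen₂ p n s t) ∈ N := by
  rw [bockstein_gen₂ hp]
  refine sub_mem ?_ ?_
  · split_ifs
    exacts [hN t, zero_mem _]
  · split_ifs
    exacts [hN s, zero_mem _]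

theorem bockstein_gen₁_mem {N : Submodule (ZMod p) (Coh p n)}
    (hN : incl p n (dicksonCoeff p n 0) ∈ N) (s : Fin n) : bockstein p n (gen₁ p n s) ∈ N := by
  rw [bockstein_gen₁]
  split_ifs
  · obtain ⟨ε, hε⟩ := exists_incl_dicksonCoeff_zero_eq (p := p) (n := n)
    rw [hε]
    exact zsmul_mem hN _
  · exact zero_mem _

theorem bockstein_SD_mem (hp : p ≠ 2) {z : Coh p n} (hz : z ∈ SD p n) :
    bockstein p n z ∈ SD p n := by
  let S : Subalgebra (ZMod p) (Coh p n) :=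
    { carrier := {z | z ∈ SD p n ∧ bockstein p n z ∈ SD p n}
      mul_mem' := fun {a b} ha hb => by
        refine ⟨mul_mem ha.1 hb.1, ?_⟩
        rw [bockstein_mul]
        exact add_mem (mul_mem ha.2 hb.1) (mul_mem (gradeInvol_mem hp ha.1) hb.2)
      add_mem' := fun {a b} ha hb => by
        refine ⟨add_mem ha.1 hb.1, ?_⟩
        rw [map_add]
        exact add_mem ha.2 hb.2
      algebraMap_mem' := fun r => by
        refine ⟨Subalgebra.algebraMap_mem _ _, ?_⟩
        rw [← AlgHom.commutes (incl p n), bockstein_incl]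
        exact zero_mem _ }
  refine (SD_le hp (S := S) (fun s => ⟨incl_dicksonCoeff_mem s, ?_⟩) (fun s => ⟨gen₁_mem s, ?_⟩)
    (fun s t => ⟨gen₂_mem hp s t, ?_⟩) hz).2
  · rw [bockstein_incl]
    exact zero_mem _
  · exact bockstein_gen₁_mem (N := Subalgebra.toSubmodule (SD p n)) (incl_dicksonCoeff_mem 0) s
  · exact bockstein_gen₂_mem (N := Subalgebra.toSubmodule (SD p n)) hp gen₁_mem s t

theorem SD_isSteenrodClosed (hp : p ≠ 2) :
    IsSteenrodClosed (Subalgebra.toSubmodule (SD p n)) :=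
  ⟨fun _ hz => bockstein_SD_mem hp hz, fun k _ hz => power_SD_mem hp hz k⟩

omit [NeZero n] in
theorem mul_mem_idealI {u g v : Coh p n} (hu : u ∈ SD p n) (hg : g ∈ idealGens p n)
    (hv : v ∈ SD p n) : u * g * v ∈ idealI p n :=
  Submodule.mul_mem_mul (Submodule.mul_mem_mul hu hg) hv

omit [NeZero n] in
theorem idealGens_le_idealI : idealGens p n ≤ idealI p n := fun g hg => by
  simpa using mul_mem_idealI (one_mem _) hg (one_mem _)

theorem gradeInvol_idealGens_mem (hp : p ≠ 2) {z : Coh p n} (hz : z ∈ idealGens p n) :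
    gradeInvol p n z ∈ idealGens p n := by
  refine idealGens_le hp (N := (idealGens p n).comap (gradeInvol p n).toLinearMap) ?_
    (fun s => ?_) (fun t => ?_) hz
  · rw [Submodule.mem_comap, AlgHom.toLinearMap_apply, gradeInvol_incl]
    exact incl_dicksonCoeff_zero_mem_idealGens
  · rw [Submodule.mem_comap, AlgHom.toLinearMap_apply, gradeInvol_gen₁]
    exact neg_mem (gen₁_mem_idealGens s)
  · rw [Submodule.mem_comap, AlgHom.toLinearMap_apply, gradeInvol_gen₂]
    exact gen₂_mem_idealGens hp t

theorem bockstein_idealGens_mem (hp : p ≠ 2) {z : Coh p n} (hz : z ∈ idealGens p n) :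
    bockstein p n z ∈ idealI p n := by
  refine idealGens_le_idealI (idealGens_le hp (N := (idealGens p n).comap (bockstein p n)) ?_
    (fun s => ?_) (fun t => ?_) hz)
  · rw [Submodule.mem_comap, bockstein_incl]
    exact zero_mem _
  · exact bockstein_gen₁_mem incl_dicksonCoeff_zero_mem_idealGens s
  · exact bockstein_gen₂_mem hp gen₁_mem_idealGens 0 t

theorem power_idealGens_mem (hp : p ≠ 2) {z : Coh p n} (hz : z ∈ idealGens p n) (k : ℕ) :
    power p n k z ∈ idealI p n := by
  have hmul : ∀ F, ∀ g ∈ idealGens p n, incl p n (dicksonEval p n F) * g ∈ idealI p n :=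
    fun F g hg => by simpa using mul_mem_idealI (incl_dicksonEval_mem F) hg (one_mem _)
  refine idealGens_le hp (N := (idealI p n).comap (power p n k)) ?_ (fun s => ?_) (fun t => ?_) hz
  · obtain ⟨ε, hε⟩ := exists_incl_dicksonCoeff_zero_eq (p := p) (n := n)
    -- Since $D=\pm L_n^{p-1}$, every reduced power of $D$ is a multiple of $D$ over the Dickson
    -- algebra.
    rw [← zsmul_units_mem_iff ε, ← hε, Submodule.mem_comap, ← coeff_cohPower, cohPower_det_pow,
      coeff_inclT_mul_C]
    refine hmul _ _ ?_
    rw [hε]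
    exact zsmul_mem incl_dicksonCoeff_zero_mem_idealGens _
  · exact coeff_cohPower_gen₁_mem (fun F t => hmul F _ (gen₁_mem_idealGens t)) s k
  · rw [Submodule.mem_comap, ← coeff_cohPower, cohPower_gen₂]
    simp only [Polynomial.finsetSum_coeff, coeff_inclT_mul_C]
    refine sum_mem fun a _ => sum_mem fun b _ => ?_
    rcases eq_or_ne a 0 with rfl | ha
    · exact hmul _ _ (gen₂_mem_idealGens hp b)
    -- The element $\xi_a\xi_bL_n^{p-3}$ with $a\neq 0$ need not lie in $I_n$, but its coefficient
    -- is divisible by $c_0$, itself a generator of $I_n$ up to sign.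
    · obtain ⟨w, hw⟩ := C_X_dvd_adjugate_powerMatrix (p := p) ha
      rw [hw, mul_assoc, Polynomial.coeff_C_mul, map_mul, dicksonEval_X, map_mul, mul_assoc]
      simpa using mul_mem_idealI (one_mem _) incl_dicksonCoeff_zero_mem_idealGens
        (mul_mem (incl_dicksonEval_mem _) (gen₂_mem hp a b))

theorem idealI_isSteenrodClosed (hp : p ≠ 2) : IsSteenrodClosed (idealI p n) :=
  ⟨sandwich_bockstein_mem (fun _ hz => bockstein_SD_mem hp hz) (fun _ hz => gradeInvol_mem hp hz)
    (fun _ hz => gradeInvol_idealGens_mem hp hz) fun _ hz => bockstein_idealGens_mem hp hz,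
  fun k => sandwich_power_mem (fun _ hz k => power_SD_mem hp hz k)
    (fun _ hz k => power_idealGens_mem hp hz k) k⟩

end Closure

/-! ### Grading, augmentation and finiteness of the degrees -/

section Degrees

variable {p n : ℕ}

theorem tmul_mem_degPart {i j d : ℕ} {a : ExteriorAlgebra (ZMod p) (Fin n → ZMod p)}
    {b : MvPolynomial (Fin n) (ZMod p)} (ha : a ∈ ⋀[ZMod p]^i (Fin n → ZMod p))
    (hb : b.IsHomogeneous j) (h : i + 2 * j = d) : a ⊗ₜ b ∈ degPart p n d :=
  Submodule.subset_span ⟨i, j, a, b, h, ha, hb, rfl⟩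

theorem degPart_mul_degPart_le (a b : ℕ) : degPart p n a * degPart p n b ≤ degPart p n (a + b) := by
  rw [degPart, degPart, Submodule.span_mul_span, Submodule.span_le]
  rintro _ ⟨_, ⟨i, j, u, v, h, hu, hv, rfl⟩, _, ⟨i', j', u', v', h', hu', hv', rfl⟩, rfl⟩
  refine (congrArg (· ∈ degPart p n (a + b)) (Algebra.TensorProduct.tmul_mul_tmul u u' v v')).mpr
    (tmul_mem_degPart (i := i + i') (j := j + j') ?_ (hv.mul hv') (by omega))
  rw [ExteriorAlgebra.exteriorPower, pow_add]
  exact Submodule.mul_mem_mul hu hu'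

theorem mul_mem_degPart {a b : ℕ} {z w : Coh p n} (hz : z ∈ degPart p n a)
    (hw : w ∈ degPart p n b) :
    z * w ∈ degPart p n (a + b) :=
  degPart_mul_degPart_le a b (Submodule.mul_mem_mul hz hw)

theorem incl_mem_degPart {j : ℕ} {q : MvPolynomial (Fin n) (ZMod p)} (hq : q.IsHomogeneous j) :
    incl p n q ∈ degPart p n (2 * j) :=
  tmul_mem_degPart (i := 0)
    (by rw [ExteriorAlgebra.exteriorPower, pow_zero]; exact Submodule.one_le.1 le_rfl) hq (by omega)

theorem one_mem_degPart_zero : (1 : Coh p n) ∈ degPart p n 0 := by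
  have h := incl_mem_degPart (p := p) (MvPolynomial.isHomogeneous_one (Fin n) (ZMod p))
  rwa [map_one] at h

theorem x_mem_degPart_one (i : Fin n) : x p n i ∈ degPart p n 1 :=
  tmul_mem_degPart (i := 1) (j := 0)
    (by rw [ExteriorAlgebra.exteriorPower, pow_one]; exact LinearMap.mem_range_self _ _)
    (MvPolynomial.isHomogeneous_one _ _) (by omega)

theorem exists_algebraMap_eq_of_mem_degPart_zero {z : Coh p n} (hz : z ∈ degPart p n 0) :
    ∃ c, algebraMap (ZMod p) (Coh p n) c = z := by
  suffices h : degPart p n 0 ≤ LinearMap.range (Algebra.linearMap (ZMod p) (Coh p n)) from h hz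
  refine Submodule.span_le.2 ?_
  rintro _ ⟨i, j, a, b, h, ha, hb, rfl⟩
  obtain ⟨rfl, rfl⟩ : i = 0 ∧ j = 0 := by omega
  rw [ExteriorAlgebra.exteriorPower, pow_zero] at ha
  obtain ⟨r, rfl⟩ := Submodule.mem_one.1 ha
  obtain ⟨c, rfl⟩ : ∃ c, b = MvPolynomial.C c :=
    ⟨_, MvPolynomial.totalDegree_eq_zero_iff_eq_C.1 (Nat.le_zero.1 hb.totalDegree_le)⟩
  refine ⟨r * c, ?_⟩
  rw [Algebra.linearMap_apply, Algebra.TensorProduct.algebraMap_apply, ← MvPolynomial.algebraMap_eq,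
    Algebra.algebraMap_eq_smul_one (A := MvPolynomial (Fin n) (ZMod p)) c, TensorProduct.tmul_smul,
    TensorProduct.smul_tmul', Algebra.smul_def, ← map_mul, mul_comm]

theorem algebraMapInv_eq_zero {i : ℕ} {a : ExteriorAlgebra (ZMod p) (Fin n → ZMod p)}
    (ha : a ∈ ⋀[ZMod p]^(i + 1) (Fin n → ZMod p)) : ExteriorAlgebra.algebraMapInv a = 0 := by
  rw [ExteriorAlgebra.exteriorPower, pow_succ'] at ha
  induction ha using Submodule.mul_induction_on' with
  | mem_mul_mem u hu v hv =>
    obtain ⟨m, rfl⟩ := hu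
    rw [map_mul]
    have : ExteriorAlgebra.algebraMapInv (ExteriorAlgebra.ι (ZMod p) m) = 0 := by
      simp [ExteriorAlgebra.algebraMapInv]
    rw [this, zero_mul]
  | add u hu v hv h1 h2 => rw [map_add, h1, h2, add_zero]

variable (p n) in
/-- The augmentation of `H`, killing all the `x_i` and `y_i`. -/
def augEval : Coh p n →ₐ[ZMod p] ZMod p :=
  (MvPolynomial.aeval fun _ => 0).comp (exteriorAug p n)

theorem augEval_apply (z : Coh p n) :
    augEval p n z = MvPolynomial.constantCoeff (exteriorAug p n z) := by
  simp [augEval]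

theorem augEval_eq_zero_of_mem_degPart {d : ℕ} {z : Coh p n} (hz : z ∈ degPart p n (d + 1)) :
    augEval p n z = 0 := by
  suffices h : degPart p n (d + 1) ≤ LinearMap.ker (augEval p n).toLinearMap from h hz
  refine Submodule.span_le.2 ?_
  rintro _ ⟨i, j, a, b, h, ha, hb, rfl⟩
  change augEval p n (a ⊗ₜ b) = 0
  rw [augEval_apply, exteriorAug_tmul, map_mul]
  rcases i with _ | i
  · have : MvPolynomial.constantCoeff b = 0 := by
      rw [MvPolynomial.constantCoeff_eq]
      exact hb.coeff_eq_zero (by simp; omega)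
    rw [this, mul_zero]
  · rw [algebraMapInv_eq_zero ha, map_zero, map_zero, zero_mul]

theorem augEval_bockstein (z : Coh p n) : augEval p n (bockstein p n z) = 0 := by
  induction z using TensorProduct.induction_on with
  | zero => simp
  | add z w hz hw => rw [map_add, map_add, hz, hw, add_zero]
  | tmul a b =>
    simp only [bockstein, LinearMap.sum_apply, TensorProduct.map_tmul, map_sum]
    refine Finset.sum_eq_zero fun i _ => ?_
    rw [augEval_apply, exteriorAug_tmul]
    simp

theorem constantCoeff_polyPower (k : ℕ) (b : MvPolynomial (Fin n) (ZMod p)) [Fact p.Prime] :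
    MvPolynomial.constantCoeff (polyPower p n k b) =
      if k = 0 then MvPolynomial.constantCoeff b else 0 := by
  have h : (Polynomial.mapRingHom MvPolynomial.constantCoeff).comp
      (totalPower p n).toRingHom =
      Polynomial.C.comp MvPolynomial.constantCoeff := by
    refine MvPolynomial.ringHom_ext (fun r => ?_) fun i => ?_
    · simp [totalPower]
    · simp [totalPower, (Fact.out : p.Prime).ne_zero]
  have h2 := congrArg (Polynomial.coeff · k) (RingHom.congr_fun h b)
  simpa [Polynomial.coeff_C, polyPower_apply] using h2

theorem augEval_power [Fact p.Prime] (k : ℕ) (z : Coh p n) :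
    augEval p n (power p n k z) = if k = 0 then augEval p n z else 0 := by
  induction z using TensorProduct.induction_on with
  | zero => simp
  | add z w hz hw =>
    rw [map_add, map_add, hz, hw]
    split_ifs <;> simp
  | tmul a b =>
    rw [power_tmul, augEval_apply, augEval_apply, exteriorAug_tmul, exteriorAug_tmul, map_mul,
      map_mul, constantCoeff_polyPower]
    split_ifs <;> simp

/-- Finiteness is used twice: a bijection in one degree has finite order, and an injective degree
preserving map is bijective in each degree. -/
theorem finite_degPart [NeZero p] (d : ℕ) : Finite (degPart p n d) := by
  let N : Submodule (ZMod p) (Coh p n) := ⨆ i ∈ Finset.range (d + 1), ⨆ j ∈ Finset.range (d + 1),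
    Submodule.map₂ (TensorProduct.mk (ZMod p) _ _) (⋀[ZMod p]^i (Fin n → ZMod p))
      (MvPolynomial.homogeneousSubmodule (Fin n) (ZMod p) j)
  have hN : N.FG := by
    refine Submodule.fg_biSup _ _ fun i _ => Submodule.fg_biSup _ _ fun j _ => ?_
    refine Submodule.FG.map₂ _ ?_ ?_
    · exact Module.Finite.iff_fg.1 inferInstance
    · exact MvPolynomial.homogeneousSubmodule_fg _ _ _
  have hle : degPart p n d ≤ N := by
    refine Submodule.span_le.2 ?_
    rintro _ ⟨i, j, a, b, h, ha, hb, rfl⟩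
    refine Submodule.mem_iSup_of_mem i (Submodule.mem_iSup_of_mem (Finset.mem_range.2 (by omega))
      (Submodule.mem_iSup_of_mem j (Submodule.mem_iSup_of_mem (Finset.mem_range.2 (by omega)) ?_)))
    exact Submodule.apply_mem_map₂ _ ha hb
  have : Module.Finite (ZMod p) N := Module.Finite.iff_fg.2 hN
  have : Finite N := Module.finite_of_finite (ZMod p)
  exact Finite.of_injective _ (Submodule.inclusion_injective hle)

end Degrees

/-! ### Homogeneity of the Dickson invariants and of the generators -/

section Homogeneous

theorem isHomogeneous_coeff_prod_X_sub_C {R σ ι : Type*} [CommRing R] (t : Finset ι)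
    (l : ι → MvPolynomial σ R) (hl : ∀ v, (l v).IsHomogeneous 1) {i j : ℕ} (h : i + j = t.card) :
    ((∏ v ∈ t, (Polynomial.X - Polynomial.C (l v))).coeff i).IsHomogeneous j := by
  classical
  induction t using Finset.induction_on generalizing i j with
  | empty =>
    obtain ⟨rfl, rfl⟩ : i = 0 ∧ j = 0 := by simpa using h
    simpa using MvPolynomial.isHomogeneous_one σ R
  | insert v t hv ih =>
    rw [Finset.card_insert_of_notMem hv] at h
    rw [Finset.prod_insert hv, sub_mul, Polynomial.coeff_sub, Polynomial.coeff_C_mul]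
    refine MvPolynomial.IsHomogeneous.sub ?_ ?_
    · rcases i with _ | i
      · simpa using MvPolynomial.isHomogeneous_zero σ R j
      · rw [Polynomial.coeff_X_mul]
        exact ih (by omega)
    · rcases j with _ | j
      · rw [Polynomial.coeff_eq_zero_of_natDegree_lt, mul_zero]
        · exact MvPolynomial.isHomogeneous_zero _ _ _
        · refine (Polynomial.natDegree_prod_le _ _).trans_lt ?_
          refine (Finset.sum_le_card_nsmul _ _ 1 fun v _ => ?_).trans_lt (by simp; omega)
          exact Polynomial.natDegree_X_sub_C_le _
      · rw [add_comm j]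
        exact (hl v).mul (ih (by omega))

theorem isHomogeneous_det {R σ m : Type*} [CommRing R] [Fintype m] [DecidableEq m]
    {A : Matrix m m (MvPolynomial σ R)} {d : m → ℕ} (h : ∀ i j, (A i j).IsHomogeneous (d i)) :
    A.det.IsHomogeneous (∑ i, d i) := by
  rw [Matrix.det_apply]
  refine MvPolynomial.IsHomogeneous.sum _ _ _ fun σ _ => ?_
  have : (∏ i, A (σ i) i).IsHomogeneous (∑ i, d i) := by
    rw [← Equiv.sum_comp σ d]
    exact MvPolynomial.IsHomogeneous.prod _ _ _ fun i _ => h _ _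
  rcases Int.units_eq_one_or (Equiv.Perm.sign σ) with hs | hs <;> rw [hs]
  · simpa
  · simpa using this.neg

theorem exists_isHomogeneous_adjugate {R σ m : Type*} [CommRing R] [Fintype m] [DecidableEq m]
    {A : Matrix m m (MvPolynomial σ R)} {d : m → ℕ} (h : ∀ i j, (A i j).IsHomogeneous (d i))
    (s : m) : ∃ e, ∀ j, (A.adjugate j s).IsHomogeneous e := by
  -- An adjugate entry is the determinant with row $s$ replaced by a unit vector, so that row
  -- contributes degree $0$.
  refine ⟨∑ i, Function.update d s 0 i, fun j => ?_⟩
  rw [Matrix.adjugate_apply]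
  refine isHomogeneous_det fun a b => ?_
  rcases eq_or_ne a s with rfl | ha
  · rw [Matrix.updateRow_self, Function.update_self, Pi.single_apply]
    split_ifs
    · exact MvPolynomial.isHomogeneous_one _ _
    · exact MvPolynomial.isHomogeneous_zero _ _ _
  · rw [Matrix.updateRow_ne ha, Function.update_of_ne ha]
    exact h a b

variable {p n : ℕ} [Fact p.Prime]

omit [Fact p.Prime] in
theorem isHomogeneous_moore (i j : Fin n) : (moore p n i j).IsHomogeneous (p ^ (i : ℕ)) := by
  rw [moore_apply]
  exact MvPolynomial.isHomogeneous_X_pow _ _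

theorem isHomogeneous_dicksonCoeff (s : Fin n) :
    (dicksonCoeff p n s).IsHomogeneous (p ^ n - p ^ (s : ℕ)) := by
  refine MvPolynomial.IsHomogeneous.neg (isHomogeneous_coeff_prod_X_sub_C _ _ (fun v => ?_) ?_)
  · refine MvPolynomial.IsHomogeneous.sum _ _ _ fun j _ => ?_
    simpa using (MvPolynomial.isHomogeneous_C _ (v j)).mul (MvPolynomial.isHomogeneous_X (ZMod p) j)
  · have := Nat.pow_le_pow_right (Fact.out : p.Prime).pos s.2.le
    simp [ZMod.card]
    omega

theorem constantCoeff_dicksonCoeff (s : Fin n) :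
    MvPolynomial.constantCoeff (dicksonCoeff p n s) = 0 := by
  rw [MvPolynomial.constantCoeff_eq]
  refine (isHomogeneous_dicksonCoeff s).coeff_eq_zero ?_
  have := Nat.pow_lt_pow_right (Fact.out : p.Prime).one_lt s.2
  simp
  omega

omit [Fact p.Prime] in
theorem exists_xi_mem_degPart (s : Fin n) : ∃ d, xi p n s ∈ degPart p n d := by
  obtain ⟨e, he⟩ := exists_isHomogeneous_adjugate (isHomogeneous_moore (p := p)) s
  exact ⟨2 * e + 1, sum_mem fun j _ => mul_mem_degPart (incl_mem_degPart (he j))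
    (x_mem_degPart_one j)⟩

omit [Fact p.Prime] in
theorem exists_gen₁_mem_degPart (s : Fin n) : ∃ d, gen₁ p n s ∈ degPart p n d := by
  obtain ⟨e, he⟩ := exists_xi_mem_degPart (p := p) s
  exact ⟨_, mul_mem_degPart he (incl_mem_degPart ((isHomogeneous_det isHomogeneous_moore).pow _))⟩

omit [Fact p.Prime] in
theorem exists_gen₂_mem_degPart (s t : Fin n) : ∃ d, gen₂ p n s t ∈ degPart p n d := by
  obtain ⟨e, he⟩ := exists_xi_mem_degPart (p := p) s
  obtain ⟨e', he'⟩ := exists_xi_mem_degPart (p := p) t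
  exact ⟨_, mul_mem_degPart (mul_mem_degPart he he')
    (incl_mem_degPart ((isHomogeneous_det isHomogeneous_moore).pow _))⟩

end Homogeneous

/-! ### $SD_n$, its augmentation ideal and $I_n$ as graded submodules -/

section Graded

variable {p n : ℕ}

theorem iSup_inf_degPart_mul_le (N N' : Submodule (ZMod p) (Coh p n)) :
    (⨆ d, N ⊓ degPart p n d) * (⨆ d, N' ⊓ degPart p n d) ≤ ⨆ d, N * N' ⊓ degPart p n d := by
  rw [Submodule.iSup_mul]
  refine iSup_le fun a => ?_
  rw [Submodule.mul_iSup]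
  exact iSup_le fun b => le_iSup_of_le (a + b) (le_inf (mul_le_mul' inf_le_left inf_le_left)
    ((mul_le_mul' inf_le_right inf_le_right).trans (degPart_mul_degPart_le a b)))

theorem eq_iSup_inf_degPart_iff {N : Submodule (ZMod p) (Coh p n)} :
    N = ⨆ d, N ⊓ degPart p n d ↔ N ≤ ⨆ d, N ⊓ degPart p n d :=
  ⟨fun h => h.le, fun h => h.antisymm (iSup_le fun _ => inf_le_left)⟩

theorem graded_mul {N N' : Submodule (ZMod p) (Coh p n)} (h : N = ⨆ d, N ⊓ degPart p n d)
    (h' : N' = ⨆ d, N' ⊓ degPart p n d) : N * N' = ⨆ d, N * N' ⊓ degPart p n d :=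
  eq_iSup_inf_degPart_iff.2 ((mul_le_mul' h.le h'.le).trans (iSup_inf_degPart_mul_le N N'))

theorem mem_iSup_inf_degPart {N : Submodule (ZMod p) (Coh p n)} {z : Coh p n} {d : ℕ} (hN : z ∈ N)
    (hz : z ∈ degPart p n d) : z ∈ ⨆ d, N ⊓ degPart p n d :=
  Submodule.mem_iSup_of_mem d ⟨hN, hz⟩

variable [Fact p.Prime]

theorem SD_graded (hp : p ≠ 2) : Subalgebra.toSubmodule (SD p n) =
    ⨆ d, Subalgebra.toSubmodule (SD p n) ⊓ degPart p n d := by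
  refine eq_iSup_inf_degPart_iff.2 fun z hz => ?_
  let T : Submodule (ZMod p) (Coh p n) := ⨆ d, Subalgebra.toSubmodule (SD p n) ⊓ degPart p n d
  have hmul : ∀ a b, a ∈ T → b ∈ T → a * b ∈ T := fun a b ha hb => by
    have h := iSup_inf_degPart_mul_le _ _ (Submodule.mul_mem_mul ha hb)
    rwa [(SD p n).isIdempotentElem_toSubmodule.eq] at h
  have h1 : (1 : Coh p n) ∈ T :=
    mem_iSup_inf_degPart (one_mem (SD p n)) one_mem_degPart_zero
  refine SD_le hp (S := T.toSubalgebra h1 hmul) (fun s => ?_) (fun s => ?_) (fun s t => ?_) hz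
  · exact mem_iSup_inf_degPart (incl_dicksonCoeff_mem s)
      (incl_mem_degPart (isHomogeneous_dicksonCoeff s))
  · obtain ⟨d, hd⟩ := exists_gen₁_mem_degPart (p := p) s
    exact mem_iSup_inf_degPart (gen₁_mem s) hd
  · obtain ⟨d, hd⟩ := exists_gen₂_mem_degPart (p := p) s t
    exact mem_iSup_inf_degPart (gen₂_mem hp s t) hd

omit [Fact p.Prime] in
theorem iSup_degPart_succ_le_ker :
    (⨆ d, degPart p n (d + 1)) ≤ LinearMap.ker (augEval p n).toLinearMap :=
  iSup_le fun _ _ hz => augEval_eq_zero_of_mem_degPart hz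

theorem exists_algebraMap_add_of_mem_SD (hp : p ≠ 2) {z : Coh p n} (hz : z ∈ SD p n) :
    ∃ (c : ZMod p) (v : Coh p n), v ∈ SD p n ∧ v ∈ (⨆ d, degPart p n (d + 1)) ∧
      algebraMap (ZMod p) (Coh p n) c + v = z := by
  have h1 : (⨆ d, Subalgebra.toSubmodule (SD p n) ⊓ degPart p n (d + 1)) ≤
      ⨆ d, degPart p n (d + 1) :=
    iSup_le fun d => inf_le_right.trans (le_iSup (fun d => degPart p n (d + 1)) d)
  have h2 : (⨆ d, Subalgebra.toSubmodule (SD p n) ⊓ degPart p n (d + 1)) ≤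
      Subalgebra.toSubmodule (SD p n) := iSup_le fun d => inf_le_left
  have h : z ∈ Subalgebra.toSubmodule (SD p n) := hz
  rw [SD_graded hp, ← sup_iSup_nat_succ] at h
  obtain ⟨u, hu, v, hv, huv⟩ := Submodule.mem_sup.1 h
  obtain ⟨c, hc⟩ := exists_algebraMap_eq_of_mem_degPart_zero hu.2
  have h3 := h2 hv
  have h4 := h1 hv
  have h5 := (congrArg (· + v) hc).trans huv
  exact ⟨c, v, h3, h4, h5⟩

/-- Replaces the condition on degrees by the kernel of a ring homomorphism, which is easier to check
on products and on Steenrod operations. -/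
theorem mem_augSD_iff (hp : p ≠ 2) {z : Coh p n} :
    z ∈ augSD p n ↔ z ∈ SD p n ∧ augEval p n z = 0 := by
  refine ⟨fun hz => ⟨hz.1, iSup_degPart_succ_le_ker hz.2⟩, fun hz => ⟨hz.1, ?_⟩⟩
  obtain ⟨c, v, -, hv, rfl⟩ := exists_algebraMap_add_of_mem_SD hp hz.1
  have hev : augEval p n v = 0 := iSup_degPart_succ_le_ker hv
  have hc := hz.2
  rw [map_add, hev, add_zero, AlgHom.commutes, Algebra.algebraMap_self_apply] at hc
  rwa [hc, map_zero, zero_add]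

theorem augSD_eq (hp : p ≠ 2) : augSD p n =
    Subalgebra.toSubmodule (SD p n) ⊓ LinearMap.ker (augEval p n).toLinearMap :=
  Submodule.ext fun _ => mem_augSD_iff hp

theorem augSD_graded (hp : p ≠ 2) : augSD p n = ⨆ d, augSD p n ⊓ degPart p n d := by
  refine eq_iSup_inf_degPart_iff.2 fun z hz => ?_
  have h := (SD_graded hp).le hz.1
  rw [← sup_iSup_nat_succ] at h
  obtain ⟨u, hu, v, hv, rfl⟩ := Submodule.mem_sup.1 h
  have hle : (⨆ d, Subalgebra.toSubmodule (SD p n) ⊓ degPart p n (d + 1)) ≤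
      ⨆ d, augSD p n ⊓ degPart p n d :=
    iSup_le fun d => le_iSup_of_le (d + 1) (le_inf (inf_le_inf_left _ (le_iSup_of_le d le_rfl))
      inf_le_right)
  refine add_mem ?_ (hle hv)
  have hv' : v ∈ augSD p n := (hle.trans (iSup_le fun _ => inf_le_left)) hv
  exact mem_iSup_inf_degPart ((Submodule.add_mem_iff_left _ hv').1 hz) hu.2

variable [NeZero n]

theorem idealGens_graded (hp : p ≠ 2) : idealGens p n = ⨆ d, idealGens p n ⊓ degPart p n d := by
  refine eq_iSup_inf_degPart_iff.2 (idealGens_le hp ?_ (fun s => ?_) fun t => ?_)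
  · exact mem_iSup_inf_degPart incl_dicksonCoeff_zero_mem_idealGens
      (incl_mem_degPart (isHomogeneous_dicksonCoeff 0))
  · obtain ⟨d, hd⟩ := exists_gen₁_mem_degPart (p := p) s
    exact mem_iSup_inf_degPart (gen₁_mem_idealGens s) hd
  · obtain ⟨d, hd⟩ := exists_gen₂_mem_degPart (p := p) 0 t
    exact mem_iSup_inf_degPart (gen₂_mem_idealGens hp t) hd

theorem SD_isSteenrodSubmodule (hp : p ≠ 2) :
    IsSteenrodSubmodule p n (Subalgebra.toSubmodule (SD p n)) :=
  ⟨SD_graded hp, (SD_isSteenrodClosed hp).1, (SD_isSteenrodClosed hp).2⟩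

theorem augSD_isSteenrodSubmodule (hp : p ≠ 2) : IsSteenrodSubmodule p n (augSD p n) := by
  refine ⟨augSD_graded hp, ?_, ?_⟩
  · rw [augSD_eq hp]
    exact fun z hz => ⟨bockstein_SD_mem hp hz.1, augEval_bockstein z⟩
  · rw [augSD_eq hp]
    refine fun k z hz => ⟨power_SD_mem hp hz.1 k, (augEval_power k z).trans ?_⟩
    split_ifs
    · exact hz.2
    · rfl

theorem idealI_isSteenrodSubmodule (hp : p ≠ 2) : IsSteenrodSubmodule p n (idealI p n) := by
  refine ⟨?_, (idealI_isSteenrodClosed hp).1, (idealI_isSteenrodClosed hp).2⟩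
  rw [idealI_eq]
  exact graded_mul (graded_mul (SD_graded hp) (idealGens_graded hp)) (SD_graded hp)

theorem idealI_le_augSD (hp : p ≠ 2) : idealI p n ≤ augSD p n := by
  have hxi : ∀ s, exteriorAug p n (xi p n s) = 0 := fun s => by simp [xi]
  have hg : idealGens p n ≤ LinearMap.ker (augEval p n).toLinearMap := by
    refine idealGens_le hp ?_ (fun s => ?_) fun t => ?_
    · exact (augEval_apply _).trans (by rw [exteriorAug_incl, constantCoeff_dicksonCoeff])
    · exact (augEval_apply _).trans (by rw [gen₁, map_mul, hxi, zero_mul, map_zero])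
    · exact (augEval_apply _).trans (by rw [gen₂, map_mul (exteriorAug p n), map_mul (exteriorAug p n),
        hxi, zero_mul, zero_mul, map_zero])
  rw [augSD_eq hp, idealI_eq]
  refine le_inf ?_ ?_
  · refine (mul_le_mul' (mul_le_mul' le_rfl (idealGens_le_SD hp)) le_rfl).trans ?_
    rw [(SD p n).isIdempotentElem_toSubmodule.eq, (SD p n).isIdempotentElem_toSubmodule.eq]
  · refine Submodule.mul_le.2 fun u hu v _ => ?_
    suffices h : augEval p n u = 0 by
      change augEval p n (u * v) = 0
      rw [map_mul, h, zero_mul]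
    refine (Submodule.mul_le (P := LinearMap.ker (augEval p n).toLinearMap)).2
      (fun a _ b hb => ?_) hu
    change augEval p n (a * b) = 0
    rw [map_mul, show augEval p n b = 0 from hg hb, mul_zero]

end Graded

/-! ### Endomorphisms and atomicity -/

section Endomorphisms

variable {p n : ℕ} {N : Submodule (ZMod p) (Coh p n)}

theorem IsSteenrodEnd.one : IsSteenrodEnd (1 : N →ₗ[ZMod p] N) :=
  ⟨fun _ _ h => h, fun _ _ h => h, fun _ _ _ h => h⟩

theorem IsSteenrodEnd.mul {f g : N →ₗ[ZMod p] N} (hf : IsSteenrodEnd f) (hg : IsSteenrodEnd g) :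
    IsSteenrodEnd (f * g) :=
  ⟨fun d z h => hf.map_degree d _ (hg.map_degree d z h),
    fun z w h => hf.map_bockstein _ _ (hg.map_bockstein z w h),
    fun k z w h => hf.map_power k _ _ (hg.map_power k z w h)⟩

theorem IsSteenrodEnd.pow {f : N →ₗ[ZMod p] N} (hf : IsSteenrodEnd f) (m : ℕ) :
    IsSteenrodEnd (f ^ m) := by
  induction m with
  | zero => exact .one
  | succ m ih => rw [pow_succ]; exact ih.mul hf

theorem IsSteenrodEnd.sub {f g : N →ₗ[ZMod p] N} (hf : IsSteenrodEnd f) (hg : IsSteenrodEnd g) :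
    IsSteenrodEnd (f - g) := by
  refine ⟨fun d z h => ?_, fun z w h => ?_, fun k z w h => ?_⟩
  · exact sub_mem (hf.map_degree d z h) (hg.map_degree d z h)
  · rw [LinearMap.sub_apply, LinearMap.sub_apply, Submodule.coe_sub, Submodule.coe_sub,
      hf.map_bockstein z w h, hg.map_bockstein z w h, map_sub]
  · rw [LinearMap.sub_apply, LinearMap.sub_apply, Submodule.coe_sub, Submodule.coe_sub,
      hf.map_power k z w h, hg.map_power k z w h, map_sub]

/-- The kernel of `g` on the augmentation ideal. -/
def augKer (g : N →ₗ[ZMod p] N) : Submodule (ZMod p) (Coh p n) :=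
  (LinearMap.ker g ⊓ LinearMap.ker ((augEval p n).toLinearMap ∘ₗ N.subtype)).map N.subtype

theorem mem_augKer {g : N →ₗ[ZMod p] N} {z : Coh p n} :
    z ∈ augKer g ↔ ∃ hz : z ∈ N, g ⟨z, hz⟩ = 0 ∧ augEval p n z = 0 := by
  constructor
  · rintro ⟨z, hz, rfl⟩
    exact ⟨z.2, hz.1, hz.2⟩
  · rintro ⟨hz, h1, h2⟩
    exact ⟨⟨z, hz⟩, ⟨h1, h2⟩, rfl⟩

theorem surjective_of_forall_isIsoInDegree (hN : N = ⨆ d, N ⊓ degPart p n d)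
    {f : N →ₗ[ZMod p] N} (h : ∀ d, IsIsoInDegree f d) : Function.Surjective f := by
  have hle : N ≤ (LinearMap.range f).map N.subtype := by
    refine hN.le.trans (iSup_le fun d z hz => ?_)
    obtain ⟨w, -, hw⟩ := (h d).surjOn (show (⟨z, hz.1⟩ : N) ∈ _ from hz.2)
    exact ⟨f w, LinearMap.mem_range_self _ _, congrArg Subtype.val hw⟩
  intro z
  obtain ⟨w, ⟨u, rfl⟩, hw⟩ := hle z.2
  exact ⟨u, Subtype.ext hw⟩

variable [Fact p.Prime]

theorem augKer_isSteenrodClosed (hN : IsSteenrodSubmodule p n N) {g : N →ₗ[ZMod p] N}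
    (hg : IsSteenrodEnd g) : IsSteenrodClosed (augKer g) := by
  refine ⟨fun z hz => ?_, fun k z hz => ?_⟩
  · obtain ⟨hzN, h1, h2⟩ := mem_augKer.1 hz
    refine mem_augKer.2 ⟨hN.bockstein_mem z hzN, Subtype.ext ?_, augEval_bockstein z⟩
    rw [hg.map_bockstein ⟨z, hzN⟩ _ rfl, h1]
    exact map_zero _
  · obtain ⟨hzN, h1, h2⟩ := mem_augKer.1 hz
    refine mem_augKer.2 ⟨hN.power_mem k z hzN, Subtype.ext ?_, ?_⟩
    · rw [hg.map_power k ⟨z, hzN⟩ _ rfl, h1]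
      exact map_zero _
    · rw [augEval_power, h2, ite_self]

theorem finite_setOf_mem_degPart (N : Submodule (ZMod p) (Coh p n)) (d : ℕ) :
    {z : N | (z : Coh p n) ∈ degPart p n d}.Finite := by
  have : (degPart p n d : Set (Coh p n)).Finite := finite_degPart d
  exact this.preimage Subtype.val_injective.injOn

theorem IsIsoInDegree.exists_pow_eq {f : N →ₗ[ZMod p] N} {r : ℕ} (h : IsIsoInDegree f r) :
    ∃ m, 0 < m ∧ ∀ z : N, (z : Coh p n) ∈ degPart p n r → (f ^ m) z = z := by
  let e : Equiv.Perm {z : N | (z : Coh p n) ∈ degPart p n r} := h.equiv f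
  have : Finite {z : N | (z : Coh p n) ∈ degPart p n r} := finite_setOf_mem_degPart N r
  refine ⟨orderOf e, (isOfFinOrder_of_finite e).orderOf_pos, fun z hz => ?_⟩
  have hs : Function.Semiconj (Subtype.val : {z : N | (z : Coh p n) ∈ degPart p n r} → N) e f :=
    fun _ => rfl
  have h2 := (hs.iterate_right (orderOf e)) ⟨z, hz⟩
  rw [Equiv.Perm.iterate_eq_pow, pow_orderOf_eq_one] at h2
  rw [Module.End.pow_apply]
  exact h2.symm

variable [NeZero n]

/-- The comparison of $\ker f$ with $\ker(f^m-1)$: were both nonzero on the augmentation ideal, they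
would share a power of $D$, on which $f^m$ would be at once zero and the identity. -/
theorem augKer_eq_bot (hp : p ≠ 2) (hN : IsSteenrodSubmodule p n N)
    (hle : N ≤ Subalgebra.toSubmodule (SD p n)) {f : N →ₗ[ZMod p] N} (hf : IsSteenrodEnd f) {r : ℕ}
    (hr : IsLowestPositiveDegree N r) (hfr : IsIsoInDegree f r) : augKer f = ⊥ := by
  obtain ⟨m, hm, hfm⟩ := hfr.exists_pow_eq
  have key : ∀ g : N →ₗ[ZMod p] N, IsSteenrodEnd g → augKer g ≠ ⊥ →
      ∃ k, ∀ j ≥ k, incl p n (dicksonCoeff p n 0 ^ p ^ j) ∈ augKer g := by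
    intro g hg h0
    refine (augKer_isSteenrodClosed hN hg).exists_forall_dicksonCoeff_pow_mem hp (fun z hz => ?_)
      (fun z hz => ?_) h0 constantCoeff_dicksonCoeff
    · exact exteriorAug_mem_range hp (hle (mem_augKer.1 hz).1)
    · rw [← augEval_apply]
      exact (mem_augKer.1 hz).2.2
  by_contra h0
  obtain ⟨k, hk⟩ := key f hf h0
  -- Here $m$ is chosen with $f^m=1$ in degree $r$, so a nonzero element of degree $r$ witnesses
  -- that this kernel is nonzero; it has augmentation zero because $r>0$.
  obtain ⟨k', hk'⟩ := key (f ^ m - 1) ((hf.pow m).sub .one) (by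
    obtain ⟨z, hz, hz0⟩ := Submodule.exists_mem_ne_zero_of_ne_bot hr.1.2
    refine (Submodule.ne_bot_iff _).2 ⟨z, mem_augKer.2 ⟨hz.1, ?_, ?_⟩, hz0⟩
    · rw [LinearMap.sub_apply, hfm _ hz.2, Module.End.one_apply, sub_self]
    · obtain ⟨d, rfl⟩ := Nat.exists_eq_succ_of_ne_zero hr.1.1.ne'
      exact augEval_eq_zero_of_mem_degPart hz.2)
  obtain ⟨hw, h1, -⟩ := mem_augKer.1 (hk (max k k') (le_max_left _ _))
  obtain ⟨_, h2, -⟩ := mem_augKer.1 (hk' (max k k') (le_max_right _ _))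
  obtain ⟨m, rfl⟩ := Nat.exists_eq_succ_of_ne_zero hm.ne'
  have h3 := sub_eq_zero.1 ((LinearMap.sub_apply _ _ _).symm.trans h2)
  rw [Nat.succ_eq_add_one, pow_succ, Module.End.mul_apply, h1, map_zero] at h3
  replace h3 : incl p n (dicksonCoeff p n 0 ^ p ^ max k k') = 0 := congrArg Subtype.val h3.symm
  rw [← map_zero (incl p n)] at h3
  exact pow_ne_zero _ dicksonCoeff_zero_ne_zero (incl_injective h3)

theorem isIsoInDegree_of_pos (hp : p ≠ 2) (hN : IsSteenrodSubmodule p n N)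
    (hle : N ≤ Subalgebra.toSubmodule (SD p n)) {f : N →ₗ[ZMod p] N} (hf : IsSteenrodEnd f) {r : ℕ}
    (hr : IsLowestPositiveDegree N r) (hfr : IsIsoInDegree f r) {d : ℕ} (hd : 0 < d) :
    IsIsoInDegree f d := by
  obtain ⟨d, rfl⟩ := Nat.exists_eq_succ_of_ne_zero hd.ne'
  refine ((finite_setOf_mem_degPart N _).injOn_iff_bijOn_of_mapsTo
    fun z hz => hf.map_degree _ z hz).1 fun z hz w hw hzw => ?_
  have h : ((z - w : N) : Coh p n) ∈ augKer f :=
    mem_augKer.2 ⟨(z - w).2, (map_sub f z w).trans (sub_eq_zero.2 hzw),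
      augEval_eq_zero_of_mem_degPart (sub_mem hz hw)⟩
  rw [augKer_eq_bot hp hN hle hf hr hfr, Submodule.mem_bot] at h
  exact sub_eq_zero.1 (Subtype.ext h)

theorem isAtomicModule_of_le_augSD (hp : p ≠ 2) (hN : IsSteenrodSubmodule p n N)
    (hle : N ≤ augSD p n) : IsAtomicModule N := by
  intro f hf r hr hfr
  have hle' : N ≤ Subalgebra.toSubmodule (SD p n) := hle.trans inf_le_left
  have hinj : Function.Injective f := by
    rw [← LinearMap.ker_eq_bot, LinearMap.ker_eq_bot']
    intro z hz
    have h : (z : Coh p n) ∈ augKer f :=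
      mem_augKer.2 ⟨z.2, hz, ((mem_augSD_iff hp).1 (hle z.2)).2⟩
    rw [augKer_eq_bot hp hN hle' hf hr hfr, Submodule.mem_bot] at h
    exact Subtype.ext h
  exact ⟨hinj, surjective_of_forall_isIsoInDegree hN.graded fun d =>
    ((finite_setOf_mem_degPart N _).injOn_iff_bijOn_of_mapsTo
      fun z hz => hf.map_degree _ z hz).1 hinj.injOn⟩

omit [NeZero n] in
-- By linearity and the grading it suffices to look at homogeneous elements: in positive degree both
-- sides vanish, and degree $0$ consists of the multiples of $1$.
theorem augEval_map_SD (hp : p ≠ 2)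
    {f : Subalgebra.toSubmodule (SD p n) →ₗ[ZMod p] Subalgebra.toSubmodule (SD p n)}
    (hf : IsSteenrodEnd f) (z : Subalgebra.toSubmodule (SD p n)) :
    augEval p n (f z) = augEval p n z * augEval p n (f ⟨1, (SD p n).one_mem⟩) := by
  set e := augEval p n with he
  let S : Submodule (ZMod p) (Subalgebra.toSubmodule (SD p n)) := LinearMap.ker
    ((e.toLinearMap ∘ₗ (Subalgebra.toSubmodule (SD p n)).subtype ∘ₗ f) -
      e (f ⟨1, (SD p n).one_mem⟩) • (e.toLinearMap ∘ₗ (Subalgebra.toSubmodule (SD p n)).subtype))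
  have hS : ∀ z, z ∈ S ↔ e (f z) = e z * e (f ⟨1, (SD p n).one_mem⟩) := fun z => by
    rw [LinearMap.mem_ker, LinearMap.sub_apply, sub_eq_zero, mul_comm]
    rfl
  have hle : Subalgebra.toSubmodule (SD p n) ≤ S.map (Subalgebra.toSubmodule (SD p n)).subtype := by
    refine (SD_graded hp).le.trans (iSup_le fun d z hz => ?_)
    refine ⟨⟨z, hz.1⟩, (hS _).2 ?_, rfl⟩
    rcases d with _ | d
    · obtain ⟨c, hc⟩ := exists_algebraMap_eq_of_mem_degPart_zero hz.2
      have h : (⟨z, hz.1⟩ : Subalgebra.toSubmodule (SD p n)) = c • ⟨1, (SD p n).one_mem⟩ :=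
        Subtype.ext (hc.symm.trans (Algebra.algebraMap_eq_smul_one c))
      rw [h, map_smul, Submodule.coe_smul, Submodule.coe_smul, map_smul, map_smul, map_one,
        smul_eq_mul, smul_eq_mul, mul_one]
    · rw [he, augEval_eq_zero_of_mem_degPart (hf.map_degree _ ⟨z, hz.1⟩ hz.2),
        augEval_eq_zero_of_mem_degPart hz.2, zero_mul]
  obtain ⟨w, hw, hwz⟩ := hle z.2
  obtain rfl : w = z := Subtype.ext hwz
  exact (hS w).1 hw

theorem bijective_iff_map_one_ne_zero (hp : p ≠ 2)
    {f : Subalgebra.toSubmodule (SD p n) →ₗ[ZMod p] Subalgebra.toSubmodule (SD p n)}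
    (hf : IsSteenrodEnd f) {r : ℕ}
    (hr : IsLowestPositiveDegree (Subalgebra.toSubmodule (SD p n)) r) (hfr : IsIsoInDegree f r) :
    Function.Bijective f ↔ f ⟨1, (SD p n).one_mem⟩ ≠ 0 := by
  constructor
  · intro h h1
    have h2 : (1 : Coh p n) = 0 := congrArg Subtype.val (h.1 (h1.trans (map_zero f).symm))
    have h3 := congrArg (augEval p n) h2
    rw [map_one, map_zero] at h3
    exact one_ne_zero h3
  · intro h1
    have hone : augEval p n (f ⟨1, (SD p n).one_mem⟩) ≠ 0 := by
      intro h0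
      obtain ⟨c, hc⟩ := exists_algebraMap_eq_of_mem_degPart_zero
        (hf.map_degree 0 ⟨1, (SD p n).one_mem⟩ one_mem_degPart_zero)
      rw [← hc, AlgHom.commutes, Algebra.algebraMap_self_apply] at h0
      rw [h0, map_zero] at hc
      exact h1 (Subtype.ext hc.symm)
    have hinj : Function.Injective f := by
      rw [← LinearMap.ker_eq_bot, LinearMap.ker_eq_bot']
      intro z hz
      -- Because $f(1)$ is a nonzero scalar, an element of $\ker f$ has augmentation zero and is
      -- subject to the result on the augmentation ideal.
      have hz0 := augEval_map_SD hp hf z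
      rw [hz, Submodule.coe_zero, map_zero, eq_comm, mul_eq_zero, or_iff_left hone] at hz0
      have h : (z : Coh p n) ∈ augKer f := mem_augKer.2 ⟨z.2, hz, hz0⟩
      rw [augKer_eq_bot hp (SD_isSteenrodSubmodule hp) le_rfl hf hr hfr, Submodule.mem_bot] at h
      exact Subtype.ext h
    exact ⟨hinj, surjective_of_forall_isIsoInDegree (SD_graded hp) fun d =>
      ((finite_setOf_mem_degPart _ _).injOn_iff_bijOn_of_mapsTo
        fun z hz => hf.map_degree _ z hz).1 hinj.injOn⟩

end Endomorphisms

end DicksonAtomic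

end

theorem mainTheorem6 (p n : ℕ) [Fact p.Prime] (hp : p ≠ 2) (hn : 1 ≤ n) :
    (DicksonAtomic.IsSteenrodSubmodule p n (Subalgebra.toSubmodule (DicksonAtomic.SD p n)) ∧
      DicksonAtomic.IsSteenrodSubmodule p n (DicksonAtomic.augSD p n) ∧
      DicksonAtomic.IsAtomicModule (DicksonAtomic.augSD p n) ∧
      ∀ f : Subalgebra.toSubmodule (DicksonAtomic.SD p n) →ₗ[ZMod p]
          Subalgebra.toSubmodule (DicksonAtomic.SD p n),
        DicksonAtomic.IsSteenrodEnd f →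
        ∀ r, DicksonAtomic.IsLowestPositiveDegree
            (Subalgebra.toSubmodule (DicksonAtomic.SD p n)) r →
          DicksonAtomic.IsIsoInDegree f r →
          (∀ d, 0 < d → DicksonAtomic.IsIsoInDegree f d) ∧
            (Function.Bijective f ↔ f ⟨1, (DicksonAtomic.SD p n).one_mem⟩ ≠ 0)) ∧
    (DicksonAtomic.IsSteenrodSubmodule p n (DicksonAtomic.idealI p n) ∧
      DicksonAtomic.IsAtomicModule (DicksonAtomic.idealI p n)) := by
  have : NeZero n := ⟨by omega⟩
  have hSD := DicksonAtomic.SD_isSteenrodSubmodule (p := p) (n := n) hp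
  have haug := DicksonAtomic.augSD_isSteenrodSubmodule (p := p) (n := n) hp
  have hI := DicksonAtomic.idealI_isSteenrodSubmodule (p := p) (n := n) hp
  exact ⟨⟨hSD, haug, DicksonAtomic.isAtomicModule_of_le_augSD hp haug le_rfl,
    fun _ hf _ hr hfr => ⟨fun _ hd => DicksonAtomic.isIsoInDegree_of_pos hp hSD le_rfl hf hr hfr hd,
      DicksonAtomic.bijective_iff_map_one_ne_zero hp hf hr hfr⟩⟩,
    hI, DicksonAtomic.isAtomicModule_of_le_augSD hp hI (DicksonAtomic.idealI_le_augSD hp)⟩
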